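/- **Many-to-one posets and DFC.** A *many-to-one poset* is a finite set $C$ of cells with a dimension function $\dim:C\to\mathbb N\cup\{-1\}$ (write $C_k=\dim^{-1}(k)$) and maps $\delta,\gamma:C_{k+1}\to\mathcal P(C_k)$ ($k\ge-1$) such that $\gamma(x)$ is a singleton if $\dim x\ge 0$; $\delta(x)\cap\gamma(x)\ne\emptyset$ implies $\delta(x)=\gamma(x)$; there is exactly one cell $\ast$ of dimension $-1$, and $\gamma(x)\setminus\delta(x)=\{\ast\}$ if $\dim x=0$. Write $y\prec^{-}x$, $y\prec^{+}x$, $y\prec^{\circ}x$ for $y\in\delta(x)\setminus\gamma(x)$, $y\in\gamma(x)\setminus\delta(x)$, $y\in\delta(x)\cap\gamma(x)$ respectively (in the last case $x$ is a *loop* on $y$), $y\prec x$ for $y\in\delta(x)\cup\gamma(x)$, and compute with the signs $+,-,\circ$ as with $1,-1,0$. Let $\Lambda$ be the set of cells $x$ with $x\prec^+w$ for no $w$, $\Lambda_k=\Lambda\cap C_k$, and $N=\{x\mid\delta(x)=\emptyset\}$. Moreover, for each $x\in\Lambda$ and each $z$, a strict total order $\triangleleft$ (the *local order*) on $\{y\mid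 z\prec^{\circ}y\prec^-x\}$ is given. A morphism is a map of cells that preserves dimensions, local orders and targets, $f(\gamma(x))=\gamma(f(x))$, and restricts to bijections $\delta(x)\to\delta(f(x))$. A *dendritic face complex* (DFC) is a many-to-one poset such that: (1) there is a greatest cell $\omega$, for the reflexive transitive closure of $\prec$, and $\dim\omega>0$; (2) if $z\prec^{\circ}y$ then $y\prec^+x$ for some $x$; (3) if $z\prec^\beta y\prec^\alpha x$ with $\alpha,\beta\in\{+,-\}$, there is a unique $y'\ne y$ with $z\prec^{\beta'}y'\prec^{\alpha'}x$ for some $\alpha',\beta'\in\{+,-\}$, and $\alpha\beta=-\alpha'\beta'$; (4) if $z\prec^{\circ}y\prec^-x$, there is $y'\ne y$ with $z\prec^\beta y'\prec^\alpha x$ and $(\alpha,\beta)\ne(-,\circ)$; (5) for $\dim x\ge1$ there is no cyclic sequence $y_1,\dots,y_p,y_{p+1}=y_1$ ($p\ge 1$) of cells $y_i\prec^-x$ with $y_i\succ^-\gamma(y_{i+1})\prec^+y_{i+1}$ for all $i$. Its dimension is $n=\dim\omega$; $\gamma^{(k)}\omega\in C_k$ denotes the iterated target of $\omega$. $\mathbf{DFC}^{\mathsf{core}}$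 is the groupoid of DFC and their isomorphisms. **Loop orders.** For $a\in\Lambda$, $c\prec^{\circ}b\prec^+a$ and $c\prec^{\circ}b'\prec^-a$ write $b'\subset b$, and let $\subseteq$ be the reflexive transitive closure. For a cell $c$, let $a\to_c a'$ if $a,a'\in\Lambda$ and some $b$ satisfies either $c\prec^-b$, $b\prec^+a$, $b\prec^-a'$, or $c\prec^+b$, $b\prec^-a$, $b\prec^+a'$; let $<_c$ be the transitive closure of $\to_c$. Put $b_1\blacktriangleleft^1b_1'$ if $b_1\subseteq b$, $b_1'\subseteq b'$ for some $c\prec^{\circ}b\prec^-a$, $c\prec^{\circ}b'\prec^-a'$ with $a<_ca'$. Let $V(c)$ be the set of $b$ with $c\prec^{\circ}b\prec^+a$ for some $a\in\Lambda\cap N$. For distinct $b,b'\in V(c)$ not comparable by $\blacktriangleleft^1$, put $b\blacktriangleleft^2b'$ if there are $a''\in\Lambda$ and $d\ne d'$ with $c\prec^{\circ}d\prec^-a''$, $c\prec^{\circ}d'\prec^-a''$, $b\subseteq d$, $b'\subseteq d'$ and $d\triangleleft d'$. The loop total order on $V(c)$ is $\blacktriangleleft\,=\,\blacktriangleleft^1\cup\blacktriangleleft^2$.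 For $W(c)=\{w\in\Lambda\cap N\mid\gamma^2(w)=c\}$ put $w\blacktriangleleft w'$ if $\gamma(w)\blacktriangleleft\gamma(w')$ in $V(c)$. **Opetopes.** A *rooted tree* $T$ has a finite set of nodes and a finite set of edges; each node has exactly one target edge, each edge has at most one source node (it is the target edge of at most one node) and at most one target node (it is then a source edge of that node); there is a root edge without target node, reached from every edge by a descending path (passing to targets). A leaf is an edge without source node, a nulldot is a node without source edges. A *subdivision* $T'$ of $T$ is a finite totally ordered set $W(b)$ for each edge $b$; its blackdots are the nodes of $T$, its whitedots the elements of $\bigsqcup_bW(b)$; each edge $b$ is replaced by a linear tree on $W(b)$, with smaller elements closer to the root. A *constellation* $T\to U$ is a subdivision $T'$ of $T$ with bijections $\sigma$ from the blackdots of $T'$ to the leaves of $U$ and from the whitedots of $T'$ to the nulldots of $U$ satisfying the kernel rule: for each node $x$ of $U$, the dots $t$ of $T'$ with a descending path from $\sigma(t)$ to $x$ in $U$ induce a connected full subgraph of $T'$. It is *exact* if the bijections are identities. An *$n$-opetope* is a sequence $T_0\to T_1\to\dots\to T_n$ of rooted trees and exact constellations such that $T_0$, and $T_1$ if $n\ge1$,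 have one node and one leaf, and, if $n\ge2$, $T_2$ is linear (each node has exactly one source edge). An isomorphism of opetopes of the same dimension is a sequence of isomorphisms of (subdivided, rooted) trees compatible with the bijections of the constellations. $\mathbf{KJBM}$ is the category of opetopes and their isomorphisms. **Theorem.** There is a functor $Z:\mathbf{DFC}^{\mathsf{core}}\to\mathbf{KJBM}$ with the following properties. * For a DFC $C$ of dimension $n$, $Z(C)=(T_0\to T_1\to\dots\to T_n)$ is an $n$-opetope in which, for $2\le k\le n$, the nodes of $T_k$ are the elements of $\Lambda_{k-1}$, the edges of $T_k$ are the elements of $C_{k-2}$, an edge $y$ is a source of a node $x$ if and only if $y\prec^-x$, it is the target of $x$ if and only if $y\prec^+x$, and the root edge is $\gamma^{(k-2)}\omega$; for $2\le k<n$, the subdivision of $T_k$ in the constellation $T_k\to T_{k+1}$ is $y\mapsto W(y)$, ordered by $\blacktriangleleft$. The node of $T_1$ is the unique element of $\Lambda_0$ (the rest of $T_0$ and $T_1$ is determined up to renaming). * For an isomorphism $f:C\to D$ of DFC, the isomorphism of opetopes $Z(f):Z(C)\to Z(D)$ is given by $f$ on the nodes of $T_1$ and on the nodes, edges and whitedots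 of $T_k$ for $k\ge2$ (on the rest of $T_0$ and $T_1$ it is the only possible isomorphism). -/

import Mathlib

open CategoryTheory

universe u

/-! ## Many-to-one posets -/

/-- The cells of a many-to-one poset with their dimensions, source sets `δ` and target sets `γ`
(everything except the local orders). Since all dimensions are at least `-1`, the fields
`dim_of_mem_δ` and `dim_of_mem_γ` say that `δ` and `γ` send a cell of dimension `k + 1` to sets of
cells of dimension `k`, and that they are empty (that is, absent) on cells of dimension `-1`. -/
structure FacetPoset where
  Cell : Type u
  finite : Finite Cell
  dim : Cell → ℤ
  neg_one_le_dim : ∀ x, -1 ≤ dim x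
  δ : Cell → Set Cell
  γ : Cell → Set Cell
  dim_of_mem_δ : ∀ x y, y ∈ δ x → dim y + 1 = dim x
  dim_of_mem_γ : ∀ x y, y ∈ γ x → dim y + 1 = dim x
  γ_singleton : ∀ x, 0 ≤ dim x → ∃ y, γ x = {y}
  δ_eq_γ : ∀ x, (δ x ∩ γ x).Nonempty → δ x = γ x
  existsUnique_bot : ∃! x, dim x = -1
  γ_diff_δ_of_dim_zero : ∀ b x, dim b = -1 → dim x = 0 → γ x \ δ x = {b}

namespace FacetPoset

variable (P : FacetPoset.{u})

/-- `y ≺⁺ x`: `y` is the target of `x` and not a source of `x`. -/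
def Pos (y x : P.Cell) : Prop := y ∈ P.γ x \ P.δ x

/-- `y ≺⁻ x`: `y` is a source of `x` and not the target of `x`. -/
def Neg (y x : P.Cell) : Prop := y ∈ P.δ x \ P.γ x

/-- `y ≺ᵒ x`: `y` is both a source and the target of `x`, that is, `x` is a loop on `y`. -/
def Loop (y x : P.Cell) : Prop := y ∈ P.δ x ∩ P.γ x

/-- `y ≺^α x` for a sign `α ∈ {+, -, o} = {1, -1, 0}`. -/
def Facet : SignType → P.Cell → P.Cell → Prop
  | .pos => P.Pos
  | .neg => P.Neg
  | .zero => P.Loop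

/-- The partial order on cells: the reflexive transitive closure of `y ≺ x`. -/
def Le : P.Cell → P.Cell → Prop :=
  Relation.ReflTransGen fun y x => y ∈ P.δ x ∪ P.γ x

/-- `ω` is the greatest element. -/
def IsGreatestCell (ω : P.Cell) : Prop := ∀ x, P.Le x ω

/-- `Λ`: the cells `x` for which there is no `w` with `x ≺⁺ w`. -/
def Lam : Set P.Cell := {x | ∀ w, ¬ P.Pos x w}

/-- `N`: the cells without sources. -/
def Null : Set P.Cell := {x | P.δ x = ∅}

/-- `n` is the dimension of `P`, the maximum of the dimensions of its cells. -/
def HasDim (n : ℕ) : Prop := IsGreatest (Set.range P.dim) (n : ℤ)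

/-- `x` is an iterated target of the greatest element `ω`; the one of dimension `k` is
`γ^(k)(ω)`. -/
def IsIteratedTarget (x : P.Cell) : Prop :=
  ∃ ω, P.IsGreatestCell ω ∧ Relation.ReflTransGen (fun y z => z ∈ P.γ y) ω x

/-- One step of a cycle inside the sources of `x`: `y ≻⁻ z ≺⁺ y'` with `y, y' ≺⁻ x`. -/
def CycleStep (x y y' : P.Cell) : Prop :=
  P.Neg y x ∧ P.Neg y' x ∧ ∃ z, P.Neg z y ∧ P.Pos z y'

end FacetPoset

/-- Many-to-one posets. The relation `LocalLT x` is the disjoint union, over all `z`, of the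
(strict) local orders on the sets `{y | z ≺ᵒ y ≺⁻ x}`, for `x ∈ Λ`; it relates nothing else.
(A `z` with `z ≺ᵒ y ≺⁻ x` is in `∂²(x)`, and it is determined by `y`.) -/
structure MOP extends FacetPoset.{u} where
  LocalLT : Cell → Cell → Cell → Prop
  localLT_supp : ∀ x y y', LocalLT x y y' → x ∈ toFacetPoset.Lam ∧
    ∃ z, (toFacetPoset.Loop z y ∧ toFacetPoset.Neg y x) ∧
      (toFacetPoset.Loop z y' ∧ toFacetPoset.Neg y' x)
  localLT_total : ∀ x ∈ toFacetPoset.Lam, ∀ z,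
    IsStrictTotalOrder {y // toFacetPoset.Loop z y ∧ toFacetPoset.Neg y x}
      (fun y y' => LocalLT x y y')

namespace MOP

/-- Morphisms of many-to-one posets. -/
@[ext]
structure Hom (C D : MOP.{u}) where
  toFun : C.Cell → D.Cell
  map_dim : ∀ x, D.dim (toFun x) = C.dim x
  bijOn_δ : ∀ x, 0 ≤ C.dim x → Set.BijOn toFun (C.δ x) (D.δ (toFun x))
  map_γ : ∀ x, 0 ≤ C.dim x → toFun '' C.γ x = D.γ (toFun x)
  map_localLT : ∀ x y y', C.LocalLT x y y' → D.LocalLT (toFun x) (toFun y) (toFun y')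

/-- The category of many-to-one posets. -/
instance : Category MOP.{u} where
  Hom := Hom
  id C :=
    { toFun := id
      map_dim := fun _ => rfl
      bijOn_δ := fun _ _ => Set.bijOn_id _
      map_γ := fun _ _ => Set.image_id _
      map_localLT := fun _ _ _ h => h }
  comp {C D E} f g :=
    { toFun := g.toFun ∘ f.toFun
      map_dim := fun x => (g.map_dim _).trans (f.map_dim x)
      bijOn_δ := fun x hx =>
        (g.bijOn_δ (f.toFun x) ((f.map_dim x).symm ▸ hx)).comp (f.bijOn_δ x hx)
      map_γ := fun x hx => by
        rw [Set.image_comp, f.map_γ x hx, g.map_γ (f.toFun x) ((f.map_dim x).symm ▸ hx)]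
        rfl
      map_localLT := fun x y y' h => g.map_localLT _ _ _ (f.map_localLT x y y' h) }

/-! ### Dendritic face complexes -/

/-- A many-to-one poset is a dendritic face complex. -/
structure IsDFC (C : MOP.{u}) : Prop where
  greatest : ∃ ω, C.IsGreatestCell ω ∧ 0 < C.dim ω
  loops : ∀ z y, C.Loop z y → ∃ x, C.Pos y x
  /-- Lozenge completion, the completion being unique among the chains with signs in `{+, -}`. -/
  thin : ∀ (α β : SignType) (z y x : C.Cell), α ≠ 0 → β ≠ 0 → C.Facet β z y → C.Facet α y x →
    ∃! y', y' ≠ y ∧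
      ∃ α' β' : SignType, α' ≠ 0 ∧ β' ≠ 0 ∧ C.Facet β' z y' ∧ C.Facet α' y' x
  /-- The sign rule. -/
  sign : ∀ (α β α' β' : SignType) (z y y' x : C.Cell),
    α ≠ 0 → β ≠ 0 → α' ≠ 0 → β' ≠ 0 → y' ≠ y →
    C.Facet β z y → C.Facet α y x → C.Facet β' z y' → C.Facet α' y' x →
    α * β = -(α' * β')
  thin_loop : ∀ z y x, C.Loop z y → C.Neg y x →
    ∃ (y' : C.Cell) (α β : SignType), y' ≠ y ∧ C.Facet β z y' ∧ C.Facet α y' x ∧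
      (α, β) ≠ (-1, 0)
  acyclic : ∀ x, 1 ≤ C.dim x → ∀ y, ¬ Relation.TransGen (C.CycleStep x) y y

/-! ### The order of loops -/

variable (C : MOP.{u})

/-- `b' ⊂ b`: there are `c` and `a ∈ Λ` with `c ≺ᵒ b ≺⁺ a` and `c ≺ᵒ b' ≺⁻ a`. -/
def LoopIncl (b' b : C.Cell) : Prop :=
  ∃ c a, a ∈ C.Lam ∧ (C.Loop c b ∧ C.Pos b a) ∧ (C.Loop c b' ∧ C.Neg b' a)

/-- `b' ⊆ b`: the reflexive transitive closure of `⊂`. -/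
def LoopInclEq : C.Cell → C.Cell → Prop := Relation.ReflTransGen C.LoopIncl

/-- `a`, `a'` are two consecutive upper vertices `aᵢ`, `aᵢ₊₁` of the zig-zag over `c` that lists
all the chains `c ≺^± b ≺^± a ∈ Λ`: on its left part they are linked by some `b` with `c ≺⁻ b` and
`a ≻⁺ b ≺⁻ a'`, on its right part by some `b` with `c ≺⁺ b` and `a ≻⁻ b ≺⁺ a'`. -/
def ZigStep (c a a' : C.Cell) : Prop :=
  a ∈ C.Lam ∧ a' ∈ C.Lam ∧
    ∃ b, (C.Neg c b ∧ C.Pos b a ∧ C.Neg b a') ∨ (C.Pos c b ∧ C.Neg b a ∧ C.Pos b a')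

/-- The loops order `◂¹`, for loops on `c`. -/
def LoopLT₁ (c b₁ b₁' : C.Cell) : Prop :=
  ∃ a a' b b', Relation.TransGen (C.ZigStep c) a a' ∧
    (C.Loop c b ∧ C.Neg b a) ∧ (C.Loop c b' ∧ C.Neg b' a') ∧
    C.LoopInclEq b₁ b ∧ C.LoopInclEq b₁' b'

/-- `V(c)`: the loops `b` on `c` with `c ≺ᵒ b ≺⁺ a` for some `a ∈ Λ ∩ N`. -/
def MinLoops (c : C.Cell) : Set C.Cell :=
  {b | C.Loop c b ∧ ∃ a ∈ C.Lam ∩ C.Null, C.Pos b a}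

/-- The order `◂²` on `V(c)`: two loops that are not comparable by `◂¹` are compared by the local
order at the cell `a'' ∈ Λ` where the paths that start from them meet. -/
def LoopLT₂ (c b b' : C.Cell) : Prop :=
  b ∈ C.MinLoops c ∧ b' ∈ C.MinLoops c ∧ b ≠ b' ∧
    ¬ C.LoopLT₁ c b b' ∧ ¬ C.LoopLT₁ c b' b ∧
    ∃ a'' ∈ C.Lam, ∃ d d', d ≠ d' ∧
      (C.Loop c d ∧ C.Neg d a'') ∧ (C.Loop c d' ∧ C.Neg d' a'') ∧
      C.LoopInclEq b d ∧ C.LoopInclEq b' d' ∧ C.LocalLT a'' d d'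

/-- The loops total order `◂` on `V(c)`. -/
def LoopLT (c b b' : C.Cell) : Prop :=
  b ∈ C.MinLoops c ∧ b' ∈ C.MinLoops c ∧ (C.LoopLT₁ c b b' ∨ C.LoopLT₂ c b b')

/-- `W(c) = {w ∈ Λ ∩ N | γ²(w) = c}`. -/
def White (c : C.Cell) : Set C.Cell :=
  {w | w ∈ C.Lam ∩ C.Null ∧ ∃ b ∈ C.γ w, c ∈ C.γ b}

/-- The order on `W(c)`: `w` is below `w'` if `γ(w) ◂ γ(w')`. -/
def WhiteLT (c w w' : C.Cell) : Prop :=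
  ∃ b ∈ C.γ w, ∃ b' ∈ C.γ w', C.LoopLT c b b'

end MOP

/-- The category of dendritic face complexes, a full subcategory of `MOP`. -/
abbrev DFC := ObjectProperty.FullSubcategory (C := MOP.{u}) MOP.IsDFC

/-! ## Rooted trees

The nodes and edges of the trees, and the whitedots of the subdivisions, are named by elements of a
type `α`, so that it makes sense for the structural maps of a constellation to be identities. -/

/-- Rooted trees with nodes and edges named in `α`. -/
structure DotTree (α : Type u) where
  nodes : Finset α
  edges : Finset α
  /-- The target edge of a node. -/
  target : nodes → edges
  /-- The target node of an edge, if there is one. -/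
  targetNode : edges → Option nodes
  /-- An edge has at most one source node. -/
  target_injective : Function.Injective target
  root : edges
  targetNode_root : targetNode root = none
  /-- There is a descending path from every edge to the root. -/
  exists_path : ∀ b : edges,
    Relation.ReflTransGen (fun b b' => ∃ a, targetNode b = some a ∧ target a = b') b root

namespace DotTree

variable {α : Type u} (T : DotTree α)

/-- An edge without source node. -/
def IsLeaf (b : T.edges) : Prop := ∀ a, T.target a ≠ b

/-- A node without source edges. -/
def IsNulldot (a : T.nodes) : Prop := ∀ b, T.targetNode b ≠ some a

/-- `T.Next x x'`: `x'` is the target of `x`, for `x`, `x'` nodes or edges. -/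
inductive Next : T.nodes ⊕ T.edges → T.nodes ⊕ T.edges → Prop
  | node (a : T.nodes) : Next (.inl a) (.inr (T.target a))
  | edge (b : T.edges) (a : T.nodes) : T.targetNode b = some a → Next (.inr b) (.inl a)

/-- `x ⊑ x'`: there is a descending path from `x` to `x'`. -/
def Descends : T.nodes ⊕ T.edges → T.nodes ⊕ T.edges → Prop := Relation.ReflTransGen T.Next

/-- The tree has one root, one leaf and one node. -/
def IsUnary : Prop := T.nodes.card = 1 ∧ ∃! b, T.IsLeaf b

/-- The tree is linear: every node has exactly one source edge. -/
def IsLinear : Prop := ∀ a, ∃! b, T.targetNode b = some a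

/-- Isomorphisms of rooted trees. -/
@[ext]
structure Iso {α β : Type u} (T : DotTree α) (U : DotTree β) where
  node : T.nodes ≃ U.nodes
  edge : T.edges ≃ U.edges
  map_target : ∀ a, edge (T.target a) = U.target (node a)
  map_targetNode : ∀ b, (T.targetNode b).map node = U.targetNode (edge b)
  map_root : edge T.root = U.root

/-- The identity isomorphism. -/
def Iso.refl : T.Iso T where
  node := Equiv.refl _
  edge := Equiv.refl _
  map_target _ := rfl
  map_targetNode _ := by simp
  map_root := rfl

/-- The composite of two isomorphisms. -/
def Iso.trans {α β κ : Type u} {T : DotTree α} {U : DotTree β} {V : DotTree κ}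
    (f : T.Iso U) (g : U.Iso V) : T.Iso V where
  node := f.node.trans g.node
  edge := f.edge.trans g.edge
  map_target a := by simp [f.map_target, g.map_target]
  map_targetNode b := by
    simp only [Equiv.trans_apply, ← g.map_targetNode, ← f.map_targetNode, Option.map_map]
    rfl
  map_root := by simp [f.map_root, g.map_root]

/-- A subdivision: a finite totally ordered set `W b` for each edge `b`. -/
structure Subdivision where
  W : T.edges → Finset α
  lt : ∀ b, W b → W b → Prop
  lt_total : ∀ b, IsStrictTotalOrder (W b) (lt b)

namespace Subdivision

variable {T} (S : T.Subdivision)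

/-- The whitedots: the disjoint union of the sets `W b`. -/
abbrev Whitedot := Σ b : T.edges, S.W b

/-- The dots: blackdots (the nodes) and whitedots. -/
abbrev Dot := T.nodes ⊕ S.Whitedot

/-- The first whitedot is below the second one, on the same edge. -/
inductive WhiteLT : S.Whitedot → S.Whitedot → Prop
  | mk (b : T.edges) (w w' : S.W b) : S.lt b w w' → WhiteLT ⟨b, w⟩ ⟨b, w'⟩

/-- `S.Step d d'`: in the rooted tree obtained by replacing each edge `b` by the linear tree on
`W b` (in increasing order, the least element being the closest to the root), some edge has target
node `d` and source node `d'`. -/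
inductive Step : S.Dot → S.Dot → Prop
  | node_node (b : T.edges) (a a' : T.nodes) : T.targetNode b = some a → T.target a' = b →
      S.W b = ∅ → Step (.inl a) (.inl a')
  | node_white (b : T.edges) (a : T.nodes) (w : S.W b) : T.targetNode b = some a →
      (∀ v, ¬ S.lt b v w) → Step (.inl a) (.inr ⟨b, w⟩)
  | white_white (b : T.edges) (w w' : S.W b) : S.lt b w w' →
      (∀ v, ¬ (S.lt b w v ∧ S.lt b v w')) → Step (.inr ⟨b, w⟩) (.inr ⟨b, w'⟩)
  | white_node (b : T.edges) (w : S.W b) (a' : T.nodes) : T.target a' = b →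
      (∀ v, ¬ S.lt b w v) → Step (.inr ⟨b, w⟩) (.inl a')

/-- The graph on the dots of the subdivided tree. -/
def graph : SimpleGraph S.Dot := SimpleGraph.fromRel S.Step

end Subdivision

end DotTree

/-! ## Constellations, zoom complexes and opetopes -/

/-- Constellations from `T` to `U`. -/
structure Constellation {α : Type u} (T U : DotTree α) where
  sub : T.Subdivision
  σBlack : T.nodes ≃ {b : U.edges // U.IsLeaf b}
  σWhite : sub.Whitedot ≃ {a : U.nodes // U.IsNulldot a}
  /-- The kernel rule. -/
  kernel : ∀ x : U.nodes, (sub.graph.induce {t | U.Descends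
    (Sum.elim (fun a => .inr (σBlack a).1) (fun w => .inl (σWhite w).1) t) (.inl x)}).Connected

/-- A constellation is exact when its structural maps are identities. -/
def Constellation.IsExact {α : Type u} {T U : DotTree α} (K : Constellation T U) : Prop :=
  (∀ a, ((K.σBlack a).1 : α) = a) ∧ ∀ w, ((K.σWhite w).1 : α) = w.2

/-- Zoom complexes `T₀ ⟶ T₁ ⟶ ⋯ ⟶ Tₙ` of degree `n`. -/
structure ZoomComplex (α : Type u) (n : ℕ) where
  tree : ∀ k, k ≤ n → DotTree α
  con : ∀ (k : ℕ) (h : k + 1 ≤ n), Constellation (tree k (Nat.le_of_succ_le h)) (tree (k + 1) h)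

/-- `n`-opetopes. -/
structure Opetope (α : Type u) (n : ℕ) extends ZoomComplex α n where
  exact : ∀ k h, (con k h).IsExact
  unary_zero : (tree 0 (Nat.zero_le n)).IsUnary
  unary_one : ∀ h : 1 ≤ n, (tree 1 h).IsUnary
  linear_two : ∀ h : 2 ≤ n, (tree 2 h).IsLinear

/-- Objects of the category of opetopes. -/
structure KJBM where
  Name : Type u
  dim : ℕ
  opetope : Opetope Name dim

namespace KJBM

/-- The tree `Tₖ` of an opetope. -/
abbrev tree (Y : KJBM.{u}) (k : ℕ) (h : k ≤ Y.dim) : DotTree Y.Name := Y.opetope.tree k h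

/-- The constellation from `Tₖ` to `Tₖ₊₁` of an opetope. -/
abbrev con (Y : KJBM.{u}) (k : ℕ) (h : k + 1 ≤ Y.dim) :
    Constellation (Y.tree k (Nat.le_of_succ_le h)) (Y.tree (k + 1) h) := Y.opetope.con k h

/-- Isomorphisms of opetopes of the same dimension: sequences of isomorphisms of (subdivided) trees,
compatible with the structural maps of the constellations. -/
@[ext]
structure Hom (X Y : KJBM.{u}) where
  dim_eq : X.dim = Y.dim
  tree : ∀ k (h : k ≤ X.dim), (X.tree k h).Iso (Y.tree k (dim_eq ▸ h))
  white : ∀ k (h : k + 1 ≤ X.dim),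
    (X.con k h).sub.Whitedot ≃ (Y.con k (dim_eq ▸ h)).sub.Whitedot
  white_edge : ∀ k h w, (white k h w).1 = (tree k (Nat.le_of_succ_le h)).edge w.1
  white_lt : ∀ k h w w', (X.con k h).sub.WhiteLT w w' ↔
    (Y.con k (dim_eq ▸ h)).sub.WhiteLT (white k h w) (white k h w')
  map_σBlack : ∀ k (h : k + 1 ≤ X.dim) a, (tree (k + 1) h).edge ((X.con k h).σBlack a).1 =
    ((Y.con k (dim_eq ▸ h)).σBlack ((tree k (Nat.le_of_succ_le h)).node a)).1
  map_σWhite : ∀ k (h : k + 1 ≤ X.dim) w, (tree (k + 1) h).node ((X.con k h).σWhite w).1 =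
    ((Y.con k (dim_eq ▸ h)).σWhite (white k h w)).1

/-- The category of opetopes and their isomorphisms. -/
instance : Category KJBM.{u} where
  Hom := Hom
  id X :=
    { dim_eq := rfl
      tree := fun _ _ => DotTree.Iso.refl _
      white := fun _ _ => Equiv.refl _
      white_edge := fun _ _ _ => rfl
      white_lt := fun _ _ _ _ => Iff.rfl
      map_σBlack := fun _ _ _ => rfl
      map_σWhite := fun _ _ _ => rfl }
  comp {X Y Z} f g :=
    { dim_eq := f.dim_eq.trans g.dim_eq
      tree := fun k h => (f.tree k h).trans (g.tree k (f.dim_eq ▸ h))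
      white := fun k h => (f.white k h).trans (g.white k (f.dim_eq ▸ h))
      white_edge := fun k h w => by
        simp [DotTree.Iso.trans, f.white_edge, g.white_edge]
      white_lt := fun k h w w' => (f.white_lt k h w w').trans (g.white_lt k _ _ _)
      map_σBlack := fun k h a => by
        simp [DotTree.Iso.trans, f.map_σBlack, g.map_σBlack]
      map_σWhite := fun k h w => by
        simp [DotTree.Iso.trans, f.map_σWhite, g.map_σWhite] }

end KJBM

/-! ## The opetope of a dendritic face complex -/

/-- The opetope `Y` is the opetope `Z(C)` of `C`, the cell `c` of `C` being named `ι c` in `Y`.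
The trees of index `0` and `1`, which are determined by the others up to renaming, are only
constrained through the definition of opetopes and the name of the node of `T₁`. -/
structure IsZoomOf (C : MOP.{u}) (Y : KJBM.{u}) (ι : C.Cell ↪ Y.Name) : Prop where
  hasDim : C.HasDim Y.dim
  /-- The node of `T₁` is the cell in `Λ₀`. -/
  mem_nodes_one : ∀ (h : 1 ≤ Y.dim) (x : Y.Name),
    x ∈ (Y.tree 1 h).nodes ↔ ∃ a ∈ C.Lam, C.dim a = 0 ∧ ι a = x
  /-- The set of nodes of `Tₖ₊₂` is `Λₖ₊₁`. -/
  mem_nodes : ∀ (k : ℕ) (h : k + 2 ≤ Y.dim) (x : Y.Name),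
    x ∈ (Y.tree (k + 2) h).nodes ↔ ∃ a ∈ C.Lam, C.dim a = k + 1 ∧ ι a = x
  /-- The set of edges of `Tₖ₊₂` is `Cₖ`. -/
  mem_edges : ∀ (k : ℕ) (h : k + 2 ≤ Y.dim) (x : Y.Name),
    x ∈ (Y.tree (k + 2) h).edges ↔ ∃ c, C.dim c = k ∧ ι c = x
  /-- The edge `c` is the target of the node `a` if and only if `c ≺⁺ a`. -/
  target_iff : ∀ (k : ℕ) (h : k + 2 ≤ Y.dim) (a : (Y.tree (k + 2) h).nodes)
    (b : (Y.tree (k + 2) h).edges) (a₀ c₀ : C.Cell), ι a₀ = a → ι c₀ = b →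
    ((Y.tree (k + 2) h).target a = b ↔ C.Pos c₀ a₀)
  /-- The edge `c` is a source of the node `a` if and only if `c ≺⁻ a`. -/
  targetNode_iff : ∀ (k : ℕ) (h : k + 2 ≤ Y.dim) (a : (Y.tree (k + 2) h).nodes)
    (b : (Y.tree (k + 2) h).edges) (a₀ c₀ : C.Cell), ι a₀ = a → ι c₀ = b →
    ((Y.tree (k + 2) h).targetNode b = some a ↔ C.Neg c₀ a₀)
  /-- The root edge of `Tₖ₊₂` is the `k`-dimensional iterated target of the greatest cell. -/
  root_eq : ∀ (k : ℕ) (h : k + 2 ≤ Y.dim),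
    ∃ c, C.IsIteratedTarget c ∧ C.dim c = k ∧ ι c = (Y.tree (k + 2) h).root
  /-- The whitedots of `Tₖ₊₂` on the edge `c` are the elements of `W(c)`. -/
  mem_white : ∀ (k : ℕ) (h : k + 2 + 1 ≤ Y.dim)
    (b : (Y.tree (k + 2) (Nat.le_of_succ_le h)).edges) (c : C.Cell), ι c = b →
    ∀ x : Y.Name, x ∈ (Y.con (k + 2) h).sub.W b ↔ ∃ w ∈ C.White c, ι w = x
  /-- The order of the whitedots on the edge `c` is the loops total order. -/
  white_lt_iff : ∀ (k : ℕ) (h : k + 2 + 1 ≤ Y.dim)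
    (b : (Y.tree (k + 2) (Nat.le_of_succ_le h)).edges) (c : C.Cell), ι c = b →
    ∀ (w w' : (Y.con (k + 2) h).sub.W b) (w₀ w₀' : C.Cell), ι w₀ = w → ι w₀' = w' →
    ((Y.con (k + 2) h).sub.lt b w w' ↔ C.WhiteLT c w₀ w₀')

/-- The isomorphism of opetopes `g` is given by the map of cells `f` on nodes (blackdots), on edges
and on whitedots. On the edges of `T₁` and on `T₀`, whose elements are not cells, it is the only
possible isomorphism. -/
structure ActsAs {C D : MOP.{u}} {X Y : KJBM.{u}} (ι : C.Cell ↪ X.Name) (κ : D.Cell ↪ Y.Name)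
    (f : C ⟶ D) (g : X ⟶ Y) : Prop where
  node_one : ∀ (h : 1 ≤ X.dim) (a : (X.tree 1 h).nodes) (a₀ : C.Cell), ι a₀ = a →
    ((g.tree 1 h).node a : Y.Name) = κ (f.toFun a₀)
  node : ∀ (k : ℕ) (h : k + 2 ≤ X.dim) (a : (X.tree (k + 2) h).nodes) (a₀ : C.Cell), ι a₀ = a →
    ((g.tree (k + 2) h).node a : Y.Name) = κ (f.toFun a₀)
  edge : ∀ (k : ℕ) (h : k + 2 ≤ X.dim) (b : (X.tree (k + 2) h).edges) (c : C.Cell), ι c = b →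
    ((g.tree (k + 2) h).edge b : Y.Name) = κ (f.toFun c)
  white : ∀ (k : ℕ) (h : k + 2 + 1 ≤ X.dim) (w : (X.con (k + 2) h).sub.Whitedot) (w₀ : C.Cell),
    ι w₀ = w.2 → ((g.white (k + 2) h w).2 : Y.Name) = κ (f.toFun w₀)

/-! Everything is read off from one relation. For cells `b`, `b'` of the same dimension, `Descent b
b'` says that some cell of Λ has `b` as a source and `b'` as its target; its reflexive transitive
closure is `Desc`.

Each level is a rooted tree. This goes by induction down the iterated targets `g` of the greatest
cell (`IsRootOfLevel.of_mem_γ`). The invariant is that the cells of Λ in the dimension of `g` are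
either `g` alone or exactly the sources of some `G` with target `g`. One dimension lower, lozenge
completion and the sign rule inside `G` give each edge at most one source node and one target node
(`source_unique`, `targetNode_unique`), and the acyclicity axiom for `G` excludes cycles.

The whitedots on `c` are totally ordered. Two descending paths that start at incomparable cells meet
at a node of Λ, where they arrive by different sources. If both starting cells have face `c`, so do
these two sources (`face_of_meet`, resting on the convexity lemma `face_of_desc`), and they can be
compared: the one with source `c` comes first, then the loops on `c` in the local order, then the
one with target `c`. This is the relation `Planar c`, a strict order that is total on the tips with
face `c`: the leaves, and the targets of the nulldots. On V(c) it coincides with ◂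
(`planar_of_loopLT`, `loopLT_of_planar`). If one of the arriving sources is not a loop, the zig-zag
over `c` yields ◂¹; otherwise the local order yields ◂², unless ◂¹ already holds. So totality and
transitivity of ◂ come for free.

The kernel rule holds. The dots of the subdivided tree correspond to the tips one dimension above
its edges: a blackdot to itself, a whitedot to its target. The dots over a node with target `g`
become the tips that descend to `g`. Tips that are consecutive for some `Planar c` are adjacent dots
(`step_of_nextTip`), so it suffices to connect the tips over `g` by such steps (`tipAdj_connected`).
This is an induction up the tree: the sources of one node are connected through common faces
(`exists_source_connected`), and the tips over `g` with a common face are joined along the planar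
order without leaving the cells over `g` (`desc_of_planar`).

Functoriality is formal. All the data are defined from dimensions, `δ`, `γ` and local orders, and a
morphism of opetopes is determined by its effect on names. -/

/-! ### Signed faces of a cell -/

namespace FacetPoset

variable {P : FacetPoset.{u}} {x y y' z z' : P.Cell}

theorem Pos.dim (h : P.Pos y x) : P.dim y + 1 = P.dim x := P.dim_of_mem_γ _ _ h.1

theorem Neg.dim (h : P.Neg y x) : P.dim y + 1 = P.dim x := P.dim_of_mem_δ _ _ h.1

theorem Loop.dim (h : P.Loop y x) : P.dim y + 1 = P.dim x := P.dim_of_mem_δ _ _ h.1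

theorem eq_of_mem_γ (h : y ∈ P.γ x) (h' : y' ∈ P.γ x) : y = y' := by
  have h1 := P.dim_of_mem_γ _ _ h
  have h2 := P.neg_one_le_dim y
  obtain ⟨w, hw⟩ := P.γ_singleton x (by lia)
  rw [hw] at h h'
  exact h.trans h'.symm

theorem Pos.unique (h : P.Pos y x) (h' : P.Pos y' x) : y = y' := eq_of_mem_γ h.1 h'.1

theorem Loop.unique (h : P.Loop y x) (h' : P.Loop y' x) : y = y' := eq_of_mem_γ h.2 h'.2

theorem Pos.not_neg (h : P.Pos y x) (h' : P.Neg y x) : False := h.2 h'.1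

/-- One common element forces `δ x = γ x`, so a loop has no face of nonzero sign. -/
theorem Loop.not_neg (h : P.Loop y x) (h' : P.Neg y' x) : False :=
  h'.2 (P.δ_eq_γ x ⟨y, h⟩ ▸ h'.1)

theorem Loop.not_pos (h : P.Loop y x) (h' : P.Pos y' x) : False :=
  h'.2 (P.δ_eq_γ x ⟨y, h⟩ ▸ h'.1)

theorem pos_or_loop_of_mem_γ (h : y ∈ P.γ x) : P.Pos y x ∨ P.Loop y x := by
  by_cases h' : y ∈ P.δ x
  · exact .inr ⟨h', h⟩
  · exact .inl ⟨h, h'⟩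

theorem neg_or_loop_of_mem_δ (h : y ∈ P.δ x) : P.Neg y x ∨ P.Loop y x := by
  by_cases h' : y ∈ P.γ x
  · exact .inr ⟨h, h'⟩
  · exact .inl ⟨h, h'⟩

theorem exists_pos_or_loop (h : 0 ≤ P.dim x) : ∃ y, P.Pos y x ∨ P.Loop y x := by
  obtain ⟨y, hy⟩ := P.γ_singleton x h
  exact ⟨y, pos_or_loop_of_mem_γ (by simp [hy])⟩

/-- `y` is a face of `x`, with any sign. -/
def Face (P : FacetPoset.{u}) (y x : P.Cell) : Prop := P.Neg y x ∨ P.Pos y x ∨ P.Loop y x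

theorem face_of_mem (h : y ∈ P.δ x ∪ P.γ x) : P.Face y x := by
  rcases h with h | h
  · rcases neg_or_loop_of_mem_δ h with h | h
    exacts [.inl h, .inr (.inr h)]
  · rcases pos_or_loop_of_mem_γ h with h | h
    exacts [.inr (.inl h), .inr (.inr h)]

theorem Face.dim (h : P.Face y x) : P.dim y + 1 = P.dim x := by
  rcases h with h | h | h <;> exact h.dim

theorem Neg.face (h : P.Neg y x) : P.Face y x := .inl h

theorem Pos.face (h : P.Pos y x) : P.Face y x := .inr (.inl h)

theorem Loop.face (h : P.Loop y x) : P.Face y x := .inr (.inr h)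

theorem Loop.eq_of_face (h : P.Loop y x) (h' : P.Face y' x) : y' = y := by
  rcases h' with h' | h' | h'
  · exact (h.not_neg h').elim
  · exact (h.not_pos h').elim
  · exact h'.unique h

end FacetPoset

open FacetPoset

/-- A relation without cycles on a finite type is well-founded. -/
theorem wellFounded_of_acyclic {α : Type*} [Finite α] {r : α → α → Prop}
    (h : ∀ a, ¬ Relation.TransGen r a a) : WellFounded r := by
  have : Std.Irrefl (Relation.TransGen r) := ⟨h⟩
  have := Finite.wellFounded_of_trans_of_irrefl (Relation.TransGen r)
  exact Subrelation.wf (fun h => Relation.TransGen.single h) this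

/-- The opposite of a relation without cycles on a finite type is well-founded. -/
theorem wellFounded_swap_of_acyclic {α : Type*} [Finite α] {r : α → α → Prop}
    (h : ∀ a, ¬ Relation.TransGen r a a) : WellFounded (Function.swap r) :=
  wellFounded_of_acyclic fun a ha => h a (Relation.transGen_swap.1 ha)

namespace MOP.IsDFC

variable {C : MOP.{u}} {x y y' z z' : C.Cell}

/-! ### Lozenge completion, sign by sign -/

/-- Among the possible signs of the completion, the sign rule leaves exactly the two listed. In
`neg_pos` and `pos_pos`, uniqueness of the target removes one more case. -/
theorem neg_neg (hC : C.IsDFC) (h : C.Neg z y) (h' : C.Neg y x) :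
    (∃ y', C.Pos z y' ∧ C.Neg y' x) ∨ ∃ y', C.Neg z y' ∧ C.Pos y' x := by
  obtain ⟨y', ⟨hne, α, β, hα, hβ, h1, h2⟩, -⟩ :=
    hC.thin .neg .neg z y x (by decide) (by decide) h h'
  have hs := hC.sign .neg .neg α β z y y' x (by decide) (by decide) hα hβ hne h h' h1 h2
  cases α <;> cases β <;> first | exact absurd hs (by decide) | skip
  · exact .inl ⟨y', h1, h2⟩
  · exact .inr ⟨y', h1, h2⟩

theorem pos_neg (hC : C.IsDFC) (h : C.Pos z y) (h' : C.Neg y x) :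
    (∃ y', C.Neg z y' ∧ C.Neg y' x) ∨ ∃ y', C.Pos z y' ∧ C.Pos y' x := by
  obtain ⟨y', ⟨hne, α, β, hα, hβ, h1, h2⟩, -⟩ :=
    hC.thin .neg .pos z y x (by decide) (by decide) h h'
  have hs := hC.sign .neg .pos α β z y y' x (by decide) (by decide) hα hβ hne h h' h1 h2
  cases α <;> cases β <;> first | exact absurd hs (by decide) | skip
  · exact .inl ⟨y', h1, h2⟩
  · exact .inr ⟨y', h1, h2⟩

theorem neg_pos (hC : C.IsDFC) (h : C.Neg z y) (h' : C.Pos y x) :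
    ∃ y', C.Neg z y' ∧ C.Neg y' x := by
  obtain ⟨y', ⟨hne, α, β, hα, hβ, h1, h2⟩, -⟩ :=
    hC.thin .pos .neg z y x (by decide) (by decide) h h'
  have hs := hC.sign .pos .neg α β z y y' x (by decide) (by decide) hα hβ hne h h' h1 h2
  cases α <;> cases β <;> first | exact absurd hs (by decide) | skip
  · exact ⟨y', h1, h2⟩
  · exact (hne (Pos.unique h2 h')).elim

theorem pos_pos (hC : C.IsDFC) (h : C.Pos z y) (h' : C.Pos y x) :
    ∃ y', C.Pos z y' ∧ C.Neg y' x := by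
  obtain ⟨y', ⟨hne, α, β, hα, hβ, h1, h2⟩, -⟩ :=
    hC.thin .pos .pos z y x (by decide) (by decide) h h'
  have hs := hC.sign .pos .pos α β z y y' x (by decide) (by decide) hα hβ hne h h' h1 h2
  cases α <;> cases β <;> first | exact absurd hs (by decide) | skip
  · exact ⟨y', h1, h2⟩
  · exact (hne (Pos.unique h2 h')).elim

/-- Two different middle cells with equal products of signs would violate the sign rule. -/
theorem neg_neg_unique (hC : C.IsDFC) (h : C.Neg z y) (h' : C.Neg y x) (k : C.Neg z y')
    (k' : C.Neg y' x) : y = y' := by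
  by_contra hne
  exact absurd (hC.sign .neg .neg .neg .neg z y y' x (by decide) (by decide) (by decide)
    (by decide) (Ne.symm hne) h h' k k') (by decide)

theorem pos_neg_unique (hC : C.IsDFC) (h : C.Pos z y) (h' : C.Neg y x) (k : C.Pos z y')
    (k' : C.Neg y' x) : y = y' := by
  by_contra hne
  exact absurd (hC.sign .neg .pos .neg .pos z y y' x (by decide) (by decide) (by decide)
    (by decide) (Ne.symm hne) h h' k k') (by decide)

theorem not_neg_neg_of_pos_pos (hC : C.IsDFC) (h : C.Pos z y) (h' : C.Pos y x) (k : C.Neg z y')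
    (k' : C.Neg y' x) : False := by
  have hne : y' ≠ y := by rintro rfl; exact h'.not_neg k'
  exact absurd (hC.sign .pos .pos .neg .neg z y y' x (by decide) (by decide) (by decide)
    (by decide) hne h h' k k') (by decide)

theorem not_pos_neg_of_neg_pos (hC : C.IsDFC) (h : C.Neg z y) (h' : C.Pos y x) (k : C.Pos z y')
    (k' : C.Neg y' x) : False := by
  have hne : y' ≠ y := by rintro rfl; exact h'.not_neg k'
  exact absurd (hC.sign .pos .neg .neg .pos z y y' x (by decide) (by decide) (by decide)
    (by decide) hne h h' k k') (by decide)

/-- If the completion supplied by `thin_loop` passes through the target of `x` with nonzero signs,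
an ordinary lozenge completion replaces it by one through a source. -/
theorem loop_neg (hC : C.IsDFC) (h : C.Loop z y) (h' : C.Neg y x) :
    (∃ y', C.Loop z y' ∧ C.Pos y' x) ∨ ∃ y', (C.Neg z y' ∨ C.Pos z y') ∧ C.Neg y' x := by
  obtain ⟨y', α, β, hne, h1, h2, h3⟩ := hC.thin_loop z y x h h'
  cases α
  · exact (Loop.not_neg h2 h').elim
  · cases β
    · exact (h3 rfl).elim
    · exact .inr ⟨y', .inl h1, h2⟩
    · exact .inr ⟨y', .inr h1, h2⟩
  · cases β
    · exact .inl ⟨y', h1, h2⟩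
    · obtain ⟨w, hw, hw'⟩ := hC.neg_pos h1 h2
      exact .inr ⟨w, .inl hw, hw'⟩
    · obtain ⟨w, hw, hw'⟩ := hC.pos_pos h1 h2
      exact .inr ⟨w, .inr hw, hw'⟩

/-- The sources of a cell whose target is a loop on `z` are loops on `z`. -/
theorem loop_of_loop_pos (hC : C.IsDFC) (h : C.Loop z y) (h' : C.Pos y x) (k : C.Neg y' x) :
    C.Loop z y' := by
  have := C.finite
  have hz := C.neg_one_le_dim z
  have hdim := h.dim
  have hdim' := h'.dim
  -- No source of `x` has a strict target. Such a target is not a strict target of the loop `y`, so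
  -- it is a source of another source of `x`, which again has a strict target; acyclicity stops
  -- this.
  have key : ∀ w, ∀ v, C.Neg w x → ¬ C.Pos v w := by
    intro w
    induction w using (wellFounded_of_acyclic (hC.acyclic x (by lia))).induction with
    | _ w ih =>
    intro v hw hv
    rcases hC.pos_neg hv hw with ⟨w', h1, h2⟩ | ⟨w', h1, h2⟩
    · obtain ⟨v', hv'⟩ := C.exists_pos_or_loop (x := w') (by have := h2.dim; lia)
      rcases hv' with hv' | hv'
      · exact ih w' ⟨h2, hw, v, h1, hv⟩ v' h2 hv'
      · exact hv'.not_neg h1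
    · exact h.not_pos (h2.unique h' ▸ h1)
  obtain ⟨v, hv⟩ := C.exists_pos_or_loop (x := y') (by have := k.dim; lia)
  have hv := hv.resolve_left (key y' v k)
  rcases hC.loop_neg hv k with ⟨w, h1, h2⟩ | ⟨w, h1 | h1, h2⟩
  · obtain rfl := h2.unique h'
    rwa [h.unique h1]
  · obtain ⟨t, ht⟩ := C.exists_pos_or_loop (x := w) (by have := h2.dim; lia)
    rcases ht with ht | ht
    · exact (key w t h2 ht).elim
    · exact (ht.not_neg h1).elim
  · exact (key w v h2 h1).elim

end MOP.IsDFC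

/-! ### Each level of cells is a rooted tree -/

namespace MOP

variable {C : MOP.{u}}

/-- `b'` is the target of a cell of `Λ` that has `b` among its sources. -/
def Descent (C : MOP.{u}) (b b' : C.Cell) : Prop := ∃ a ∈ C.Lam, C.Neg b a ∧ C.Pos b' a

theorem Descent.dim {b b' : C.Cell} (h : C.Descent b b') : C.dim b = C.dim b' := by
  obtain ⟨a, -, h1, h2⟩ := h
  have := h1.dim
  have := h2.dim
  lia

/-- The cells of the dimension of `g` are the edges of a rooted tree with root `g` whose leaves are
in `Λ`; the elements of `Λ` of this dimension are either `g` alone or the sources of a cell with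
target `g`. -/
structure IsRootOfLevel (C : MOP.{u}) (g : C.Cell) : Prop where
  lam : (∀ y, C.dim y = C.dim g → (y ∈ C.Lam ↔ y = g)) ∨
    ∃ G, C.Pos g G ∧ ∀ y, C.dim y = C.dim g → (y ∈ C.Lam ↔ C.Neg y G)
  eq_or_neg : ∀ y, C.dim y = C.dim g → y = g ∨ ∃ a ∈ C.Lam, C.Neg y a
  lam_or_pos : ∀ y, C.dim y = C.dim g → y ∈ C.Lam ∨ ∃ a ∈ C.Lam, C.Pos y a
  acyclic : ∀ y, C.dim y = C.dim g → ¬ Relation.TransGen C.Descent y y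

theorem descent_transGen_dim {b b' : C.Cell} (h : Relation.TransGen C.Descent b b') :
    C.dim b = C.dim b' := by
  induction h with
  | single h => exact h.dim
  | tail _ h ih => exact ih.trans h.dim

theorem descent_dim {b b' : C.Cell} (h : Relation.ReflTransGen C.Descent b b') :
    C.dim b = C.dim b' := by
  induction h with
  | refl => rfl
  | tail _ h ih => exact ih.trans h.dim

theorem le_dim {x y : C.Cell} (h : C.Le x y) : x = y ∨ C.dim x < C.dim y := by
  induction h with
  | refl => exact .inl rfl
  | tail _ h ih =>
    right
    have := (face_of_mem h).dim
    rcases ih with rfl | ih <;> lia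

theorem exists_face_of_dim_lt {ω x : C.Cell} (hω : C.IsGreatestCell ω) (h : C.dim x < C.dim ω) :
    ∃ y, C.Face x y := by
  rcases Relation.ReflTransGen.cases_head (hω x) with rfl | ⟨y, hy, -⟩
  · exact (lt_irrefl _ h).elim
  · exact ⟨y, face_of_mem hy⟩

namespace IsDFC

/-- By the axiom `loops`, a loop is the strict target of some cell, which a cell of Λ never is. -/
theorem not_loop_of_mem_lam (hC : C.IsDFC) {z y : C.Cell} (hy : y ∈ C.Lam) : ¬ C.Loop z y :=
  fun h => (hC.loops z y h).elim hy

/-- Base case of the induction down the dimensions: `g` is the only cell of its dimension and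
nothing lies above it. -/
theorem isRootOfLevel_greatest {g : C.Cell} (hg : C.IsGreatestCell g) : C.IsRootOfLevel g := by
  have huniq : ∀ y, C.dim y = C.dim g → y = g := fun y hy =>
    (le_dim (hg y)).resolve_right (by lia)
  have hno : ∀ y w, C.dim y = C.dim g → C.dim y + 1 ≠ C.dim w := fun y w hy h => by
    rcases le_dim (hg w) with rfl | h' <;> lia
  have hlam : ∀ y, C.dim y = C.dim g → y ∈ C.Lam := fun y hy w hw => hno y w hy hw.dim
  refine ⟨.inl fun y hy => ⟨fun _ => huniq y hy, fun _ => hlam y hy⟩,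
    fun y hy => .inl (huniq y hy), fun y hy => .inl (hlam y hy), fun y hy h => ?_⟩
  obtain ⟨-, ⟨a, -, ha, -⟩, -⟩ := Relation.TransGen.head'_iff.1 h
  exact hno y a hy ha.dim

/-- A descending path between two cells gives a path of nodes. -/
theorem exists_cycleStep_path {G z z' : C.Cell} {d : ℤ}
    (hG : ∀ y, C.dim y = d → (y ∈ C.Lam ↔ C.Neg y G)) (hz : C.dim z + 1 = d)
    (h : Relation.TransGen C.Descent z z') :
    ∃ a a', C.Neg z a ∧ C.Neg a G ∧ C.Pos z' a' ∧ C.Neg a' G ∧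
      Relation.ReflTransGen (C.CycleStep G) a' a := by
  induction h with
  | single h =>
    obtain ⟨a, ha, h1, h2⟩ := h
    have := (hG a (h1.dim.symm.trans hz)).1 ha
    exact ⟨a, a, h1, this, h2, this, .refl⟩
  | tail h' h ih =>
    obtain ⟨a, a', h1, h2, h3, h4, h5⟩ := ih
    obtain ⟨a'', ha, h6, h7⟩ := h
    have h8 := (hG a'' (by have := descent_transGen_dim h'; have := h6.dim; lia)).1 ha
    exact ⟨a, a'', h1, h2, h7, h8, .head ⟨h8, h4, _, h6, h3⟩ h5⟩

end IsDFC

variable {g g' : C.Cell}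

theorem IsRootOfLevel.acyclic_of_mem_γ (hC : C.IsDFC) (hg : C.IsRootOfLevel g) (h : g' ∈ C.γ g)
    {y : C.Cell} (hy : C.dim y = C.dim g') : ¬ Relation.TransGen C.Descent y y := by
  have hdim := C.dim_of_mem_γ _ _ h
  have hd := C.neg_one_le_dim g'
  intro hcyc
  rcases hg.lam with hlam | ⟨G, hG, hlam⟩
  · obtain ⟨-, ⟨a, ha, h1, -⟩, -⟩ := Relation.TransGen.head'_iff.1 hcyc
    obtain ⟨-, -, ⟨a', ha', -, h2⟩⟩ := Relation.TransGen.tail'_iff.1 hcyc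
    obtain rfl := (hlam a (by have := h1.dim; lia)).1 ha
    obtain rfl := (hlam a' (by have := h2.dim; lia)).1 ha'
    exact h2.not_neg h1
  · obtain ⟨a, a', h1, h2, h3, h4, h5⟩ :=
      IsDFC.exists_cycleStep_path hlam (by rw [hy, hdim]) hcyc
    -- `CycleStep` runs against `Descent`, so the path found goes from the last node to the first;
    -- the edge `y`, shared by both ends, closes it.
    exact hC.acyclic G (by have := hG.dim; lia) a (.head' ⟨h2, h4, _, h1, h3⟩ h5)

theorem IsRootOfLevel.wellFounded (hg : C.IsRootOfLevel g) :
    WellFounded fun b' b => C.dim b = C.dim g ∧ C.Descent b b' := by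
  have := C.finite
  refine wellFounded_swap_of_acyclic (r := fun b b' => C.dim b = C.dim g ∧ C.Descent b b')
    fun a ha => ?_
  obtain ⟨-, ⟨h, -⟩, -⟩ := Relation.TransGen.head'_iff.1 ha
  exact hg.acyclic a h (ha.lift id fun _ _ h => h.2)

theorem IsRootOfLevel.wellFounded_swap (hg : C.IsRootOfLevel g) :
    WellFounded fun b b' => C.dim b = C.dim g ∧ C.Descent b b' := by
  have := C.finite
  refine wellFounded_of_acyclic (r := fun b b' => C.dim b = C.dim g ∧ C.Descent b b')
    fun a ha => ?_
  obtain ⟨-, ⟨h, -⟩, -⟩ := Relation.TransGen.head'_iff.1 ha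
  exact hg.acyclic a h (ha.lift id fun _ _ h => h.2)

/-- If `y` is the target of a node, lozenge completion makes `z` a source of one of the sources of
that node. Climbing in this way ends at a leaf. The positive case is the same. -/
theorem IsRootOfLevel.exists_lam_neg (hC : C.IsDFC) (hg : C.IsRootOfLevel g) {z y : C.Cell}
    (hy : C.dim y = C.dim g) (h : C.Neg z y) : ∃ y' ∈ C.Lam, C.Neg z y' := by
  induction y using hg.wellFounded_swap.induction with
  | _ y ih =>
  rcases hg.lam_or_pos y hy with h' | ⟨a, ha, h'⟩
  · exact ⟨y, h', h⟩
  · obtain ⟨y', h1, h2⟩ := hC.neg_pos h h'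
    have hy' : C.dim y' = C.dim g := by have := h1.dim; have := h.dim; lia
    exact ih y' ⟨hy', a, ha, h2, h'⟩ hy' h1

theorem IsRootOfLevel.exists_lam_pos (hC : C.IsDFC) (hg : C.IsRootOfLevel g) {z y : C.Cell}
    (hy : C.dim y = C.dim g) (h : C.Pos z y) : ∃ y' ∈ C.Lam, C.Pos z y' := by
  induction y using hg.wellFounded_swap.induction with
  | _ y ih =>
  rcases hg.lam_or_pos y hy with h' | ⟨a, ha, h'⟩
  · exact ⟨y, h', h⟩
  · obtain ⟨y', h1, h2⟩ := hC.pos_pos h h'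
    have hy' : C.dim y' = C.dim g := by have := h1.dim; have := h.dim; lia
    exact ih y' ⟨hy', a, ha, h2, h'⟩ hy' h1

/-- Push `z` towards the root. At each node either `z` turns out to be a source of something, or it
remains a face of the target of the node. At the root `g` the only face that is not a source is the
target `g'`. -/
theorem IsRootOfLevel.eq_or_exists_neg (hC : C.IsDFC) (hg : C.IsRootOfLevel g) (h : g' ∈ C.γ g)
    {z y : C.Cell} (hy : C.dim y = C.dim g) (hz : C.Face z y) : z = g' ∨ ∃ y', C.Neg z y' := by
  induction y using hg.wellFounded.induction with
  | _ y ih =>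
  rcases hz with hz | hz | hz
  · exact .inr ⟨y, hz⟩
  · rcases hg.eq_or_neg y hy with rfl | ⟨a, ha, h'⟩
    · exact .inl (eq_of_mem_γ hz.1 h)
    · rcases hC.pos_neg hz h' with ⟨y', h1, h2⟩ | ⟨y', h1, h2⟩
      · exact .inr ⟨y', h1⟩
      · exact ih y' ⟨hy, a, ha, h', h2⟩ (by have := h1.dim; have := hz.dim; lia) h1.face
  · rcases hg.eq_or_neg y hy with rfl | ⟨a, ha, h'⟩
    · exact .inl (eq_of_mem_γ hz.2 h)
    · rcases hC.loop_neg hz h' with ⟨y', h1, h2⟩ | ⟨y', h1 | h1, h2⟩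
      · exact ih y' ⟨hy, a, ha, h', h2⟩ (by have := h1.dim; have := hz.dim; lia) h1.face
      · exact .inr ⟨y', h1⟩
      · rcases hC.pos_neg h1 h2 with ⟨y'', h3, h4⟩ | ⟨y'', h3, h4⟩
        · exact .inr ⟨y'', h3⟩
        · exact ih y'' ⟨hy, a, ha, h', h4⟩ (by have := h3.dim; have := hz.dim; lia) h3.face

/-- Inductive step from `g` to its target. The cells of Λ of the higher dimension compose to `g`:
their inner faces cancel in pairs, and the faces that are targets of nothing are exactly the sources
of `g`. -/
theorem IsRootOfLevel.of_mem_γ (hC : C.IsDFC) (hg : C.IsRootOfLevel g) (h : g' ∈ C.γ g)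
    (hlt : ∀ z, C.dim z = C.dim g' → ∃ y, C.Face z y) : C.IsRootOfLevel g' := by
  have hdim := C.dim_of_mem_γ _ _ h
  have hbelow : ∀ y, C.dim y = C.dim g' → y = g' ∨ ∃ a ∈ C.Lam, C.Neg y a := by
    intro z hz
    obtain ⟨y, hy⟩ := hlt z hz
    rcases IsRootOfLevel.eq_or_exists_neg hC hg h (by have := hy.dim; lia) hy with h' | ⟨y', h'⟩
    · exact .inl h'
    · exact .inr (IsRootOfLevel.exists_lam_neg hC hg (by have := h'.dim; lia) h')
  have habove : ∀ y, C.dim y = C.dim g' → y ∈ C.Lam ∨ ∃ a ∈ C.Lam, C.Pos y a := by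
    intro z hz
    by_cases h' : z ∈ C.Lam
    · exact .inl h'
    · obtain ⟨y, hy⟩ : ∃ y, C.Pos z y := by simpa [Lam] using h'
      exact .inr (IsRootOfLevel.exists_lam_pos hC hg (by have := hy.dim; lia) hy)
  refine ⟨?_, hbelow, habove, fun y hy => IsRootOfLevel.acyclic_of_mem_γ hC hg h hy⟩
  -- Forward, lozenge completion in `G` moves `z` from a source of `G` to the target `g`, as `z` is
  -- not the target of anything. Backward, a source of `g` that is also the target of a source of
  -- `G` breaks the sign rule, or, if `g` is a loop, the fact that all sources of `G` are then
  -- loops.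
  have hδ : ∀ z, C.dim z = C.dim g' → (z ∈ C.Lam ↔ z ∈ C.δ g) := by
    intro z hz
    constructor
    · intro hzΛ
      rcases hbelow z hz with rfl | ⟨y, hyΛ, hy⟩
      · rcases pos_or_loop_of_mem_γ h with h' | h'
        · exact (hzΛ _ h').elim
        · exact h'.1
      · have hyd : C.dim y = C.dim g := by have := hy.dim; lia
        rcases hg.lam with hlam | ⟨G, hG, hlam⟩
        · rw [← (hlam y hyd).1 hyΛ]
          exact hy.1
        · rcases hC.neg_neg hy ((hlam y hyd).1 hyΛ) with ⟨y', h1, -⟩ | ⟨y', h1, h2⟩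
          · exact (hzΛ _ h1).elim
          · rw [← h2.unique hG]
            exact h1.1
    · intro hzδ
      rcases habove z hz with h' | ⟨y, hyΛ, hy⟩
      · exact h'
      exfalso
      have hyd : C.dim y = C.dim g := by have := hy.dim; lia
      rcases hg.lam with hlam | ⟨G, hG, hlam⟩
      · rw [(hlam y hyd).1 hyΛ] at hy
        exact hy.2 hzδ
      · have hyG := (hlam y hyd).1 hyΛ
        rcases neg_or_loop_of_mem_δ hzδ with h' | h'
        · exact hC.not_pos_neg_of_neg_pos h' hG hy hyG
        · exact (hC.loop_of_loop_pos h' hG hyG).not_pos hy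
  -- If `g` is not a loop, it plays the role of `G` for the next level. If it is a loop on `g'`,
  -- then `g'` is alone in Λ in its dimension.
  rcases pos_or_loop_of_mem_γ h with h' | h'
  · refine .inr ⟨g, h', fun z hz => (hδ z hz).trans ⟨fun hz' => ?_, fun hz' => hz'.1⟩⟩
    exact (neg_or_loop_of_mem_δ hz').resolve_right fun h'' => h''.not_pos h'
  · refine .inl fun z hz => (hδ z hz).trans ⟨fun hz' => ?_, ?_⟩
    · exact h'.eq_of_face (face_of_mem (.inl hz'))
    · rintro rfl
      exact h'.1

namespace IsDFC

theorem isRootOfLevel (hC : C.IsDFC) (hg : C.IsIteratedTarget g) : C.IsRootOfLevel g := by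
  obtain ⟨ω, hω, h⟩ := hg
  suffices C.IsRootOfLevel g ∧ C.dim g ≤ C.dim ω from this.1
  induction h with
  | refl => exact ⟨isRootOfLevel_greatest hω, le_rfl⟩
  | tail _ h ih =>
    have hdim := C.dim_of_mem_γ _ _ h
    exact ⟨IsRootOfLevel.of_mem_γ hC ih.1 h
      fun z hz => exists_face_of_dim_lt hω (by lia), by lia⟩

theorem exists_isIteratedTarget_of_le {ω : C.Cell} (hω : C.IsGreatestCell ω) {d : ℤ}
    (hd : -1 ≤ d) (hd' : d ≤ C.dim ω) : ∃ g, C.IsIteratedTarget g ∧ C.dim g = d := by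
  obtain ⟨m, rfl⟩ : ∃ m : ℕ, d = C.dim ω - m := ⟨(C.dim ω - d).toNat, by lia⟩
  clear hd'
  induction m with
  | zero => exact ⟨ω, ⟨ω, hω, .refl⟩, by simp⟩
  | succ m ih =>
    push_cast at hd ⊢
    obtain ⟨g, ⟨ω', hω', hg⟩, hd⟩ := ih (by lia)
    obtain ⟨g', hg'⟩ := C.γ_singleton g (by lia)
    have hg' : g' ∈ C.γ g := by simp [hg']
    exact ⟨g', ⟨ω', hω', hg.tail hg'⟩, by have := C.dim_of_mem_γ _ _ hg'; lia⟩

theorem exists_isIteratedTarget (hC : C.IsDFC) (x : C.Cell) :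
    ∃ g, C.IsIteratedTarget g ∧ C.dim g = C.dim x := by
  obtain ⟨ω, hω, -⟩ := hC.greatest
  exact exists_isIteratedTarget_of_le hω (C.neg_one_le_dim x)
    (by rcases le_dim (hω x) with rfl | h <;> lia)

/-! ### Consequences for all cells -/

variable {a a' b b' c d d' e t : C.Cell}

theorem lam_or_pos (hC : C.IsDFC) (b : C.Cell) : b ∈ C.Lam ∨ ∃ a ∈ C.Lam, C.Pos b a := by
  obtain ⟨g, hg, hd⟩ := hC.exists_isIteratedTarget b
  exact (hC.isRootOfLevel hg).lam_or_pos b hd.symm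

theorem isIteratedTarget_or_neg (hC : C.IsDFC) (b : C.Cell) :
    C.IsIteratedTarget b ∨ ∃ a ∈ C.Lam, C.Neg b a := by
  obtain ⟨g, hg, hd⟩ := hC.exists_isIteratedTarget b
  rcases (hC.isRootOfLevel hg).eq_or_neg b hd.symm with rfl | h
  exacts [.inl hg, .inr h]

theorem descent_acyclic (hC : C.IsDFC) (b : C.Cell) : ¬ Relation.TransGen C.Descent b b := by
  obtain ⟨g, hg, hd⟩ := hC.exists_isIteratedTarget b
  exact (hC.isRootOfLevel hg).acyclic b hd.symm

theorem wellFounded_descent (hC : C.IsDFC) : WellFounded C.Descent :=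
  have := C.finite
  wellFounded_of_acyclic hC.descent_acyclic

theorem wellFounded_swap_descent (hC : C.IsDFC) : WellFounded (Function.swap C.Descent) :=
  have := C.finite
  wellFounded_swap_of_acyclic hC.descent_acyclic

/-- Two cells of Λ of the same dimension are both equal to the root of the level or both sources of
the same `G`, where signs determine the middle cell of a lozenge. The same argument gives
`targetNode_unique`. -/
theorem source_unique (hC : C.IsDFC) (ha : a ∈ C.Lam) (ha' : a' ∈ C.Lam) (h : C.Pos b a)
    (h' : C.Pos b a') : a = a' := by
  obtain ⟨g, hg, hd⟩ := hC.exists_isIteratedTarget a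
  have hd' : C.dim a' = C.dim g := by have := h.dim; have := h'.dim; lia
  rcases (hC.isRootOfLevel hg).lam with hlam | ⟨G, hG, hlam⟩
  · exact ((hlam a hd.symm).1 ha).trans ((hlam a' hd').1 ha').symm
  · exact hC.pos_neg_unique h ((hlam a hd.symm).1 ha) h' ((hlam a' hd').1 ha')

theorem targetNode_unique (hC : C.IsDFC) (ha : a ∈ C.Lam) (ha' : a' ∈ C.Lam) (h : C.Neg b a)
    (h' : C.Neg b a') : a = a' := by
  obtain ⟨g, hg, hd⟩ := hC.exists_isIteratedTarget a
  have hd' : C.dim a' = C.dim g := by have := h.dim; have := h'.dim; lia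
  rcases (hC.isRootOfLevel hg).lam with hlam | ⟨G, hG, hlam⟩
  · exact ((hlam a hd.symm).1 ha).trans ((hlam a' hd').1 ha').symm
  · exact hC.neg_neg_unique h ((hlam a hd.symm).1 ha) h' ((hlam a' hd').1 ha')

theorem isIteratedTarget_of_face (hb : C.IsIteratedTarget b) (h : C.Face b a) :
    ∃ g, b ∈ C.γ g ∧ C.IsIteratedTarget g ∧ C.dim g = C.dim a := by
  obtain ⟨ω, hω, hb⟩ := hb
  rcases Relation.ReflTransGen.cases_tail hb with rfl | ⟨g, hg, hg'⟩
  · have := h.dim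
    rcases le_dim (hω a) with rfl | h' <;> lia
  · exact ⟨g, hg', ⟨ω, hω, hg⟩, by have := C.dim_of_mem_γ _ _ hg'; have := h.dim; lia⟩

/-- A source of `G` having `b` as a source would clash with `b` being the target of the target `g`
of `G`: by the sign rule if `g` is not a loop, and because the sources of `G` are then loops if it
is. -/
theorem not_neg_of_isIteratedTarget (hC : C.IsDFC) (hb : C.IsIteratedTarget b) (ha : a ∈ C.Lam) :
    ¬ C.Neg b a := by
  intro h
  obtain ⟨g, hbg, hg, hd⟩ := isIteratedTarget_of_face hb h.face
  rcases (hC.isRootOfLevel hg).lam with hlam | ⟨G, hG, hlam⟩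
  · rw [(hlam a hd.symm).1 ha] at h
    exact h.2 hbg
  · have haG := (hlam a hd.symm).1 ha
    rcases pos_or_loop_of_mem_γ hbg with h' | h'
    · exact hC.not_neg_neg_of_pos_pos h' hG h haG
    · exact (hC.loop_of_loop_pos h' hG haG).not_neg h

theorem isIteratedTarget_unique (hC : C.IsDFC) (hb : C.IsIteratedTarget b)
    (hb' : C.IsIteratedTarget b') (hd : C.dim b = C.dim b') : b = b' := by
  rcases (hC.isRootOfLevel hb).eq_or_neg b' hd.symm with h | ⟨a, ha, h⟩
  · exact h.symm
  · exact (hC.not_neg_of_isIteratedTarget hb' ha h).elim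

theorem descent_unique (hC : C.IsDFC) (h : C.Descent t b) (h' : C.Descent t b') : b = b' := by
  obtain ⟨a, ha, h1, h2⟩ := h
  obtain ⟨a', ha', h1', h2'⟩ := h'
  obtain rfl := hC.targetNode_unique ha ha' h1 h1'
  exact h2.unique h2'

theorem exists_descent_root (hC : C.IsDFC) (b : C.Cell) :
    ∃ g, C.IsIteratedTarget g ∧ Relation.ReflTransGen C.Descent b g := by
  induction b using hC.wellFounded_swap_descent.induction with
  | _ b ih =>
  rcases hC.isIteratedTarget_or_neg b with h | ⟨a, ha, h⟩
  · exact ⟨b, h, .refl⟩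
  · obtain ⟨b', hb'⟩ := C.exists_pos_or_loop (x := a)
      (by have := C.neg_one_le_dim b; have := h.dim; lia)
    have hb' := hb'.resolve_right (hC.not_loop_of_mem_lam ha)
    have hs : C.Descent b b' := ⟨a, ha, h, hb'⟩
    obtain ⟨g, hg, h'⟩ := ih b' hs
    exact ⟨g, hg, .head hs h'⟩

theorem descent_total (hC : C.IsDFC) (h : Relation.ReflTransGen C.Descent t b)
    (h' : Relation.ReflTransGen C.Descent t b') :
    Relation.ReflTransGen C.Descent b b' ∨ Relation.ReflTransGen C.Descent b' b :=
  Relation.ReflTransGen.total_of_right_unique (fun _ _ _ => hC.descent_unique) h h'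

theorem descent_antisymm (hC : C.IsDFC) (h : Relation.ReflTransGen C.Descent b b')
    (h' : Relation.ReflTransGen C.Descent b' b) : b = b' := by
  rcases Relation.reflTransGen_iff_eq_or_transGen.1 h with rfl | h1
  · rfl
  · exact (hC.descent_acyclic b (h1.trans_left h')).elim

/-- A descending path that starts at a source of `a` and is not constant goes through the target
of `a`. -/
theorem descent_target_of_ne (hC : C.IsDFC) (ha : a ∈ C.Lam) (hd : C.Neg d a) (hb : C.Pos b a)
    (h : Relation.ReflTransGen C.Descent d e) (hne : d ≠ e) :
    Relation.ReflTransGen C.Descent b e := by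
  rcases Relation.ReflTransGen.cases_head h with rfl | ⟨b', h1, h2⟩
  · exact (hne rfl).elim
  · rwa [hC.descent_unique ⟨a, ha, hd, hb⟩ h1]

/-- A descending path goes through at most one source of `a`. -/
theorem source_eq_of_descent (hC : C.IsDFC) (ha : a ∈ C.Lam) (hd : C.Neg d a) (hd' : C.Neg d' a)
    (h : Relation.ReflTransGen C.Descent t d) (h' : Relation.ReflTransGen C.Descent t d') :
    d = d' := by
  wlog hdd : Relation.ReflTransGen C.Descent d d' generalizing d d'
  · exact (this hd' hd h' h ((hC.descent_total h h').resolve_left hdd)).symm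
  by_contra hne
  obtain ⟨b, hb⟩ := C.exists_pos_or_loop (x := a)
    (by have := C.neg_one_le_dim d; have := hd.dim; lia)
  have hb := hb.resolve_right (hC.not_loop_of_mem_lam ha)
  have h1 := hC.descent_target_of_ne ha hd hb hdd hne
  exact hC.descent_acyclic b (.tail' h1 ⟨a, ha, hd', hb⟩)

/-- Two cells of the same dimension that are not on a descending path meet at some cell of `Λ`. -/
theorem exists_meet (hC : C.IsDFC) {t t' : C.Cell} (hdim : C.dim t = C.dim t')
    (h : ¬ Relation.ReflTransGen C.Descent t t') (h' : ¬ Relation.ReflTransGen C.Descent t' t) :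
    ∃ a ∈ C.Lam, ∃ d d', d ≠ d' ∧ C.Neg d a ∧ C.Neg d' a ∧
      Relation.ReflTransGen C.Descent t d ∧ Relation.ReflTransGen C.Descent t' d' := by
  obtain ⟨g, hg, htg⟩ := hC.exists_descent_root t
  obtain ⟨g', hg', htg'⟩ := hC.exists_descent_root t'
  obtain rfl := hC.isIteratedTarget_unique hg hg'
    (by rw [← descent_dim htg, hdim, descent_dim htg'])
  clear hdim
  induction htg using Relation.ReflTransGen.head_induction_on with
  | refl => exact (h' htg').elim
  | head hs hsg ih =>
    rename_i t s
    -- Descend from `t` to the first cell `s` that is also below `t'`. The last steps into `s` on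
    -- the two paths cross the same node, because `s` has only one source node in Λ.
    by_cases hts : Relation.ReflTransGen C.Descent t' s
    · rcases Relation.ReflTransGen.cases_tail hts with rfl | ⟨d', h1, h2⟩
      · exact (h (.single hs)).elim
      · obtain ⟨a, ha, h3, h4⟩ := hs
        obtain ⟨a', ha', h3', h4'⟩ := h2
        obtain rfl := hC.source_unique ha ha' h4 h4'
        refine ⟨a, ha, t, d', ?_, h3, h3', .refl, h1⟩
        rintro rfl
        exact h' h1
    · obtain ⟨a, ha, d, d', h1, h2, h3, h4, h5⟩ := ih (fun hst => h (.head hs hst)) hts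
      exact ⟨a, ha, d, d', h1, h2, h3, .head hs h4, h5⟩

end IsDFC

end MOP

namespace MOP

variable {C : MOP.{u}} {a a' a'' b b' c d d' d'' e e' f t t' t'' : C.Cell}

/-- There is a descending path from `b` to `b'`. -/
abbrev Desc (C : MOP.{u}) : C.Cell → C.Cell → Prop := Relation.ReflTransGen C.Descent

namespace IsDFC

theorem exists_target (hC : C.IsDFC) (ha : a ∈ C.Lam) (hd : C.Neg d a) : ∃ b, C.Pos b a := by
  obtain ⟨b, hb⟩ := C.exists_pos_or_loop (x := a)
    (by have := C.neg_one_le_dim d; have := hd.dim; lia)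
  exact ⟨b, hb.resolve_right (hC.not_loop_of_mem_lam ha)⟩

/-! ### Descending paths over a cell -/

/-- By `loop_of_loop_pos`, being a loop on `c` passes from the target of a node to all its sources,
hence to everything above. -/
theorem loop_of_desc (hC : C.IsDFC) (h : C.Desc t d) (hd : C.Loop c d) : C.Loop c t := by
  induction h using Relation.ReflTransGen.head_induction_on with
  | refl => exact hd
  | head hs _ ih =>
    obtain ⟨a, -, h1, h2⟩ := hs
    exact hC.loop_of_loop_pos ih h2 h1

/-- A property that propagates from the target of each cell of `Λ` to one of its sources propagates
along a descending path that starts at a cell of `Λ`. -/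
theorem exists_lam_desc (hC : C.IsDFC) {p : C.Cell → Prop}
    (hp : ∀ b a, p b → C.Pos b a → ∃ y, p y ∧ C.Neg y a) (hd : p d) :
    ∃ l ∈ C.Lam, C.Desc l d ∧ ∀ f, C.Desc l f → C.Desc f d → p f := by
  induction d using hC.wellFounded_descent.induction with
  | _ d ih =>
  rcases hC.lam_or_pos d with h | ⟨a, ha, h⟩
  · refine ⟨d, h, .refl, fun f h1 h2 => ?_⟩
    rwa [← hC.descent_antisymm h1 h2]
  · obtain ⟨y, hy, hya⟩ := hp d a hd h
    obtain ⟨l, hl, h1, h2⟩ := ih y ⟨a, ha, hya, h⟩ hy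
    refine ⟨l, hl, h1.tail ⟨a, ha, hya, h⟩, fun f h3 h4 => ?_⟩
    -- A cell of the path that is not above the chosen source `y` is strictly below it, hence below
    -- the target `d` of the node as well, so it is `d` itself.
    by_cases hfy : C.Desc f y
    · exact h2 f h3 hfy
    · have hyf := (hC.descent_total h1 h3).resolve_right hfy
      have hne : y ≠ f := by rintro rfl; exact hfy .refl
      rwa [← hC.descent_antisymm (hC.descent_target_of_ne ha hya h hyf hne) h4]

theorem exists_lam_desc_neg (hC : C.IsDFC) (hd : C.Neg c d) :
    ∃ l ∈ C.Lam, C.Desc l d ∧ ∀ f, C.Desc l f → C.Desc f d → C.Neg c f :=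
  hC.exists_lam_desc (fun _ _ h h' => hC.neg_pos h h') hd

theorem exists_lam_desc_pos (hC : C.IsDFC) (hd : C.Pos c d) :
    ∃ l ∈ C.Lam, C.Desc l d ∧ ∀ f, C.Desc l f → C.Desc f d → C.Pos c f :=
  hC.exists_lam_desc (fun _ _ h h' => hC.pos_pos h h') hd

/-- Lifting `d` to a leaf that still has source `c` must end at `t`, by `targetNode_unique`. So the
cells with source `c` lie on the single descending path from `t`. -/
theorem desc_of_neg (hC : C.IsDFC) (ht : t ∈ C.Lam) (h : C.Neg c t) (hd : C.Neg c d) :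
    C.Desc t d ∧ ∀ f, C.Desc t f → C.Desc f d → C.Neg c f := by
  obtain ⟨l, hl, h1, h2⟩ := hC.exists_lam_desc_neg hd
  obtain rfl := hC.targetNode_unique hl ht (h2 l .refl h1) h
  exact ⟨h1, h2⟩

theorem desc_of_pos (hC : C.IsDFC) (ht : t ∈ C.Lam) (h : C.Pos c t) (hd : C.Pos c d) :
    C.Desc t d ∧ ∀ f, C.Desc t f → C.Desc f d → C.Pos c f := by
  obtain ⟨l, hl, h1, h2⟩ := hC.exists_lam_desc_pos hd
  obtain rfl := hC.source_unique hl ht (h2 l .refl h1) h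
  exact ⟨h1, h2⟩

/-- If `c` is a face of a source of `a` but not of its target, then it is a source of a source of
`a` and the target of another one. -/
theorem exists_turn (hC : C.IsDFC) (he : C.Neg e a) (hb : C.Pos b a) (hce : C.Face c e)
    (hcb : ¬ C.Face c b) :
    ∃ d d', C.Neg c d ∧ C.Neg d a ∧ C.Pos c d' ∧ C.Neg d' a := by
  have hneg : ∀ d, C.Neg c d → C.Neg d a →
      ∃ d d', C.Neg c d ∧ C.Neg d a ∧ C.Pos c d' ∧ C.Neg d' a := by
    intro d h1 h2
    rcases hC.neg_neg h1 h2 with ⟨d', h3, h4⟩ | ⟨d', h3, h4⟩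
    · exact ⟨d, d', h1, h2, h3, h4⟩
    · exact (hcb (h4.unique hb ▸ h3.face)).elim
  have hpos : ∀ d, C.Pos c d → C.Neg d a →
      ∃ d d', C.Neg c d ∧ C.Neg d a ∧ C.Pos c d' ∧ C.Neg d' a := by
    intro d h1 h2
    rcases hC.pos_neg h1 h2 with ⟨d', h3, h4⟩ | ⟨d', h3, h4⟩
    · exact ⟨d', d, h3, h4, h1, h2⟩
    · exact (hcb (h4.unique hb ▸ h3.face)).elim
  rcases hce with h | h | h
  · exact hneg e h he
  · exact hpos e h he
  · rcases hC.loop_neg h he with ⟨d', h3, h4⟩ | ⟨d', h3 | h3, h4⟩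
    · exact (hcb (h4.unique hb ▸ h3.face)).elim
    · exact hneg d' h3 h4
    · exact hpos d' h3 h4

/-- At the first node where the path loses the face `c`, some sources of the node have `c` as source
and as target (`exists_turn`); these are then lifted to leaves. -/
theorem exists_lam_of_not_face (hC : C.IsDFC) (h : C.Desc e f) (he : C.Face c e)
    (hf : ¬ C.Face c f) :
    ∃ l ∈ C.Lam, ∃ l' ∈ C.Lam, C.Neg c l ∧ C.Pos c l' ∧ C.Desc l f ∧ C.Desc l' f := by
  induction h using Relation.ReflTransGen.head_induction_on with
  | refl => exact (hf he).elim
  | head hs hsf ih =>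
    rename_i e s
    by_cases hcs : C.Face c s
    · exact ih hcs
    obtain ⟨a, ha, h1, h2⟩ := hs
    obtain ⟨d, d', h3, h4, h5, h6⟩ := hC.exists_turn h1 h2 he hcs
    obtain ⟨l, hl, h7, h8⟩ := hC.exists_lam_desc_neg h3
    obtain ⟨l', hl', h9, h10⟩ := hC.exists_lam_desc_pos h5
    exact ⟨l, hl, l', hl', h8 l .refl h7, h10 l' .refl h9,
      h7.trans (.head ⟨a, ha, h4, h2⟩ hsf), h9.trans (.head ⟨a, ha, h6, h2⟩ hsf)⟩

/-- The cells with face `c` are convex for descending paths. -/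
theorem face_of_desc (hC : C.IsDFC) (h : C.Desc e f) (h' : C.Desc f d) (he : C.Face c e)
    (hd : C.Face c d) : C.Face c f := by
  -- If `c` is lost at `f`, the leaves with source `c` and with target `c` both descend to `f`. The
  -- sign of `c` in `d` selects one of them, whose path down to `d` keeps the face `c` and contains
  -- `f`; if `d` is a loop, so is the leaf `l`, which is absurd.
  by_contra hf
  obtain ⟨l, hl, l', hl', h1, h2, h3, h4⟩ := hC.exists_lam_of_not_face h he hf
  rcases hd with hd | hd | hd
  · exact hf ((hC.desc_of_neg hl h1 hd).2 f h3 h').face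
  · exact hf ((hC.desc_of_pos hl' h2 hd).2 f h4 h').face
  · exact (hC.loop_of_desc (h3.trans h') hd).not_neg h1

/-- By convexity `c` is a face of every cell of the path, and at each node the sign rule forbids a
source to become a target, while `loop_of_loop_pos` forbids it to become a loop. Similarly for
`pos_of_desc`. -/
theorem neg_of_desc (hC : C.IsDFC) (h : C.Desc e d) (he : C.Neg c e) (hd : C.Face c d) :
    C.Neg c d := by
  induction h using Relation.ReflTransGen.head_induction_on with
  | refl => exact he
  | head hs hsd ih =>
    have hcs := hC.face_of_desc (.single hs) hsd he.face hd
    obtain ⟨a, ha, h1, h2⟩ := hs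
    rcases hcs with h | h | h
    · exact ih h
    · exact (hC.not_neg_neg_of_pos_pos h h2 he h1).elim
    · exact ((hC.loop_of_loop_pos h h2 h1).not_neg he).elim

theorem pos_of_desc (hC : C.IsDFC) (h : C.Desc e d) (he : C.Pos c e) (hd : C.Face c d) :
    C.Pos c d := by
  induction h using Relation.ReflTransGen.head_induction_on with
  | refl => exact he
  | head hs hsd ih =>
    have hcs := hC.face_of_desc (.single hs) hsd he.face hd
    obtain ⟨a, ha, h1, h2⟩ := hs
    rcases hcs with h | h | h
    · exact (hC.not_pos_neg_of_neg_pos h h2 he h1).elim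
    · exact ih h
    · exact ((hC.loop_of_loop_pos h h2 h1).not_pos he).elim

theorem loop_or_exists_of_desc (hC : C.IsDFC) (h : C.Desc e d) (he : C.Loop c e) :
    C.Loop c d ∨ ∃ f, (C.Neg c f ∨ C.Pos c f) ∧ C.Desc f d := by
  induction h using Relation.ReflTransGen.head_induction_on with
  | refl => exact .inl he
  | head hs hsd ih =>
    obtain ⟨a, ha, h1, h2⟩ := hs
    rcases hC.loop_neg he h1 with ⟨y, h3, h4⟩ | ⟨y, h3, h4⟩
    · exact ih (h4.unique h2 ▸ h3)
    · exact .inr ⟨y, h3, .head ⟨a, ha, h4, h2⟩ hsd⟩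

/-- Descending paths that start at cells with face `c` meet at a cell of `Λ` whose corresponding
sources have face `c`. -/
theorem face_of_meet (hC : C.IsDFC) (ha : a ∈ C.Lam) (hd : C.Neg d a) (hd' : C.Neg d' a)
    (hne : d ≠ d') (h : C.Desc e d) (h' : C.Desc e' d') (he : C.Face c e) (he' : C.Face c e') :
    C.Face c d := by
  by_contra hcd
  obtain ⟨l, hl, l', hl', h1, h2, h3, h4⟩ := hC.exists_lam_of_not_face h he hcd
  -- Every cell with strict face `c` lies below `l` or `l'`, both above `d`, and a descending path
  -- crosses only one source of `a`. So such a cell cannot be above `d'`, and a loop above `d'` is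
  -- treated by following it downwards.
  have key : ∀ f, C.Neg c f ∨ C.Pos c f → ∀ k, C.Neg k a → C.Desc f k → k = d := by
    rintro f (hf | hf) k hk hfk
    · exact hC.source_eq_of_descent ha hk hd ((hC.desc_of_neg hl h1 hf).1.trans hfk) h3
    · exact hC.source_eq_of_descent ha hk hd ((hC.desc_of_pos hl' h2 hf).1.trans hfk) h4
  rcases he' with he' | he' | he'
  · exact hne (key e' (.inl he') d' hd' h').symm
  · exact hne (key e' (.inr he') d' hd' h').symm
  · rcases hC.loop_or_exists_of_desc h' he' with hl | ⟨f, hf, hfd⟩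
    · rcases hC.loop_neg hl hd' with ⟨y, h5, h6⟩ | ⟨y, h5, h6⟩
      · exact hcd (hC.loop_of_loop_pos h5 h6 hd).face
      · obtain rfl := key y h5 y h6 .refl
        rcases h5 with h5 | h5
        exacts [hcd h5.face, hcd h5.face]
    · exact hne (key f hf d' hd' hfd).symm

end IsDFC

/-! ### The planar order over a cell -/

theorem LocalLT.loop (h : C.LocalLT a d d') : ∃ z, C.Loop z d ∧ C.Loop z d' := by
  obtain ⟨-, z, h1, h2⟩ := C.localLT_supp a d d' h
  exact ⟨z, h1.1, h2.1⟩

theorem LocalLT.trans (h : C.LocalLT a d d') (h' : C.LocalLT a d' d'') : C.LocalLT a d d'' := by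
  obtain ⟨ha, z, h1, h2⟩ := C.localLT_supp a d d' h
  obtain ⟨-, z', h3, h4⟩ := C.localLT_supp a d' d'' h'
  obtain rfl := h2.1.unique h3.1
  have := C.localLT_total a ha z
  exact this.toIsStrictOrder.toIsTrans.trans ⟨d, h1⟩ ⟨d', h2⟩ ⟨d'', h4⟩ h h'

theorem LocalLT.irrefl : ¬ C.LocalLT a d d := by
  intro h
  obtain ⟨ha, z, h1, -⟩ := C.localLT_supp a d d h
  have := C.localLT_total a ha z
  exact this.toIsStrictOrder.toIrrefl.irrefl ⟨d, h1⟩ h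

theorem localLT_or (ha : a ∈ C.Lam) (hd : C.Loop c d) (hda : C.Neg d a) (hd' : C.Loop c d')
    (hda' : C.Neg d' a) (hne : d ≠ d') : C.LocalLT a d d' ∨ C.LocalLT a d' d := by
  have := C.localLT_total a ha c
  by_contra h
  push Not at h
  exact hne (congrArg Subtype.val
    (this.toTrichotomous.trichotomous ⟨d, hd, hda⟩ ⟨d', hd', hda'⟩ h.1 h.2))

/-- The order of the sources of `a` with face `c`: first the one with source `c`, then the loops
on `c` in the local order, then the one with target `c`. -/
def SrcLT (C : MOP.{u}) (c a d d' : C.Cell) : Prop :=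
  C.Neg d a ∧ C.Neg d' a ∧ C.Face c d ∧ C.Face c d' ∧ d ≠ d' ∧
    (C.Neg c d ∨ C.Pos c d' ∨ C.LocalLT a d d')

/-- The planar order over `c`: descending paths from `t` and `t'` meet, and the one from `t` arrives
first. -/
def Planar (C : MOP.{u}) (c t t' : C.Cell) : Prop :=
  ∃ a ∈ C.Lam, ∃ d d', C.SrcLT c a d d' ∧ C.Desc t d ∧ C.Desc t' d'

theorem LocalLT.not_pos_left (h : C.LocalLT a d d') (h' : C.Pos c d) : False := by
  obtain ⟨z, h1, -⟩ := LocalLT.loop h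
  exact h1.not_pos h'

theorem LocalLT.not_neg_right (h : C.LocalLT a d d') (h' : C.Neg c d') : False := by
  obtain ⟨z, -, h1⟩ := LocalLT.loop h
  exact h1.not_neg h'

namespace IsDFC

/-- At most one source of `a` has source `c`, at most one has target `c`, and the local order
relates only loops. -/
theorem srcLT_asymm (hC : C.IsDFC) (h : C.SrcLT c a d d') (h' : C.SrcLT c a d' d) : False := by
  obtain ⟨h1, h2, -, -, hne, h3⟩ := h
  obtain ⟨-, -, -, -, -, h4⟩ := h'
  rcases h3 with h3 | h3 | h3
  · rcases h4 with h4 | h4 | h4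
    · exact hne (hC.neg_neg_unique h3 h1 h4 h2)
    · exact h4.not_neg h3
    · exact LocalLT.not_neg_right h4 h3
  · rcases h4 with h4 | h4 | h4
    · exact h3.not_neg h4
    · exact hne (hC.pos_neg_unique h4 h1 h3 h2)
    · exact LocalLT.not_pos_left h4 h3
  · rcases h4 with h4 | h4 | h4
    · exact LocalLT.not_neg_right h3 h4
    · exact LocalLT.not_pos_left h3 h4
    · exact LocalLT.irrefl (LocalLT.trans h3 h4)

theorem srcLT_trans (hC : C.IsDFC) (h : C.SrcLT c a d d') (h' : C.SrcLT c a d' d'') :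
    C.SrcLT c a d d'' := by
  have hne : d ≠ d'' := by
    rintro rfl
    exact hC.srcLT_asymm h h'
  obtain ⟨h1, -, h2, -, -, h3⟩ := h
  obtain ⟨-, h5, -, h6, -, h7⟩ := h'
  refine ⟨h1, h5, h2, h6, hne, ?_⟩
  rcases h3 with h3 | h3 | h3
  · exact .inl h3
  · rcases h7 with h7 | h7 | h7
    · exact (h3.not_neg h7).elim
    · exact .inr (.inl h7)
    · exact (LocalLT.not_pos_left h7 h3).elim
  · rcases h7 with h7 | h7 | h7
    · exact (LocalLT.not_neg_right h3 h7).elim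
    · exact .inr (.inl h7)
    · exact .inr (.inr (LocalLT.trans h3 h7))

theorem srcLT_total (ha : a ∈ C.Lam) (hd : C.Neg d a) (hd' : C.Neg d' a)
    (hne : d ≠ d') (hc : C.Face c d) (hc' : C.Face c d') :
    C.SrcLT c a d d' ∨ C.SrcLT c a d' d := by
  suffices (C.Neg c d ∨ C.Pos c d' ∨ C.LocalLT a d d') ∨
      (C.Neg c d' ∨ C.Pos c d ∨ C.LocalLT a d' d) from
    this.imp (fun h => ⟨hd, hd', hc, hc', hne, h⟩) (fun h => ⟨hd', hd, hc', hc, hne.symm, h⟩)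
  rcases hc with h | h | h
  · exact .inl (.inl h)
  · exact .inr (.inr (.inl h))
  · rcases hc' with h' | h' | h'
    · exact .inr (.inl h')
    · exact .inl (.inr (.inl h'))
    · exact (localLT_or ha h hd h' hd' hne).imp (fun h => .inr (.inr h)) fun h => .inr (.inr h)

theorem planar_irrefl (hC : C.IsDFC) : ¬ C.Planar c t t := by
  rintro ⟨a, ha, d, d', h, h1, h2⟩
  exact h.2.2.2.2.1 (hC.source_eq_of_descent ha h.1 h.2.1 h1 h2)

/-- The path from `t'` crosses both meeting nodes. If they coincide, `SrcLT` is composed there;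
otherwise the comparison is made at the lower node, which the path from the remaining cell reaches
through the target of the upper one. -/
theorem planar_trans (hC : C.IsDFC) (h : C.Planar c t t') (h' : C.Planar c t' t'') :
    C.Planar c t t'' := by
  obtain ⟨a, ha, d, d', h1, h2, h3⟩ := h
  obtain ⟨a', ha', e, e', h4, h5, h6⟩ := h'
  obtain ⟨b, hb⟩ := hC.exists_target ha h1.1
  obtain ⟨b', hb'⟩ := hC.exists_target ha' h4.1
  rcases eq_or_ne d' e with rfl | hne
  · obtain rfl := hC.targetNode_unique ha ha' h1.2.1 h4.1
    exact ⟨a, ha, d, e', hC.srcLT_trans h1 h4, h2, h6⟩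
  rcases hC.descent_total h3 h5 with h7 | h7
  · have := hC.descent_target_of_ne ha h1.2.1 hb h7 hne
    exact ⟨a', ha', e, e', h4, h2.trans (.head ⟨a, ha, h1.1, hb⟩ this), h6⟩
  · have := hC.descent_target_of_ne ha' h4.1 hb' h7 hne.symm
    exact ⟨a, ha, d, d', h1, h2, h6.trans (.head ⟨a', ha', h4.2.1, hb'⟩ this)⟩

theorem planar_asymm (hC : C.IsDFC) (h : C.Planar c t t') (h' : C.Planar c t' t) : False :=
  hC.planar_irrefl (hC.planar_trans h h')

/-- The cells above a given one are convex for the planar order. -/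
theorem desc_of_planar (hC : C.IsDFC) (h : C.Planar c t t') (h' : C.Planar c t' t'')
    (ht : C.Desc t b) (ht'' : C.Desc t'' b) : C.Desc t' b := by
  obtain ⟨a, ha, d, d', h1, h2, h3⟩ := h
  obtain ⟨a', ha', e, e', h4, h5, h6⟩ := h'
  obtain ⟨k, hk⟩ := hC.exists_target ha h1.1
  obtain ⟨k', hk'⟩ := hC.exists_target ha' h4.1
  by_contra hcon
  -- If `b` were not above `d`, it would be below the target of `a`, hence below `t'`.
  have hbd : C.Desc b d := by
    by_contra hn
    exact hcon (h3.trans (.head ⟨a, ha, h1.2.1, hk⟩ (hC.descent_target_of_ne ha h1.1 hk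
      ((hC.descent_total h2 ht).resolve_right hn) (by rintro rfl; exact hn .refl))))
  have hbe : C.Desc b e' := by
    by_contra hn
    exact hcon (h5.trans (.head ⟨a', ha', h4.1, hk'⟩ (hC.descent_target_of_ne ha' h4.2.1 hk'
      ((hC.descent_total h6 ht'').resolve_right hn) (by rintro rfl; exact hn .refl))))
  -- Both `d` and `e'` are below `b`, hence comparable. Equality contradicts asymmetry at the common
  -- node; a strict comparison makes the path from `t'` cross two different sources of one node.
  rcases eq_or_ne d e' with rfl | hne
  · obtain rfl := hC.targetNode_unique ha ha' h1.1 h4.2.1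
    obtain rfl := hC.source_eq_of_descent ha h1.2.1 h4.1 h3 h5
    exact hC.srcLT_asymm h1 h4
  rcases hC.descent_total hbd hbe with h7 | h7
  · have h8 := hC.descent_target_of_ne ha h1.1 hk h7 hne
    exact h4.2.2.2.2.1 (hC.source_eq_of_descent ha' h4.1 h4.2.1 h5
      (h3.trans (.head ⟨a, ha, h1.2.1, hk⟩ h8)))
  · have h8 := hC.descent_target_of_ne ha' h4.2.1 hk' h7 hne.symm
    exact h1.2.2.2.2.1 (hC.source_eq_of_descent ha h1.1 h1.2.1
      (h5.trans (.head ⟨a', ha', h4.1, hk'⟩ h8)) h3)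

end IsDFC

/-! ### Tips and their total order -/

/-- The leaves, and the targets of the cells of `Λ` without sources. -/
def IsTip (C : MOP.{u}) (b : C.Cell) : Prop := b ∈ C.Lam ∨ ∃ a ∈ C.Lam ∩ C.Null, C.Pos b a

namespace IsDFC

/-- A leaf has no source node, and the source node of any other tip has no sources, so no step
arrives at a tip. -/
theorem eq_of_desc_of_isTip (hC : C.IsDFC) (h : C.Desc t b) (hb : C.IsTip b) : t = b := by
  rcases Relation.ReflTransGen.cases_tail h with rfl | ⟨s, -, a, ha, h1, h2⟩
  · rfl
  rcases hb with hb | ⟨a', ha', h3⟩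
  · exact (hb _ h2).elim
  · obtain rfl := hC.source_unique ha ha'.1 h2 h3
    have : C.δ a = ∅ := ha'.2
    exact ((Set.ext_iff.1 this s).1 h1.1).elim

/-- Distinct tips are never on one descending path, so their paths meet, and `face_of_meet` makes
the two arriving sources comparable over `c`. -/
theorem planar_total (hC : C.IsDFC) (ht : C.IsTip t) (ht' : C.IsTip t') (hc : C.Face c t)
    (hc' : C.Face c t') (hne : t ≠ t') : C.Planar c t t' ∨ C.Planar c t' t := by
  obtain ⟨a, ha, d, d', hdd, h1, h2, h3, h4⟩ := hC.exists_meet (t := t) (t' := t')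
    (by have := hc.dim; have := hc'.dim; lia)
    (fun h => hne (hC.eq_of_desc_of_isTip h ht'))
    (fun h => hne.symm (hC.eq_of_desc_of_isTip h ht))
  exact (srcLT_total ha h1 h2 hdd (hC.face_of_meet ha h1 h2 hdd h3 h4 hc hc')
    (hC.face_of_meet ha h2 h1 hdd.symm h4 h3 hc' hc)).imp
    (fun h => ⟨a, ha, d, d', h, h3, h4⟩) (fun h => ⟨a, ha, d', d, h, h4, h3⟩)

/-- A cell with source `c` precedes the other cells with face `c`. -/
theorem planar_of_neg (hC : C.IsDFC) (ht : C.IsTip t) (ht' : C.IsTip t') (hc : C.Neg c t)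
    (hc' : C.Face c t') (hne : t ≠ t') : C.Planar c t t' := by
  refine (hC.planar_total ht ht' hc.face hc' hne).resolve_right ?_
  rintro ⟨a, ha, d, d', h, h1, h2⟩
  obtain ⟨h3, h4, h5, h6, hdd, h7⟩ := h
  have hd' := hC.neg_of_desc h2 hc h6
  rcases h7 with h7 | h7 | h7
  · exact hdd (hC.neg_neg_unique h7 h3 hd' h4)
  · exact h7.not_neg hd'
  · exact LocalLT.not_neg_right h7 hd'

/-- A cell with target `c` follows the other cells with face `c`. -/
theorem planar_of_pos (hC : C.IsDFC) (ht : C.IsTip t) (ht' : C.IsTip t') (hc : C.Face c t)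
    (hc' : C.Pos c t') (hne : t ≠ t') : C.Planar c t t' := by
  refine (hC.planar_total ht ht' hc hc'.face hne).resolve_right ?_
  rintro ⟨a, ha, d, d', h, h1, h2⟩
  obtain ⟨h3, h4, h5, h6, hdd, h7⟩ := h
  have hd := hC.pos_of_desc h1 hc' h5
  rcases h7 with h7 | h7 | h7
  · exact hd.not_neg h7
  · exact hdd (hC.pos_neg_unique hd h3 h7 h4)
  · exact LocalLT.not_pos_left h7 hd

/-! ### The loops total order is the planar order -/

theorem desc_of_loopInclEq (h : C.LoopInclEq b d) : C.Desc b d := by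
  refine Relation.ReflTransGen.mono ?_ _ _ h
  rintro b' b ⟨c, a, ha, h1, h2⟩
  exact ⟨a, ha, h2.2, h1.2⟩

/-- All cells above a loop on `c` are loops on `c`, so each descending step is a step of ⊂. -/
theorem loopInclEq_of_desc (hC : C.IsDFC) (h : C.Desc b d) (hd : C.Loop c d) :
    C.LoopInclEq b d := by
  induction h using Relation.ReflTransGen.head_induction_on with
  | refl => exact .refl
  | head hs hsd ih =>
    have h1 := hC.loop_of_desc hsd hd
    have h2 := hC.loop_of_desc (.head hs hsd) hd
    obtain ⟨a, ha, h3, h4⟩ := hs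
    exact .head ⟨c, a, ha, ⟨h1, h4⟩, h2, h3⟩ ih

/-- The possible shapes of a path in the zig-zag over `c`. -/
theorem zigStep_transGen (h : Relation.TransGen (C.ZigStep c) a a') :
    a ∈ C.Lam ∧ a' ∈ C.Lam ∧
      ((∃ f s, C.Neg c f ∧ C.Neg f a' ∧ C.Pos s a ∧ C.Desc s f) ∨
        ∃ s', C.Pos s' a' ∧ C.Pos c s' ∧ ((∃ f, C.Pos c f ∧ C.Neg f a ∧ C.Desc s' f) ∨
          ∃ a₁ ∈ C.Lam, ∃ f f' s, C.Neg c f ∧ C.Neg f a₁ ∧ C.Pos c f' ∧ C.Neg f' a₁ ∧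
            C.Pos s a ∧ C.Desc s f ∧ C.Desc s' f')) := by
  induction h with
  | single h =>
    obtain ⟨ha, ha', b, ⟨h1, h2, h3⟩ | ⟨h1, h2, h3⟩⟩ := h
    · exact ⟨ha, ha', .inl ⟨b, b, h1, h3, h2, .refl⟩⟩
    · exact ⟨ha, ha', .inr ⟨b, h3, h1, .inl ⟨b, h1, h2, .refl⟩⟩⟩
  | tail _ h ih =>
    obtain ⟨ha, ha', ih⟩ := ih
    obtain ⟨-, ha'', b, ⟨h1, h2, h3⟩ | ⟨h1, h2, h3⟩⟩ := h
    · refine ⟨ha, ha'', ?_⟩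
      rcases ih with ⟨f, s, h4, h5, h6, h7⟩ | ⟨s', h4, h5, -⟩
      · exact .inl ⟨b, s, h1, h3, h6, h7.tail ⟨_, ha', h5, h2⟩⟩
      · obtain rfl := h2.unique h4
        exact (h5.not_neg h1).elim
    · refine ⟨ha, ha'', .inr ⟨b, h3, h1, ?_⟩⟩
      rcases ih with ⟨f, s, h4, h5, h6, h7⟩ | ⟨s', h4, h5, ⟨f, h6, h7, h8⟩ |
          ⟨a₁, ha₁, f, f', s, h6, h7, h8, h9, h10, h11, h12⟩⟩
      · exact .inr ⟨_, ha', f, b, s, h4, h5, h1, h2, h6, h7, .refl⟩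
      · exact .inl ⟨f, h6, h7, .head ⟨_, ha', h2, h4⟩ h8⟩
      · exact .inr ⟨a₁, ha₁, f, f', s, h6, h7, h8, h9, h10, h11, .head ⟨_, ha', h2, h4⟩ h12⟩

/-- A zig-zag path that only descends has its meeting node at its end, one that only ascends at its
start, and otherwise the meeting node is the turning point `a₁`. -/
theorem planar_of_loopLT₁ (h : C.LoopLT₁ c b b') : C.Planar c b b' := by
  obtain ⟨a, a', d, d', h, ⟨h1, h2⟩, ⟨h3, h4⟩, h5, h6⟩ := h
  replace h5 := desc_of_loopInclEq h5
  replace h6 := desc_of_loopInclEq h6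
  obtain ⟨ha, ha', ⟨f, s, h7, h8, h9, h10⟩ | ⟨s', h7, h8, ⟨f, h9, h10, h11⟩ |
    ⟨a₁, ha₁, f, f', s, h9, h10, h11, h12, h13, h14, h15⟩⟩⟩ := zigStep_transGen h
  · refine ⟨a', ha', f, d', ⟨h8, h4, h7.face, h3.face, ?_, .inl h7⟩,
      h5.trans (.head ⟨a, ha, h2, h9⟩ h10), h6⟩
    rintro rfl
    exact h3.not_neg h7
  · refine ⟨a, ha, d, f, ⟨h2, h10, h1.face, h9.face, ?_, .inr (.inl h9)⟩, h5,
      h6.trans (.head ⟨a', ha', h4, h7⟩ h11)⟩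
    rintro rfl
    exact h1.not_pos h9
  · refine ⟨a₁, ha₁, f, f', ⟨h10, h12, h9.face, h11.face, ?_, .inl h9⟩,
      h5.trans (.head ⟨a, ha, h2, h13⟩ h14), h6.trans (.head ⟨a', ha', h4, h7⟩ h15)⟩
    rintro rfl
    exact h11.not_neg h9

theorem planar_of_loopLT (h : C.LoopLT c b b') : C.Planar c b b' := by
  obtain ⟨-, -, h | ⟨-, -, -, -, -, a, ha, d, d', hne, ⟨h1, h2⟩, ⟨h3, h4⟩, h5, h6, h7⟩⟩ := h
  · exact planar_of_loopLT₁ h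
  · exact ⟨a, ha, d, d', ⟨h2, h4, h1.face, h3.face, hne, .inr (.inr h7)⟩,
      desc_of_loopInclEq h5, desc_of_loopInclEq h6⟩

/-- Go back up the path from `d` towards `b`. By convexity `c` stays a face, and it stays a source
until the first loop `e` encountered; the nodes crossed form the descending part of a zig-zag.
`exists_zigStep_of_pos` is the mirror image. -/
theorem exists_zigStep_of_neg (hC : C.IsDFC) (hb : C.Loop c b) (h : C.Desc b d) (hd : C.Neg c d)
    (ha : a ∈ C.Lam) (hda : C.Neg d a) :
    ∃ a₁ e, C.Loop c e ∧ C.Neg e a₁ ∧ C.LoopInclEq b e ∧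
      Relation.TransGen (C.ZigStep c) a₁ a := by
  induction h generalizing a with
  | refl => exact (hb.not_neg hd).elim
  | tail h hs ih =>
    rename_i e d
    have he := hC.face_of_desc h (.single hs) hb.face hd.face
    obtain ⟨a₁, ha₁, h1, h2⟩ := hs
    have hz : C.ZigStep c a₁ a := ⟨ha₁, ha, d, .inl ⟨hd, h2, hda⟩⟩
    rcases he with he | he | he
    · obtain ⟨a₂, k, h3, h4, h5, h6⟩ := ih he ha₁ h1
      exact ⟨a₂, k, h3, h4, h5, h6.tail hz⟩
    · exact (hC.not_pos_neg_of_neg_pos hd h2 he h1).elim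
    · exact ⟨a₁, e, he, h1, hC.loopInclEq_of_desc h he, .single hz⟩

theorem exists_zigStep_of_pos (hC : C.IsDFC) (hb : C.Loop c b) (h : C.Desc b d) (hd : C.Pos c d)
    (ha : a ∈ C.Lam) (hda : C.Neg d a) :
    ∃ a₁ e, C.Loop c e ∧ C.Neg e a₁ ∧ C.LoopInclEq b e ∧
      Relation.TransGen (C.ZigStep c) a a₁ := by
  induction h generalizing a with
  | refl => exact (hb.not_pos hd).elim
  | tail h hs ih =>
    rename_i e d
    have he := hC.face_of_desc h (.single hs) hb.face hd.face
    obtain ⟨a₁, ha₁, h1, h2⟩ := hs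
    have hz : C.ZigStep c a a₁ := ⟨ha, ha₁, d, .inr ⟨hd, hda, h2⟩⟩
    rcases he with he | he | he
    · exact (hC.not_neg_neg_of_pos_pos hd h2 he h1).elim
    · obtain ⟨a₂, k, h3, h4, h5, h6⟩ := ih he ha₁ h1
      exact ⟨a₂, k, h3, h4, h5, .head hz h6⟩
    · exact ⟨a₁, e, he, h1, hC.loopInclEq_of_desc h he, .single hz⟩

/-- At the meeting node the first source cannot have target `c` and the second cannot have source
`c`. Whichever of them is not a loop is traced back to a loop along the zig-zag, which gives ◂¹; two
loops are compared by the local order. -/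
theorem loopLT_of_planar (hC : C.IsDFC) (hb : b ∈ C.MinLoops c) (hb' : b' ∈ C.MinLoops c)
    (h : C.Planar c b b') : C.LoopLT c b b' := by
  refine ⟨hb, hb', ?_⟩
  have hpl := h
  obtain ⟨a, ha, d, d', ⟨h1, h2, h3, h4, hne, h5⟩, h6, h7⟩ := h
  have hd : ¬ C.Pos c d := fun hd => by
    rcases h5 with h5 | h5 | h5
    · exact hd.not_neg h5
    · exact hne (hC.pos_neg_unique hd h1 h5 h2)
    · exact LocalLT.not_pos_left h5 hd
  have hd' : ¬ C.Neg c d' := fun hd' => by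
    rcases h5 with h5 | h5 | h5
    · exact hne (hC.neg_neg_unique h5 h1 hd' h2)
    · exact h5.not_neg hd'
    · exact LocalLT.not_neg_right h5 hd'
  rcases h3 with h3 | h3 | h3
  · obtain ⟨a₁, e, k1, k2, k3, k4⟩ := hC.exists_zigStep_of_neg hb.1 h6 h3 ha h1
    rcases h4 with h4 | h4 | h4
    · exact (hd' h4).elim
    · obtain ⟨a₂, e', m1, m2, m3, m4⟩ := hC.exists_zigStep_of_pos hb'.1 h7 h4 ha h2
      exact .inl ⟨a₁, a₂, e, e', k4.trans m4, ⟨k1, k2⟩, ⟨m1, m2⟩, k3, m3⟩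
    · exact .inl ⟨a₁, a, e, d', k4, ⟨k1, k2⟩, ⟨h4, h2⟩, k3, hC.loopInclEq_of_desc h7 h4⟩
  · exact (hd h3).elim
  · rcases h4 with h4 | h4 | h4
    · exact (hd' h4).elim
    · obtain ⟨a₂, e', m1, m2, m3, m4⟩ := hC.exists_zigStep_of_pos hb'.1 h7 h4 ha h2
      exact .inl ⟨a, a₂, d, e', m4, ⟨h3, h1⟩, ⟨m1, m2⟩, hC.loopInclEq_of_desc h6 h3, m3⟩
    · by_cases hlt : C.LoopLT₁ c b b'
      · exact .inl hlt
      refine .inr ⟨hb, hb', ?_, hlt, fun hlt' => hC.planar_asymm hpl (planar_of_loopLT₁ hlt'),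
        a, ha, d, d', hne, ⟨h3, h1⟩, ⟨h4, h2⟩, hC.loopInclEq_of_desc h6 h3,
        hC.loopInclEq_of_desc h7 h4, ?_⟩
      · rintro rfl
        exact hC.planar_irrefl hpl
      · rcases h5 with h5 | h5 | h5
        · exact (h3.not_neg h5).elim
        · exact (h4.not_pos h5).elim
        · exact h5

/-! ### Whitedots -/

/-- If `c` were a strict target of `γ(w)`, lozenge completion would produce a source of `w`, but `w`
has none. -/
theorem mem_white_iff (hC : C.IsDFC) {w : C.Cell} :
    w ∈ C.White c ↔ w ∈ C.Lam ∩ C.Null ∧ ∃ b, C.Pos b w ∧ C.Loop c b := by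
  constructor
  · rintro ⟨hw, b, hb, hc⟩
    have hb := (pos_or_loop_of_mem_γ hb).resolve_right (hC.not_loop_of_mem_lam hw.1)
    refine ⟨hw, b, hb, (pos_or_loop_of_mem_γ hc).resolve_left fun hc => ?_⟩
    obtain ⟨y, -, hy⟩ := hC.pos_pos hc hb
    have : C.δ w = ∅ := hw.2
    exact (Set.ext_iff.1 this y).1 hy.1
  · rintro ⟨hw, b, hb, hc⟩
    exact ⟨hw, b, hb.1, hc.2⟩

theorem whiteLT_iff (hC : C.IsDFC) {w w' : C.Cell} (hw : w ∈ C.Lam ∩ C.Null)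
    (hw' : w' ∈ C.Lam ∩ C.Null) (hb : C.Pos b w) (hc : C.Loop c b) (hb' : C.Pos b' w')
    (hc' : C.Loop c b') : C.WhiteLT c w w' ↔ C.Planar c b b' := by
  constructor
  · rintro ⟨e, he, e', he', h⟩
    obtain rfl := eq_of_mem_γ he hb.1
    obtain rfl := eq_of_mem_γ he' hb'.1
    exact planar_of_loopLT h
  · exact fun h => ⟨b, hb.1, b', hb'.1, hC.loopLT_of_planar ⟨hc, w, hw, hb⟩ ⟨hc', w', hw', hb'⟩ h⟩

/-- The order is pulled back from the planar order along the target map, which is injective on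
nulldots by `source_unique`. -/
theorem whiteLT_isStrictTotalOrder (hC : C.IsDFC) (c : C.Cell) :
    IsStrictTotalOrder (C.White c) fun w w' => C.WhiteLT c w w' := by
  choose h1 b h2 h3 using fun w : C.White c => hC.mem_white_iff.1 w.2
  have hiff : ∀ w w' : C.White c, C.WhiteLT c w w' ↔ C.Planar c (b w) (b w') := fun w w' =>
    hC.whiteLT_iff (h1 w) (h1 w') (h2 w) (h3 w) (h2 w') (h3 w')
  exact
    { trichotomous := fun w w' hww hww' => by
        rw [hiff] at hww hww'
        by_contra hne
        have hne' : b w ≠ b w' := fun h => hne (Subtype.ext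
          (hC.source_unique (h1 w).1 (h1 w').1 (h2 w) (h ▸ h2 w')))
        rcases hC.planar_total (.inr ⟨w, h1 w, h2 w⟩) (.inr ⟨w', h1 w', h2 w'⟩) (h3 w).face
          (h3 w').face hne' with h | h
        exacts [hww h, hww' h]
      irrefl := fun w => by
        rw [hiff]
        exact hC.planar_irrefl
      trans := fun w w' w'' h h' => by
        rw [hiff] at h h' ⊢
        exact hC.planar_trans h h' }

end IsDFC

end MOP

namespace MOP

variable {C : MOP.{u}} {a b c d s s' t t' : C.Cell}

/-! ### Connectedness of the tips above a cell -/

/-- `t` and `t'` are consecutive tips for the planar order over some cell. -/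
def NextTip (C : MOP.{u}) (t t' : C.Cell) : Prop :=
  ∃ c, C.Face c t ∧ C.Face c t' ∧ C.Planar c t t' ∧
    ∀ s, C.IsTip s → C.Face c s → ¬ (C.Planar c t s ∧ C.Planar c s t')

/-- `s` and `s'` are consecutive tips, in some order, and there are descending paths from them
to `b`. -/
def TipAdj (C : MOP.{u}) (b s s' : C.Cell) : Prop :=
  (C.IsTip s ∧ C.Desc s b) ∧ (C.IsTip s' ∧ C.Desc s' b) ∧ (C.NextTip s s' ∨ C.NextTip s' s)

theorem TipAdj.symm (h : C.TipAdj b s s') : C.TipAdj b s' s := ⟨h.2.1, h.1, h.2.2.symm⟩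

theorem TipAdj.mono (h : C.TipAdj d s s') (hd : C.Desc d b) : C.TipAdj b s s' :=
  ⟨⟨h.1.1, h.1.2.trans hd⟩, ⟨h.2.1.1, h.2.1.2.trans hd⟩, h.2.2⟩

theorem reflTransGen_tipAdj_symm (h : Relation.ReflTransGen (C.TipAdj b) s s') :
    Relation.ReflTransGen (C.TipAdj b) s' s :=
  have : Std.Symm (C.TipAdj b) := ⟨fun _ _ h => h.symm⟩
  Relation.ReflTransGen.stdSymm.symm _ _ h

namespace IsDFC

theorem exists_neg_of_not_null (hC : C.IsDFC) (ha : a ∈ C.Lam) (h : a ∉ C.Null) :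
    ∃ d, C.Neg d a := by
  obtain ⟨d, hd⟩ := Set.nonempty_iff_ne_empty.2 h
  exact ⟨d, (neg_or_loop_of_mem_δ hd).resolve_right (hC.not_loop_of_mem_lam ha)⟩

/-- Climb from `b`, at each node choosing a source that still has face `c`. If `b` is a loop, every
source of the node will do, and there is one as long as `b` is not a tip. -/
theorem exists_tip_of_face (hC : C.IsDFC) (hc : C.Face c b) :
    ∃ t, C.IsTip t ∧ C.Desc t b ∧ C.Face c t := by
  induction b using hC.wellFounded_descent.induction with
  | _ b ih =>
  rcases hC.lam_or_pos b with h | ⟨a, ha, h⟩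
  · exact ⟨b, .inl h, .refl, hc⟩
  by_cases hn : a ∈ C.Null
  · exact ⟨b, .inr ⟨a, ⟨ha, hn⟩, h⟩, .refl, hc⟩
  obtain ⟨d, hd, hcd⟩ : ∃ d, C.Neg d a ∧ C.Face c d := by
    rcases hc with hc | hc | hc
    · obtain ⟨d, h1, h2⟩ := hC.neg_pos hc h
      exact ⟨d, h2, h1.face⟩
    · obtain ⟨d, h1, h2⟩ := hC.pos_pos hc h
      exact ⟨d, h2, h1.face⟩
    · obtain ⟨d, hd⟩ := hC.exists_neg_of_not_null ha hn
      exact ⟨d, hd, (hC.loop_of_loop_pos hc h hd).face⟩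
  have hdb : C.Descent d b := ⟨a, ha, hd, h⟩
  obtain ⟨t, h1, h2, h3⟩ := ih d hdb hcd
  exact ⟨t, h1, h2.tail hdb, h3⟩

theorem wellFounded_planar (hC : C.IsDFC) (c : C.Cell) : WellFounded (C.Planar c) :=
  have := C.finite
  have : IsTrans C.Cell (C.Planar c) := ⟨fun _ _ _ => hC.planar_trans⟩
  have : Std.Irrefl (C.Planar c) := ⟨fun _ => hC.planar_irrefl⟩
  Finite.wellFounded_of_trans_of_irrefl _

theorem wellFounded_swap_planar (hC : C.IsDFC) (c : C.Cell) :
    WellFounded (Function.swap (C.Planar c)) :=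
  have := C.finite
  have : IsTrans C.Cell (Function.swap (C.Planar c)) := ⟨fun _ _ _ h h' => hC.planar_trans h' h⟩
  have : Std.Irrefl (Function.swap (C.Planar c)) := ⟨fun _ => hC.planar_irrefl⟩
  Finite.wellFounded_of_trans_of_irrefl _

theorem tipAdj_of_planar (hC : C.IsDFC) (ht : C.IsTip t) (htb : C.Desc t b) (hct : C.Face c t)
    (ht' : C.IsTip t') (htb' : C.Desc t' b) (hct' : C.Face c t') (h : C.Planar c t t') :
    Relation.ReflTransGen (C.TipAdj b) t t' := by
  induction t' using (hC.wellFounded_planar c).induction with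
  | _ t' ih =>
  by_cases hex : ∃ s, C.IsTip s ∧ C.Face c s ∧ C.Planar c t s ∧ C.Planar c s t'
  -- A planar-maximal `s` between `t` and `t'` is the immediate predecessor of `t'`; convexity keeps
  -- it above `b`.
  · obtain ⟨s, ⟨h1, h2, h3, h4⟩, hs⟩ := (hC.wellFounded_swap_planar c).has_min
      {s | C.IsTip s ∧ C.Face c s ∧ C.Planar c t s ∧ C.Planar c s t'} hex
    have hsb := hC.desc_of_planar h3 h4 htb htb'
    refine (ih s h4 h1 hsb h2 h3).tail ⟨⟨h1, hsb⟩, ⟨ht', htb'⟩, .inl ⟨c, h2, hct', h4, ?_⟩⟩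
    exact fun r hr hcr hrs => hs r ⟨hr, hcr, hC.planar_trans h3 hrs.1, hrs.2⟩ hrs.1
  · exact .single ⟨⟨ht, htb⟩, ⟨ht', htb'⟩, .inl ⟨c, hct, hct', h, fun s hs hcs hss =>
      hex ⟨s, hs, hcs, hss.1, hss.2⟩⟩⟩

theorem tipAdj_of_face (hC : C.IsDFC) (ht : C.IsTip t) (htb : C.Desc t b) (hct : C.Face c t)
    (ht' : C.IsTip t') (htb' : C.Desc t' b) (hct' : C.Face c t') :
    Relation.ReflTransGen (C.TipAdj b) t t' := by
  rcases eq_or_ne t t' with rfl | hne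
  · exact .refl
  rcases hC.planar_total ht ht' hct hct' hne with h | h
  · exact hC.tipAdj_of_planar ht htb hct ht' htb' hct' h
  · exact reflTransGen_tipAdj_symm
      (hC.tipAdj_of_planar ht' htb' hct' ht htb hct h)

/-- The sources of a cell are connected through their faces. -/
theorem exists_source_connected (hC : C.IsDFC) (hb : C.Pos b a) (hd : C.Neg d a)
    (hdim : 1 ≤ C.dim b) :
    ∃ d₀, C.Neg d₀ a ∧ ∀ d, C.Neg d a → Relation.ReflTransGen
      (fun d d' => C.Neg d a ∧ C.Neg d' a ∧ ∃ c, C.Face c d ∧ C.Face c d') d d₀ := by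
  have := C.finite
  have hdima := hb.dim
  obtain ⟨c₀, hc₀ | hc₀⟩ := C.exists_pos_or_loop (x := b) (by lia)
  · obtain ⟨d₀, h1, h2⟩ := hC.pos_pos hc₀ hb
    refine ⟨d₀, h2, ?_⟩
    -- Follow strict targets: `z` is either a source of another source of `a`, which is then a
    -- neighbour and smaller for the acyclic relation, or the target `c₀` of `b`, in which case `d`
    -- is `d₀`.
    have key : ∀ d z, C.Pos z d → C.Neg d a → Relation.ReflTransGen
        (fun d d' => C.Neg d a ∧ C.Neg d' a ∧ ∃ c, C.Face c d ∧ C.Face c d') d d₀ := by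
      intro d
      induction d using (wellFounded_of_acyclic (hC.acyclic a (by lia))).induction with
      | _ d ih =>
      intro z hz hd
      rcases hC.pos_neg hz hd with ⟨d', h3, h4⟩ | ⟨b', h3, h4⟩
      · obtain ⟨z', hz' | hz'⟩ := C.exists_pos_or_loop (x := d') (by have := h4.dim; lia)
        · exact .head ⟨hd, h4, z, hz.face, h3.face⟩ (ih d' ⟨h4, hd, z, h3, hz⟩ z' hz' h4)
        · exact (hz'.not_neg h3).elim
      · obtain rfl := h4.unique hb
        obtain rfl := h3.unique hc₀
        rw [hC.pos_neg_unique hz hd h1 h2]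
    intro d hd
    obtain ⟨z, hz | hz⟩ := C.exists_pos_or_loop (x := d) (by have := hd.dim; lia)
    · exact key d z hz hd
    -- A loop among the sources shares its face with a source that is not a loop, since the target
    -- `b` is not a loop here.
    · rcases hC.loop_neg hz hd with ⟨b', h3, h4⟩ | ⟨d', h3, h4⟩
      · obtain rfl := h4.unique hb
        exact (h3.not_pos hc₀).elim
      · obtain ⟨z', hz' | hz'⟩ := C.exists_pos_or_loop (x := d') (by have := h4.dim; lia)
        · refine .head ⟨hd, h4, z, hz.face, ?_⟩ (key d' z' hz' h4)
          rcases h3 with h3 | h3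
          exacts [h3.face, h3.face]
        · rcases h3 with h3 | h3
          exacts [(hz'.not_neg h3).elim, (hz'.not_pos h3).elim]
  · exact ⟨d, hd, fun d' hd' => .single ⟨hd', hd, c₀, (hC.loop_of_loop_pos hc₀ hb hd').face,
      (hC.loop_of_loop_pos hc₀ hb hd).face⟩⟩

/-- The tips from which there is a descending path to `b` are connected. -/
theorem tipAdj_connected (hC : C.IsDFC) (hdim : 1 ≤ C.dim b) (ht : C.IsTip t) (htb : C.Desc t b)
    (ht' : C.IsTip t') (htb' : C.Desc t' b) : Relation.ReflTransGen (C.TipAdj b) t t' := by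
  induction b using hC.wellFounded_descent.induction generalizing t t' with
  | _ b ih =>
  by_cases hb : C.IsTip b
  · rw [hC.eq_of_desc_of_isTip htb hb, hC.eq_of_desc_of_isTip htb' hb]
  rcases Relation.ReflTransGen.cases_tail htb with rfl | ⟨d, hd, hdb⟩
  · exact (hb ht).elim
  rcases Relation.ReflTransGen.cases_tail htb' with rfl | ⟨d', hd', hdb'⟩
  · exact (hb ht').elim
  obtain ⟨a, ha, hda, hba⟩ := hdb
  obtain ⟨a', ha', hda', hba'⟩ := hdb'
  obtain rfl := hC.source_unique ha ha' hba hba'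
  have hup : ∀ d, C.Neg d a → C.Descent d b := fun d hd => ⟨a, ha, hd, hba⟩
  have hsrc : ∀ d, C.Neg d a → ∀ t t', C.IsTip t → C.Desc t d → C.IsTip t' → C.Desc t' d →
      Relation.ReflTransGen (C.TipAdj b) t t' := fun d hd t t' h1 h2 h3 h4 =>
    Relation.ReflTransGen.mono (fun _ _ h => h.mono (.single (hup d hd))) _ _
      (ih d (hup d hd) (by rwa [(hup d hd).dim]) h1 h2 h3 h4)
  -- To pass between sources with a common face `c`, lift that face to a tip above each of them;
  -- both tips have face `c` and are joined along the planar order over `c`.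
  have hpath : ∀ d d', Relation.ReflTransGen
      (fun d d' => C.Neg d a ∧ C.Neg d' a ∧ ∃ c, C.Face c d ∧ C.Face c d') d d' → C.Neg d a →
      C.Neg d' a → ∀ t t', C.IsTip t → C.Desc t d → C.IsTip t' → C.Desc t' d' →
      Relation.ReflTransGen (C.TipAdj b) t t' := by
    intro d d' h hd
    induction h with
    | refl => exact hsrc d
    | tail _ h ih' =>
      intro hd' t t' h1 h2 h3 h4
      obtain ⟨h5, -, c, h6, h7⟩ := h
      obtain ⟨s, k1, k2, k3⟩ := hC.exists_tip_of_face h6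
      obtain ⟨s', m1, m2, m3⟩ := hC.exists_tip_of_face h7
      exact (ih' h5 t s h1 h2 k1 k2).trans ((hC.tipAdj_of_face k1 (k2.tail (hup _ h5)) k3 m1
        (m2.tail (hup _ hd')) m3).trans (hsrc _ hd' s' t' m1 m2 h3 h4))
  obtain ⟨d₀, h₀, hconn⟩ := hC.exists_source_connected hba hda hdim
  obtain ⟨c₀, hc₀⟩ : ∃ c, C.Face c d₀ := by
    obtain ⟨c, hc⟩ := C.exists_pos_or_loop (x := d₀) (by have := h₀.dim; have := hba.dim; lia)
    exact ⟨c, .inr hc⟩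
  obtain ⟨s, k1, k2, -⟩ := hC.exists_tip_of_face hc₀
  exact (hpath d d₀ (hconn d hda) hda h₀ t s ht hd k1 k2).trans
    (reflTransGen_tipAdj_symm
      (hpath d' d₀ (hconn d' hda') hda' h₀ t' s ht' hd' k1 k2))

end IsDFC

end MOP

/-! ## Trees and constellations from relations -/

/-- A rooted tree presented by its relations `tgt b a` (`b` is the target edge of `a`) and `src b a`
(`b` is a source edge of `a`). -/
structure TreeData (α : Type u) where
  nodes : Finset α
  edges : Finset α
  tgt : α → α → Prop
  src : α → α → Prop
  root : α
  root_mem : root ∈ edges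
  exists_tgt : ∀ a ∈ nodes, ∃ b ∈ edges, tgt b a
  tgt_unique : ∀ a ∈ nodes, ∀ b b', tgt b a → tgt b' a → b = b'
  tgt_injective : ∀ a ∈ nodes, ∀ a' ∈ nodes, ∀ b, tgt b a → tgt b a' → a = a'
  src_unique : ∀ a ∈ nodes, ∀ a' ∈ nodes, ∀ b, src b a → src b a' → a = a'
  not_src_root : ∀ a ∈ nodes, ¬ src root a
  exists_path : ∀ b ∈ edges,
    Relation.ReflTransGen (fun b b' => ∃ a ∈ nodes, src b a ∧ tgt b' a) b root

namespace TreeData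

variable {α : Type u} (D : TreeData α)

/-- The target edge of a node. -/
noncomputable def target (a : D.nodes) : D.edges :=
  ⟨(D.exists_tgt a a.2).choose, (D.exists_tgt a a.2).choose_spec.1⟩

theorem target_eq_iff (a : D.nodes) (b : D.edges) : D.target a = b ↔ D.tgt b a := by
  have h := (D.exists_tgt a a.2).choose_spec.2
  constructor
  · rintro rfl
    exact h
  · exact fun h' => Subtype.ext (D.tgt_unique a a.2 _ _ h h')

open Classical in
/-- The target node of an edge, if there is one. -/
noncomputable def targetNode (b : D.edges) : Option D.nodes :=
  if h : ∃ a : D.nodes, D.src b a then some h.choose else none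

theorem targetNode_eq_iff (b : D.edges) (a : D.nodes) :
    D.targetNode b = some a ↔ D.src b a := by
  unfold targetNode
  split_ifs with h
  · have hs := h.choose_spec
    simp only [Option.some.injEq]
    constructor
    · rintro rfl
      exact hs
    · exact fun h' => Subtype.ext (D.src_unique _ h.choose.2 a a.2 b hs h')
  · simp only [false_iff]
    exact fun h' => h ⟨a, h'⟩

/-- The rooted tree presented by relations. -/
noncomputable def toDotTree : DotTree α where
  nodes := D.nodes
  edges := D.edges
  target := D.target
  targetNode := D.targetNode
  target_injective a a' h := by
    have h1 := (D.target_eq_iff a _).1 h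
    have h2 := (D.target_eq_iff a' _).1 rfl
    exact Subtype.ext (D.tgt_injective a a.2 a' a'.2 _ h1 h2)
  root := ⟨D.root, D.root_mem⟩
  targetNode_root := by
    rw [Option.eq_none_iff_forall_ne_some]
    intro a ha
    exact D.not_src_root a a.2 ((D.targetNode_eq_iff _ a).1 ha)
  exists_path b := by
    obtain ⟨b, hb⟩ := b
    have h := D.exists_path b hb
    induction h using Relation.ReflTransGen.head_induction_on with
    | refl => exact .refl
    | head hs _ ih =>
      obtain ⟨a, ha, h1, h2⟩ := hs
      obtain ⟨b', hb', h3⟩ := D.exists_tgt a ha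
      obtain rfl := D.tgt_unique a ha _ _ h2 h3
      exact .head ⟨⟨a, ha⟩, (D.targetNode_eq_iff _ _).2 h1, (D.target_eq_iff _ _).2 h2⟩ (ih hb')

@[simp] theorem mem_toDotTree_nodes {x : α} : x ∈ D.toDotTree.nodes ↔ x ∈ D.nodes := Iff.rfl

@[simp] theorem mem_toDotTree_edges {x : α} : x ∈ D.toDotTree.edges ↔ x ∈ D.edges := Iff.rfl

theorem toDotTree_target_eq_iff (a : D.toDotTree.nodes) (b : D.toDotTree.edges) :
    D.toDotTree.target a = b ↔ D.tgt b a := D.target_eq_iff a b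

theorem toDotTree_targetNode_eq_iff (b : D.toDotTree.edges) (a : D.toDotTree.nodes) :
    D.toDotTree.targetNode b = some a ↔ D.src b a := D.targetNode_eq_iff b a

end TreeData

/-! ### Descending paths in terms of edges alone -/

namespace DotTree

variable {α : Type u} {T U : DotTree α}

/-- The step from an edge to the target of its target node. -/
def EdgeStep (T : DotTree α) (b b' : T.edges) : Prop :=
  ∃ a, T.targetNode b = some a ∧ T.target a = b'

theorem descends_of_edgeStep {b b' : T.edges} (h : Relation.ReflTransGen T.EdgeStep b b') :
    T.Descends (.inr b) (.inr b') := by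
  induction h with
  | refl => exact .refl
  | tail _ h ih =>
    obtain ⟨a, h1, rfl⟩ := h
    exact (ih.tail (.edge _ a h1)).tail (.node a)

theorem edgeStep_of_descends {x : T.nodes ⊕ T.edges} {b' : T.edges}
    (h : T.Descends x (.inr b')) :
    Relation.ReflTransGen T.EdgeStep (Sum.elim T.target id x) b' := by
  induction h using Relation.ReflTransGen.head_induction_on with
  | refl => exact .refl
  | head hs _ ih =>
    cases hs with
    | node a => exact ih
    | edge b a h => exact .head ⟨a, h, rfl⟩ ih

/-- A nontrivial path into the target edge of `x` must pass through `x`, the only source node of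
that edge. So descending to a node can be tested on its target edge. -/
theorem descends_node_of_edgeStep {b : T.edges} {x : T.nodes}
    (h : Relation.TransGen T.EdgeStep b (T.target x)) : T.Descends (.inr b) (.inl x) := by
  obtain ⟨b', h1, a, h2, h3⟩ := Relation.TransGen.tail'_iff.1 h
  obtain rfl := T.target_injective h3
  exact (descends_of_edgeStep h1).tail (.edge _ _ h2)

theorem leaf_descends_node_iff {b : T.edges} (hb : T.IsLeaf b) {x : T.nodes} :
    T.Descends (.inr b) (.inl x) ↔ Relation.ReflTransGen T.EdgeStep b (T.target x) := by
  constructor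
  · exact fun h => edgeStep_of_descends (h.tail (.node x))
  · intro h
    rcases Relation.reflTransGen_iff_eq_or_transGen.1 h with h | h
    · exact (hb x h).elim
    · exact descends_node_of_edgeStep h

theorem node_descends_node_iff {a x : T.nodes} :
    T.Descends (.inl a) (.inl x) ↔
      Relation.ReflTransGen T.EdgeStep (T.target a) (T.target x) := by
  constructor
  · exact fun h => edgeStep_of_descends (h.tail (.node x))
  · intro h
    rcases Relation.reflTransGen_iff_eq_or_transGen.1 h with h | h
    · rw [T.target_injective h]
      exact .refl
    · exact .head (.node a) (descends_node_of_edgeStep h)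

/-- The subdivision without whitedots. -/
def Subdivision.empty (T : DotTree α) : T.Subdivision where
  W _ := ∅
  lt _ _ _ := False
  lt_total _ :=
    { trichotomous := fun w => (Finset.notMem_empty _ w.2).elim
      irrefl := fun w => (Finset.notMem_empty _ w.2).elim
      trans := fun w => (Finset.notMem_empty _ w.2).elim }

end DotTree

namespace Constellation

variable {α : Type u} {T U : DotTree α}

/-- The constellation whose structural maps are identities. -/
noncomputable def ofExact (S : T.Subdivision)
    (hB : ∀ x, x ∈ T.nodes ↔ ∃ h : x ∈ U.edges, U.IsLeaf ⟨x, h⟩)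
    (hW : ∀ x, (∃ b, x ∈ S.W b) ↔ ∃ h : x ∈ U.nodes, U.IsNulldot ⟨x, h⟩)
    (hdisj : ∀ x b b', x ∈ S.W b → x ∈ S.W b' → b = b')
    (kernel : ∀ x : U.nodes, (S.graph.induce {t | U.Descends
      (Sum.elim (fun a => .inr ⟨a.1, ((hB a.1).1 a.2).1⟩)
        (fun w => .inl ⟨w.2.1, ((hW w.2.1).1 ⟨w.1, w.2.2⟩).1⟩) t) (.inl x)}).Connected) :
    Constellation T U where
  sub := S
  σBlack := Equiv.ofBijective (fun a => ⟨⟨a.1, ((hB a.1).1 a.2).1⟩, ((hB a.1).1 a.2).2⟩)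
    ⟨fun a a' h => Subtype.ext (congrArg (fun y => (y.1.1 : α)) h),
      fun y => ⟨⟨y.1.1, (hB _).2 ⟨y.1.2, y.2⟩⟩, rfl⟩⟩
  σWhite := Equiv.ofBijective
    (fun w => ⟨⟨w.2.1, ((hW w.2.1).1 ⟨w.1, w.2.2⟩).1⟩, ((hW w.2.1).1 ⟨w.1, w.2.2⟩).2⟩)
    ⟨by
      rintro ⟨b, w, hw⟩ ⟨b', w', hw'⟩ h
      obtain rfl : w = w' := congrArg (fun y => (y.1.1 : α)) h
      obtain rfl := hdisj _ _ _ hw hw'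
      rfl, fun y => by
      obtain ⟨b, hb⟩ := (hW y.1.1).2 ⟨y.1.2, y.2⟩
      exact ⟨⟨b, y.1.1, hb⟩, rfl⟩⟩
  kernel := kernel

/-- The constellation without whitedots from a tree with a single node to a tree with a single leaf
and no nulldots. -/
noncomputable def ofUnary (T U : DotTree α) (hT : T.nodes.card = 1)
    (hB : ∀ x, x ∈ T.nodes ↔ ∃ h : x ∈ U.edges, U.IsLeaf ⟨x, h⟩)
    (hU : ∀ a, ¬ U.IsNulldot a)
    (kernel : ∀ x : U.nodes, ∃ b, U.IsLeaf b ∧ U.Descends (.inr b) (.inl x)) :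
    Constellation T U :=
  ofExact (DotTree.Subdivision.empty T) hB
    (fun x => ⟨fun ⟨_, h⟩ => (Finset.notMem_empty _ h).elim, fun ⟨_, h⟩ => (hU _ h).elim⟩)
    (fun _ _ _ h => (Finset.notMem_empty _ h).elim)
    (fun x => by
      obtain ⟨b, hb, hx⟩ := kernel x
      refine (SimpleGraph.connected_iff _).2
        ⟨?_, ⟨⟨.inl ⟨b.1, (hB _).2 ⟨b.2, hb⟩⟩, hx⟩⟩⟩
      rintro ⟨t, ht⟩ ⟨t', ht'⟩
      -- There is only one dot, so connectedness reduces to nonemptiness.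
      have key : t = t' := by
        rcases t with t | ⟨b, w⟩
        · rcases t' with t' | ⟨b, w⟩
          · exact congrArg _ (Subtype.ext (Finset.card_le_one.1 hT.le _ t.2 _ t'.2))
          · exact (Finset.notMem_empty _ w.2).elim
        · exact (Finset.notMem_empty _ w.2).elim
      subst key
      exact .refl _)

end Constellation

/-! ## Isomorphisms given by a bijection between names -/

/-- The bijection `F` between names restricts to an isomorphism of rooted trees. -/
structure DotTree.IsIsoVia {α β : Type u} (F : α ≃ β) (T : DotTree α) (U : DotTree β) : Prop where
  mem_nodes : ∀ x, x ∈ T.nodes ↔ F x ∈ U.nodes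
  mem_edges : ∀ x, x ∈ T.edges ↔ F x ∈ U.edges
  target : ∀ (a : T.nodes) (b : T.edges), T.target a = b →
    U.target ⟨F a, (mem_nodes a).1 a.2⟩ = ⟨F b, (mem_edges b).1 b.2⟩
  targetNode : ∀ (b : T.edges) (a : T.nodes), T.targetNode b = some a ↔
    U.targetNode ⟨F b, (mem_edges b).1 b.2⟩ = some ⟨F a, (mem_nodes a).1 a.2⟩
  root : F T.root = U.root

/-- The isomorphism of rooted trees given by a bijection between names. -/
def DotTree.IsIsoVia.iso {α β : Type u} {F : α ≃ β} {T : DotTree α} {U : DotTree β}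
    (h : DotTree.IsIsoVia F T U) : T.Iso U where
  node := F.subtypeEquiv h.mem_nodes
  edge := F.subtypeEquiv h.mem_edges
  map_target a := (h.target a _ rfl).symm
  map_targetNode b := by
    ext a'
    obtain ⟨a, rfl⟩ := (F.subtypeEquiv h.mem_nodes).surjective a'
    simp only [Option.map_eq_some_iff, EmbeddingLike.apply_eq_iff_eq, exists_eq_right]
    exact h.targetNode b a
  map_root := Subtype.ext h.root

/-- The bijection `F` between names restricts to an isomorphism of opetopes. -/
structure KJBM.IsIsoVia (X Y : KJBM.{u}) (F : X.Name ≃ Y.Name) : Prop where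
  dim_eq : X.dim = Y.dim
  tree : ∀ k (h : k ≤ X.dim), DotTree.IsIsoVia F (X.tree k h) (Y.tree k (dim_eq ▸ h))
  mem_W : ∀ k (h : k + 1 ≤ X.dim) (b : (X.tree k (Nat.le_of_succ_le h)).edges) x,
    x ∈ (X.con k h).sub.W b ↔
      F x ∈ (Y.con k (dim_eq ▸ h)).sub.W ((tree k (Nat.le_of_succ_le h)).iso.edge b)
  lt_iff : ∀ k (h : k + 1 ≤ X.dim) b (w w' : (X.con k h).sub.W b),
    (X.con k h).sub.lt b w w' ↔
      (Y.con k (dim_eq ▸ h)).sub.lt ((tree k (Nat.le_of_succ_le h)).iso.edge b)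
        ⟨F w, (mem_W k h b w).1 w.2⟩ ⟨F w', (mem_W k h b w').1 w'.2⟩

namespace KJBM

theorem whiteLT_mk_iff {α : Type u} {T : DotTree α} {S : T.Subdivision} {b : T.edges}
    {w w' : S.W b} : S.WhiteLT ⟨b, w⟩ ⟨b, w'⟩ ↔ S.lt b w w' :=
  ⟨fun h => by cases h; assumption, .mk b w w'⟩

theorem fst_eq_of_whiteLT {α : Type u} {T : DotTree α} {S : T.Subdivision} {w w' : S.Whitedot}
    (h : S.WhiteLT w w') : w.1 = w'.1 := by
  cases h
  rfl

/-- The isomorphism of opetopes given by a bijection between names. -/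
def IsIsoVia.hom {X Y : KJBM.{u}} {F : X.Name ≃ Y.Name} (h : IsIsoVia X Y F) : X ⟶ Y where
  dim_eq := h.dim_eq
  tree k hk := (h.tree k hk).iso
  white k hk := Equiv.sigmaCongr (h.tree k _).iso.edge
    fun b => F.subtypeEquiv (h.mem_W k hk b)
  white_edge k hk w := rfl
  white_lt k hk w w' := by
    obtain ⟨b, w⟩ := w
    obtain ⟨b', w'⟩ := w'
    by_cases hb : b = b'
    · subst hb
      exact whiteLT_mk_iff.trans ((h.lt_iff k hk b w w').trans whiteLT_mk_iff.symm)
    · refine ⟨fun h' => (hb (fst_eq_of_whiteLT h')).elim, fun h' => (hb ?_).elim⟩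
      exact (h.tree k _).iso.edge.injective (fst_eq_of_whiteLT h')
  map_σBlack k hk a := Subtype.ext <| by
    rw [(Y.opetope.exact k _).1]
    exact congrArg F ((X.opetope.exact k hk).1 a)
  map_σWhite k hk w := Subtype.ext <| by
    rw [(Y.opetope.exact k _).2]
    exact congrArg F ((X.opetope.exact k hk).2 w)

theorem whitedot_ext {α : Type u} {T : DotTree α} {S : T.Subdivision} {w w' : S.Whitedot}
    (h : w.1 = w'.1) (h' : (w.2 : α) = w'.2) : w = w' := by
  obtain ⟨b, w⟩ := w
  obtain ⟨b', w'⟩ := w'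
  obtain rfl : b = b' := h
  obtain rfl := Subtype.ext h'
  rfl

/-- Isomorphisms of opetopes that agree on the names are equal. -/
theorem hom_ext_names {X Y : KJBM.{u}} {f g : X ⟶ Y}
    (hnode : ∀ k h a, ((f.tree k h).node a : Y.Name) = (g.tree k h).node a)
    (hedge : ∀ k h b, ((f.tree k h).edge b : Y.Name) = (g.tree k h).edge b)
    (hwhite : ∀ k h w, ((f.white k h w).2 : Y.Name) = (g.white k h w).2) : f = g := by
  have htree : f.tree = g.tree := by
    funext k h
    apply DotTree.Iso.ext
    · ext a
      exact hnode k h a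
    · ext b
      exact hedge k h b
  refine Hom.ext htree ?_
  funext k h
  ext w : 1
  refine whitedot_ext ?_ (hwhite k h w)
  rw [f.white_edge, g.white_edge, htree]

end KJBM

/-! ## The opetope of a dendritic face complex -/

namespace MOP

variable {C : MOP.{u}} {a b c d : C.Cell}

instance (C : MOP.{u}) : Finite C.Cell := C.finite

/-- The names: the cells, and two names for the edges of the trees of index `0` and `1`. -/
abbrev ZoomName (C : MOP.{u}) : Type u := C.Cell ⊕ ULift.{u} Bool

/-- A set of names, as a finite set. -/
noncomputable def nameFinset (s : Set C.ZoomName) : Finset C.ZoomName := (Set.toFinite s).toFinset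

@[simp] theorem mem_nameFinset {s : Set C.ZoomName} {x : C.ZoomName} :
    x ∈ nameFinset s ↔ x ∈ s := by
  simp [nameFinset]

/-- The name of the leaf of the trees of index `0` and `1`. -/
abbrev leafName (C : MOP.{u}) : C.ZoomName := .inr ⟨false⟩

/-- The name of the root of the trees of index `0` and `1`. -/
abbrev rootName (C : MOP.{u}) : C.ZoomName := .inr ⟨true⟩

/-- The tree with a single node `x`, a leaf and a root. -/
noncomputable def unaryData (C : MOP.{u}) (x : C.ZoomName) : TreeData C.ZoomName where
  nodes := {x}
  edges := nameFinset {C.leafName, C.rootName}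
  tgt b _ := b = C.rootName
  src b _ := b = C.leafName
  root := C.rootName
  root_mem := by simp
  exists_tgt a _ := ⟨_, by simp, rfl⟩
  tgt_unique _ _ _ _ h h' := h.trans h'.symm
  tgt_injective a ha a' ha' _ _ _ :=
    (Finset.mem_singleton.1 ha).trans (Finset.mem_singleton.1 ha').symm
  src_unique a ha a' ha' _ _ _ :=
    (Finset.mem_singleton.1 ha).trans (Finset.mem_singleton.1 ha').symm
  not_src_root _ _ := by simp
  exists_path b hb := by
    rcases mem_nameFinset.1 hb with rfl | rfl
    · exact .single ⟨x, by simp, rfl, rfl⟩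
    · exact .refl

theorem unaryData_isLeaf_iff {x : C.ZoomName} (b : (C.unaryData x).toDotTree.edges) :
    (C.unaryData x).toDotTree.IsLeaf b ↔ (b : C.ZoomName) = C.leafName := by
  constructor
  · intro h
    rcases mem_nameFinset.1 b.2 with hb | hb
    · exact hb
    · exact (h ⟨x, Finset.mem_singleton_self x⟩
        (((C.unaryData x).toDotTree_target_eq_iff _ _).2 hb)).elim
  · intro h a ha
    have h' : (b : C.ZoomName) = C.rootName := ((C.unaryData x).toDotTree_target_eq_iff _ _).1 ha
    simp [h] at h'

theorem leafName_mem_unaryData {x : C.ZoomName} :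
    C.leafName ∈ (C.unaryData x).toDotTree.edges := mem_nameFinset.2 (.inl rfl)

theorem unaryData_isUnary (x : C.ZoomName) : (C.unaryData x).toDotTree.IsUnary :=
  ⟨Finset.card_singleton x, ⟨_, leafName_mem_unaryData⟩, (unaryData_isLeaf_iff _).2 rfl,
    fun b hb => Subtype.ext ((unaryData_isLeaf_iff b).1 hb)⟩

theorem unaryData_targetNode {x : C.ZoomName} (a : (C.unaryData x).toDotTree.nodes) :
    (C.unaryData x).toDotTree.targetNode ⟨_, leafName_mem_unaryData⟩ = some a :=
  ((C.unaryData x).toDotTree_targetNode_eq_iff _ _).2 rfl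

/-! ### The tree of each level -/

/-- The dimension of a dendritic face complex, as a natural number. -/
noncomputable def IsDFC.height (hC : C.IsDFC) : ℕ := (C.dim hC.greatest.choose).toNat

namespace IsDFC

theorem exists_greatest (hC : C.IsDFC) : ∃ ω, C.IsGreatestCell ω ∧ C.dim ω = hC.height := by
  have h := hC.greatest.choose_spec
  exact ⟨_, h.1, by rw [height]; lia⟩

theorem hasDim (hC : C.IsDFC) : C.HasDim hC.height := by
  obtain ⟨ω, hω, hd⟩ := hC.exists_greatest
  refine ⟨⟨ω, hd⟩, ?_⟩
  rintro _ ⟨x, rfl⟩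
  rcases le_dim (hω x) with rfl | h <;> lia

theorem exists_isIteratedTarget_dim (hC : C.IsDFC) {k : ℕ} (hk : k ≤ hC.height) :
    ∃ g, C.IsIteratedTarget g ∧ C.dim g = k := by
  obtain ⟨ω, hω, hd⟩ := hC.exists_greatest
  exact exists_isIteratedTarget_of_le hω (by lia) (by lia)

theorem pos_of_dim_zero {x s : C.Cell} (hx : C.dim x = 0) (hs : C.dim s = -1) : C.Pos s x := by
  show s ∈ C.γ x \ C.δ x
  rw [C.γ_diff_δ_of_dim_zero s x hs hx]
  exact rfl

/-- The cell of dimension -1 is the strict target of every cell of dimension 0, so lozenge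
completion below `a` yields one source, and only one. This makes `T₂` linear. -/
theorem exists_neg_of_dim_one (hC : C.IsDFC) (ha : a ∈ C.Lam) (hd : C.dim a = 1) :
    ∃! b, C.Neg b a := by
  obtain ⟨s, hs, -⟩ := C.existsUnique_bot
  obtain ⟨b, hb⟩ := C.exists_pos_or_loop (x := a) (by lia)
  have hb := hb.resolve_right (hC.not_loop_of_mem_lam ha)
  obtain ⟨d, h1, h2⟩ := hC.pos_pos (pos_of_dim_zero (by have := hb.dim; lia) hs) hb
  exact ⟨d, h2, fun d' hd' => hC.pos_neg_unique
    (pos_of_dim_zero (by have := hd'.dim; lia) hs) hd' h1 h2⟩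

theorem existsUnique_lam_zero (hC : C.IsDFC) : ∃! a, a ∈ C.Lam ∧ C.dim a = 0 := by
  obtain ⟨s, hs, -⟩ := C.existsUnique_bot
  obtain ⟨g, hg, hd⟩ := hC.exists_isIteratedTarget_dim (Nat.zero_le _)
  push_cast at hd
  rcases (hC.isRootOfLevel hg).lam with hlam | ⟨G, hG, hlam⟩
  · exact ⟨g, ⟨(hlam g rfl).2 rfl, hd⟩, fun y hy => (hlam y (hy.2.trans hd.symm)).1 hy.1⟩
  · obtain ⟨d, h1, h2⟩ := hC.pos_pos (pos_of_dim_zero hd hs) hG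
    have hdd : C.dim d = 0 := by have := h2.dim; have := hG.dim; lia
    exact ⟨d, ⟨(hlam d (hdd.trans hd.symm)).2 h2, hdd⟩, fun y hy => hC.pos_neg_unique
      (pos_of_dim_zero hy.2 hs) ((hlam y (hy.2.trans hd.symm)).1 hy.1) h1 h2⟩

/-- The tree with nodes `Λₖ₊₁` and edges `Cₖ`. -/
noncomputable def levelData (hC : C.IsDFC) (k : ℕ) (hk : k ≤ hC.height) :
    TreeData C.ZoomName where
  nodes := nameFinset (Sum.inl '' {a | a ∈ C.Lam ∧ C.dim a = k + 1})
  edges := nameFinset (Sum.inl '' {c | C.dim c = k})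
  tgt := Sum.LiftRel C.Pos fun _ _ => False
  src := Sum.LiftRel C.Neg fun _ _ => False
  root := .inl (hC.exists_isIteratedTarget_dim hk).choose
  root_mem := by
    simpa using (hC.exists_isIteratedTarget_dim hk).choose_spec.2
  exists_tgt a ha := by
    obtain ⟨a, ⟨hΛ, hd⟩, rfl⟩ := mem_nameFinset.1 ha
    obtain ⟨b, hb⟩ := C.exists_pos_or_loop (x := a) (by lia)
    have hb := hb.resolve_right (hC.not_loop_of_mem_lam hΛ)
    exact ⟨.inl b, mem_nameFinset.2 ⟨b, by have := hb.dim; simp; lia, rfl⟩, .inl hb⟩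
  tgt_unique a ha b b' h h' := by
    cases h with
    | inl h => cases h' with
      | inl h' => rw [h.unique h']
    | inr h => exact h.elim
  tgt_injective a ha a' ha' b h h' := by
    obtain ⟨a, ⟨hΛ, -⟩, rfl⟩ := mem_nameFinset.1 ha
    obtain ⟨a', ⟨hΛ', -⟩, rfl⟩ := mem_nameFinset.1 ha'
    cases h with
    | inl h => cases h' with
      | inl h' => rw [hC.source_unique hΛ hΛ' h h']
  src_unique a ha a' ha' b h h' := by
    obtain ⟨a, ⟨hΛ, -⟩, rfl⟩ := mem_nameFinset.1 ha
    obtain ⟨a', ⟨hΛ', -⟩, rfl⟩ := mem_nameFinset.1 ha'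
    cases h with
    | inl h => cases h' with
      | inl h' => rw [hC.targetNode_unique hΛ hΛ' h h']
  not_src_root a ha h := by
    obtain ⟨a, ⟨hΛ, -⟩, rfl⟩ := mem_nameFinset.1 ha
    exact hC.not_neg_of_isIteratedTarget (hC.exists_isIteratedTarget_dim hk).choose_spec.1 hΛ
      (Sum.liftRel_inl_inl.1 h)
  exists_path b hb := by
    obtain ⟨b, (hd : C.dim b = k), rfl⟩ := mem_nameFinset.1 hb
    obtain ⟨h1, h2⟩ := (hC.exists_isIteratedTarget_dim hk).choose_spec
    obtain ⟨g, hg, h⟩ := hC.exists_descent_root b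
    obtain rfl := hC.isIteratedTarget_unique hg h1 (by rw [← descent_dim h, hd, h2])
    clear hb
    induction h using Relation.ReflTransGen.head_induction_on with
    | refl => exact .refl
    | head hs _ ih =>
      have hs' := hs.dim
      obtain ⟨a, ha, h3, h4⟩ := hs
      exact .head ⟨.inl a, mem_nameFinset.2 ⟨a, ⟨ha, by have := h3.dim; lia⟩, rfl⟩, .inl h3,
        .inl h4⟩ (ih (hs'.symm.trans hd))

variable {k : ℕ}

/-- The tree with nodes `Λₖ₊₁` and edges `Cₖ`. -/
noncomputable abbrev levelTree (hC : C.IsDFC) (k : ℕ) (hk : k ≤ hC.height) :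
    DotTree C.ZoomName := (hC.levelData k hk).toDotTree

theorem mem_levelTree_nodes (hC : C.IsDFC) (hk : k ≤ hC.height) {x : C.ZoomName} :
    x ∈ (hC.levelTree k hk).nodes ↔ ∃ a ∈ C.Lam, C.dim a = k + 1 ∧ .inl a = x := by
  refine mem_nameFinset.trans ?_
  simp [and_assoc]

theorem mem_levelTree_edges (hC : C.IsDFC) (hk : k ≤ hC.height) {x : C.ZoomName} :
    x ∈ (hC.levelTree k hk).edges ↔ ∃ c, C.dim c = k ∧ .inl c = x := by
  exact mem_nameFinset

theorem levelTree_target_eq_iff (hC : C.IsDFC) (hk : k ≤ hC.height)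
    {x : (hC.levelTree k hk).nodes} {y : (hC.levelTree k hk).edges} (hx : .inl a = x.1)
    (hy : .inl c = y.1) : (hC.levelTree k hk).target x = y ↔ C.Pos c a := by
  rw [TreeData.toDotTree_target_eq_iff, ← hx, ← hy]
  exact Sum.liftRel_inl_inl

theorem levelTree_targetNode_eq_iff (hC : C.IsDFC) (hk : k ≤ hC.height)
    {x : (hC.levelTree k hk).nodes} {y : (hC.levelTree k hk).edges} (hx : .inl a = x.1)
    (hy : .inl c = y.1) : (hC.levelTree k hk).targetNode y = some x ↔ C.Neg c a := by
  rw [TreeData.toDotTree_targetNode_eq_iff, ← hx, ← hy]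
  exact Sum.liftRel_inl_inl

theorem levelTree_isLeaf_iff (hC : C.IsDFC) (hk : k ≤ hC.height) {y : (hC.levelTree k hk).edges}
    (hy : .inl c = y.1) : (hC.levelTree k hk).IsLeaf y ↔ c ∈ C.Lam := by
  constructor
  · intro h
    rcases hC.lam_or_pos c with hc | ⟨a, ha, hc⟩
    · exact hc
    · obtain ⟨c', hd, hc'⟩ := (hC.mem_levelTree_edges hk).1 y.2
      obtain rfl := Sum.inl_injective (hc'.trans hy.symm)
      exact (h ⟨.inl a, (hC.mem_levelTree_nodes hk).2 ⟨a, ha, by have := hc.dim; lia, rfl⟩⟩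
        ((hC.levelTree_target_eq_iff hk rfl hy).2 hc)).elim
  · intro hc x hx
    obtain ⟨a, -, -, ha⟩ := (hC.mem_levelTree_nodes hk).1 x.2
    exact hc a ((hC.levelTree_target_eq_iff hk ha hy).1 hx)

theorem levelTree_isNulldot_iff (hC : C.IsDFC) (hk : k ≤ hC.height)
    {x : (hC.levelTree k hk).nodes} (hx : .inl a = x.1) :
    (hC.levelTree k hk).IsNulldot x ↔ a ∈ C.Null := by
  obtain ⟨a', ha, hd, ha'⟩ := (hC.mem_levelTree_nodes hk).1 x.2
  obtain rfl := Sum.inl_injective (ha'.trans hx.symm)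
  constructor
  · intro h
    by_contra hn
    obtain ⟨c, hc⟩ := hC.exists_neg_of_not_null ha hn
    exact h ⟨.inl c, (hC.mem_levelTree_edges hk).2 ⟨c, by have := hc.dim; lia, rfl⟩⟩
      ((hC.levelTree_targetNode_eq_iff hk hx rfl).2 hc)
  · intro hn y hy
    obtain ⟨c, -, hc⟩ := (hC.mem_levelTree_edges hk).1 y.2
    have h := (hC.levelTree_targetNode_eq_iff hk hx hc).1 hy
    have hn : C.δ a' = ∅ := hn
    exact (Set.ext_iff.1 hn c).1 h.1

theorem edgeStep_levelTree_iff (hC : C.IsDFC) (hk : k ≤ hC.height)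
    {y y' : (hC.levelTree k hk).edges} (hy : .inl b = y.1) (hy' : .inl c = y'.1) :
    (hC.levelTree k hk).EdgeStep y y' ↔ C.Descent b c := by
  constructor
  · rintro ⟨x, h1, h2⟩
    obtain ⟨a, ha, -, ha'⟩ := (hC.mem_levelTree_nodes hk).1 x.2
    exact ⟨a, ha, (hC.levelTree_targetNode_eq_iff hk ha' hy).1 h1,
      (hC.levelTree_target_eq_iff hk ha' hy').1 h2⟩
  · rintro ⟨a, ha, h1, h2⟩
    obtain ⟨b', hd, hb'⟩ := (hC.mem_levelTree_edges hk).1 y.2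
    obtain rfl := Sum.inl_injective (hb'.trans hy.symm)
    refine ⟨⟨.inl a, (hC.mem_levelTree_nodes hk).2 ⟨a, ha, by have := h1.dim; lia, rfl⟩⟩, ?_, ?_⟩
    exacts [(hC.levelTree_targetNode_eq_iff hk rfl hy).2 h1,
      (hC.levelTree_target_eq_iff hk rfl hy').2 h2]

theorem reflTransGen_edgeStep_levelTree_iff (hC : C.IsDFC) (hk : k ≤ hC.height)
    {y y' : (hC.levelTree k hk).edges} (hy : .inl b = y.1) (hy' : .inl c = y'.1) :
    Relation.ReflTransGen (hC.levelTree k hk).EdgeStep y y' ↔ C.Desc b c := by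
  constructor
  · intro h
    induction h using Relation.ReflTransGen.head_induction_on generalizing b with
    | refl =>
      rw [Sum.inl_injective (hy.trans hy'.symm)]
    | head hs hsd ih =>
      rename_i y z
      obtain ⟨d, -, hd⟩ := (hC.mem_levelTree_edges hk).1 z.2
      exact .head ((hC.edgeStep_levelTree_iff hk hy hd).1 hs) (ih hd)
  · intro h
    induction h using Relation.ReflTransGen.head_induction_on generalizing y with
    | refl =>
      rw [Subtype.ext (hy.symm.trans hy')]
    | head hs hsd ih =>
      rename_i b d
      obtain ⟨b', hb, hb'⟩ := (hC.mem_levelTree_edges hk).1 y.2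
      obtain rfl := Sum.inl_injective (hb'.trans hy.symm)
      have hd : Sum.inl d ∈ (hC.levelTree k hk).edges :=
        (hC.mem_levelTree_edges hk).2 ⟨d, by rw [← hs.dim, hb], rfl⟩
      exact .head ((hC.edgeStep_levelTree_iff hk hy (y' := ⟨_, hd⟩) rfl).2 hs) (ih rfl)

theorem levelTree_zero_isLinear (hC : C.IsDFC) (hk : 0 ≤ hC.height) :
    (hC.levelTree 0 hk).IsLinear := by
  intro x
  obtain ⟨a, ha, hd, hx⟩ := (hC.mem_levelTree_nodes hk).1 x.2
  obtain ⟨b, hb, hu⟩ := hC.exists_neg_of_dim_one ha (by simpa using hd)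
  refine ⟨⟨.inl b, (hC.mem_levelTree_edges hk).2 ⟨b, by have := hb.dim; lia, rfl⟩⟩,
    (hC.levelTree_targetNode_eq_iff hk hx rfl).2 hb, fun y hy => ?_⟩
  obtain ⟨b', -, hb'⟩ := (hC.mem_levelTree_edges hk).1 y.2
  exact Subtype.ext (hb'.symm.trans (congrArg _
    (hu b' ((hC.levelTree_targetNode_eq_iff hk hx hb').1 hy))))

/-! ### The subdivisions -/

/-- The subdivision of the tree with edges `Cₖ` by the sets `W(c)`. -/
noncomputable def levelSub (hC : C.IsDFC) (k : ℕ) (hk : k ≤ hC.height) :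
    (hC.levelTree k hk).Subdivision where
  W y := nameFinset {x | ∃ c, .inl c = y.1 ∧ ∃ w ∈ C.White c, .inl w = x}
  lt y x x' := ∃ c w w', .inl c = y.1 ∧ .inl w = x.1 ∧ .inl w' = x'.1 ∧ C.WhiteLT c w w'
  lt_total y := by
    obtain ⟨c, -, hc⟩ := (hC.mem_levelTree_edges hk).1 y.2
    have key : ∀ x : nameFinset {x : C.ZoomName | ∃ c, .inl c = y.1 ∧ ∃ w ∈ C.White c, .inl w = x},
        ∃ w : C.White c, .inl w.1 = x.1 := by
      intro x
      obtain ⟨c', hc', w, hw, hx⟩ := mem_nameFinset.1 x.2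
      obtain rfl := Sum.inl_injective (hc.trans hc'.symm)
      exact ⟨⟨w, hw⟩, hx⟩
    choose W hW using key
    have hlt : ∀ x x', (∃ c w w', .inl c = y.1 ∧ .inl w = x.1 ∧ .inl w' = x'.1 ∧ C.WhiteLT c w w')
        ↔ C.WhiteLT c (W x) (W x') := by
      intro x x'
      constructor
      · rintro ⟨c', w, w', h1, h2, h3, h4⟩
        obtain rfl := Sum.inl_injective (h1.trans hc.symm)
        rwa [Sum.inl_injective ((hW x).trans h2.symm),
          Sum.inl_injective ((hW x').trans h3.symm)]
      · exact fun h => ⟨c, W x, W x', hc, hW x, hW x', h⟩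
    have := hC.whiteLT_isStrictTotalOrder c
    exact
      { trichotomous := fun x x' h h' => by
          rw [hlt] at h h'
          have := this.toTrichotomous.trichotomous _ _ h h'
          exact Subtype.ext (by rw [← hW, ← hW, this])
        irrefl := fun x => by
          rw [hlt]
          exact this.toIsStrictOrder.toIrrefl.irrefl _
        trans := fun x x' x'' h h' => by
          rw [hlt] at h h' ⊢
          exact this.toIsStrictOrder.toIsTrans.trans _ _ _ h h' }

theorem mem_levelSub_W (hC : C.IsDFC) (hk : k ≤ hC.height) {y : (hC.levelTree k hk).edges}
    (hy : .inl c = y.1) {x : C.ZoomName} :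
    x ∈ (hC.levelSub k hk).W y ↔ ∃ w ∈ C.White c, .inl w = x := by
  refine mem_nameFinset.trans ⟨?_, fun h => ⟨c, hy, h⟩⟩
  rintro ⟨c', hc', h⟩
  rwa [Sum.inl_injective (hy.trans hc'.symm)]

theorem levelSub_lt_iff (hC : C.IsDFC) (hk : k ≤ hC.height) {y : (hC.levelTree k hk).edges}
    (hy : .inl c = y.1) {x x' : (hC.levelSub k hk).W y} {w w' : C.Cell} (hw : .inl w = x.1)
    (hw' : .inl w' = x'.1) : (hC.levelSub k hk).lt y x x' ↔ C.WhiteLT c w w' := by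
  constructor
  · rintro ⟨c', v, v', h1, h2, h3, h4⟩
    rwa [Sum.inl_injective (hy.trans h1.symm), Sum.inl_injective (hw.trans h2.symm),
      Sum.inl_injective (hw'.trans h3.symm)]
  · exact fun h => ⟨c, w, w', hy, hw, hw', h⟩

end IsDFC

end MOP

namespace MOP.IsDFC

variable {C : MOP.{u}} {a b b' c : C.Cell} {k : ℕ}

/-! ### The kernel rule -/

/-- The tip `b` is a blackdot, or the target of a whitedot. -/
def TipOf (hC : C.IsDFC) {hk : k ≤ hC.height} : (hC.levelSub k hk).Dot → C.Cell → Prop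
  | .inl x, b => .inl b = x.1
  | .inr w, b => ∃ w₀, .inl w₀ = w.2.1 ∧ C.Pos b w₀

theorem exists_white (hC : C.IsDFC) {hk : k ≤ hC.height} (w : (hC.levelSub k hk).Whitedot) :
    ∃ c w₀ b, C.dim c = k ∧ .inl c = w.1.1 ∧ .inl w₀ = w.2.1 ∧ w₀ ∈ C.Lam ∩ C.Null ∧
      C.Pos b w₀ ∧ C.Loop c b := by
  obtain ⟨c, hd, hc⟩ := (hC.mem_levelTree_edges hk).1 w.1.2
  obtain ⟨w₀, hw₀, hw⟩ := (hC.mem_levelSub_W hk hc).1 w.2.2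
  obtain ⟨h1, b, h2, h3⟩ := hC.mem_white_iff.1 hw₀
  exact ⟨c, w₀, b, hd, hc, hw, h1, h2, h3⟩

theorem exists_tipOf (hC : C.IsDFC) {hk : k ≤ hC.height} (t : (hC.levelSub k hk).Dot) :
    ∃ b, hC.TipOf t b := by
  rcases t with x | w
  · obtain ⟨a, -, -, ha⟩ := (hC.mem_levelTree_nodes hk).1 x.2
    exact ⟨a, ha⟩
  · obtain ⟨c, w₀, b, -, -, h1, -, h2, -⟩ := hC.exists_white w
    exact ⟨b, w₀, h1, h2⟩

theorem TipOf.isTip (hC : C.IsDFC) {hk : k ≤ hC.height} {t : (hC.levelSub k hk).Dot}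
    (h : hC.TipOf t b) : C.IsTip b ∧ C.dim b = k + 1 := by
  rcases t with x | w
  · obtain ⟨a, ha, hd, hx⟩ := (hC.mem_levelTree_nodes hk).1 x.2
    obtain rfl := Sum.inl_injective (hx.trans (Eq.symm h))
    exact ⟨.inl ha, hd⟩
  · obtain ⟨w₁, h1, h2⟩ := h
    obtain ⟨c, w₀, b', hd, -, h3, h4, h5, h6⟩ := hC.exists_white w
    obtain rfl := Sum.inl_injective (h1.trans h3.symm)
    obtain rfl := h2.unique h5
    exact ⟨.inr ⟨w₁, h4, h2⟩, by have := h6.dim; lia⟩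

/-- A tip outside Λ is the target of some `w` in Λ without sources, and `w` is a whitedot on the
edge `γ²(w)`. With `TipOf.unique`, the dots correspond bijectively to the tips of dimension `k + 1`.
-/
theorem exists_tipOf_eq (hC : C.IsDFC) (hk : k ≤ hC.height) (hb : C.IsTip b)
    (hd : C.dim b = k + 1) : ∃ t : (hC.levelSub k hk).Dot, hC.TipOf t b := by
  rcases hb with hb | ⟨w, hw, hbw⟩
  · exact ⟨.inl ⟨.inl b, (hC.mem_levelTree_nodes hk).2 ⟨b, hb, hd, rfl⟩⟩, rfl⟩
  · obtain ⟨c, hc⟩ := C.γ_singleton b (by lia)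
    have hc : c ∈ C.γ b := by simp [hc]
    have hdc := C.dim_of_mem_γ _ _ hc
    exact ⟨.inr ⟨⟨.inl c, (hC.mem_levelTree_edges hk).2 ⟨c, by lia, rfl⟩⟩, ⟨.inl w,
      (hC.mem_levelSub_W hk rfl).2 ⟨w, ⟨hw, b, hbw.1, hc⟩, rfl⟩⟩⟩, w, rfl, hbw⟩

theorem levelSub_W_disjoint (hC : C.IsDFC) (hk : k ≤ hC.height) (x : C.ZoomName)
    (y y' : (hC.levelTree k hk).edges) (h : x ∈ (hC.levelSub k hk).W y)
    (h' : x ∈ (hC.levelSub k hk).W y') : y = y' := by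
  obtain ⟨c, w, b, -, h1, h2, h3, h4, h5⟩ := hC.exists_white ⟨y, x, h⟩
  obtain ⟨c', w', b', -, h1', h2', h3', h4', h5'⟩ := hC.exists_white ⟨y', x, h'⟩
  obtain rfl := Sum.inl_injective (h2.trans h2'.symm)
  obtain rfl := h4.unique h4'
  obtain rfl := h5.unique h5'
  exact Subtype.ext (h1.symm.trans h1')

theorem TipOf.unique (hC : C.IsDFC) {hk : k ≤ hC.height} {t t' : (hC.levelSub k hk).Dot}
    (h : hC.TipOf t b) (h' : hC.TipOf t' b) : t = t' := by
  rcases t with x | w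
  · obtain ⟨a, ha, -, hx⟩ := (hC.mem_levelTree_nodes hk).1 x.2
    obtain rfl := Sum.inl_injective (hx.trans (Eq.symm h))
    rcases t' with x' | w'
    · exact congrArg _ (Subtype.ext (Eq.trans (Eq.symm h) h'))
    · obtain ⟨w₀, -, h'⟩ := h'
      exact (ha _ h').elim
  · rcases t' with x' | w'
    · obtain ⟨a, ha, -, hx⟩ := (hC.mem_levelTree_nodes hk).1 x'.2
      obtain rfl := Sum.inl_injective (hx.trans (Eq.symm h'))
      obtain ⟨w₀, -, h⟩ := h
      exact (ha _ h).elim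
    · obtain ⟨w₀, h1, h2⟩ := h
      obtain ⟨w₀', h1', h2'⟩ := h'
      obtain ⟨-, w₁, -, -, -, h3, h4, -⟩ := hC.exists_white w
      obtain ⟨-, w₁', -, -, -, h3', h4', -⟩ := hC.exists_white w'
      obtain rfl := Sum.inl_injective (h1.trans h3.symm)
      obtain rfl := Sum.inl_injective (h1'.trans h3'.symm)
      obtain rfl := hC.source_unique h4.1 h4'.1 h2 h2'
      have hw : w.2.1 = w'.2.1 := h1.symm.trans h1'
      refine congrArg _ (KJBM.whitedot_ext (hC.levelSub_W_disjoint hk w.2.1 _ _ w.2.2 ?_) hw)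
      rw [hw]
      exact w'.2.2

/-- Consecutive tips are consecutive dots of the subdivided tree. -/
theorem step_of_nextTip (hC : C.IsDFC) {hk : k ≤ hC.height} {t t' : (hC.levelSub k hk).Dot}
    (ht : hC.TipOf t b) (ht' : hC.TipOf t' b') (h : C.NextTip b b') :
    (hC.levelSub k hk).Step t t' := by
  have htip := (TipOf.isTip hC ht).1
  have htip' := (TipOf.isTip hC ht').1
  have hdim := (TipOf.isTip hC ht).2
  obtain ⟨c, hcb, hcb', hpl, hcov⟩ := h
  have hc : Sum.inl c ∈ (hC.levelTree k hk).edges :=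
    (hC.mem_levelTree_edges hk).2 ⟨c, by have := hcb.dim; lia, rfl⟩
  have hne : b ≠ b' := by
    rintro rfl
    exact hC.planar_irrefl hpl
  -- A whitedot whose tip has face `c` lies on the edge `c`, because its tip is a loop and a loop
  -- has only one face.
  have hloop : ∀ (w : (hC.levelSub k hk).Whitedot) (e : C.Cell), hC.TipOf (.inr w) e →
      C.Face c e → w.1 = ⟨.inl c, hc⟩ ∧ C.Loop c e ∧
        ∃ w₀, .inl w₀ = w.2.1 ∧ w₀ ∈ C.Lam ∩ C.Null ∧ C.Pos e w₀ := by
    rintro w e ⟨w₁, h1, h2⟩ hce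
    obtain ⟨c', w₀, e', -, h3, h4, h5, h6, h7⟩ := hC.exists_white w
    obtain rfl := Sum.inl_injective (h1.trans h4.symm)
    obtain rfl := h2.unique h6
    obtain rfl := h7.eq_of_face hce
    exact ⟨Subtype.ext h3.symm, h7, w₁, h1, h5, h2⟩
  have hwhite : ∀ v : (hC.levelSub k hk).W ⟨.inl c, hc⟩, ∃ e v₀, .inl v₀ = v.1 ∧
      v₀ ∈ C.Lam ∩ C.Null ∧ C.Pos e v₀ ∧ C.Loop c e := by
    intro v
    obtain ⟨c', w₀, e', -, h3, h4, h5, h6, h7⟩ := hC.exists_white ⟨_, v⟩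
    obtain rfl := Sum.inl_injective h3
    exact ⟨e', w₀, h4, h5, h6, h7⟩
  -- A blackdot that comes first has `c` as a source: if `c` were its target, it would come after
  -- `b'`. Dually for `hblack'`.
  have hblack : ∀ (x : (hC.levelTree k hk).nodes), .inl b = x.1 →
      (hC.levelTree k hk).targetNode ⟨.inl c, hc⟩ = some x ∧ C.Neg c b := by
    intro x hx
    obtain ⟨a, ha, -, hax⟩ := (hC.mem_levelTree_nodes hk).1 x.2
    obtain rfl := Sum.inl_injective (hax.trans hx.symm)
    rcases hcb with h | h | h
    · exact ⟨(hC.levelTree_targetNode_eq_iff hk hax rfl).2 h, h⟩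
    · exact (hC.planar_asymm hpl (hC.planar_of_pos htip' htip hcb' h hne.symm)).elim
    · exact (hC.not_loop_of_mem_lam ha h).elim
  have hblack' : ∀ (x : (hC.levelTree k hk).nodes), .inl b' = x.1 →
      (hC.levelTree k hk).target x = ⟨.inl c, hc⟩ ∧ C.Pos c b' := by
    intro x hx
    obtain ⟨a, ha, -, hax⟩ := (hC.mem_levelTree_nodes hk).1 x.2
    obtain rfl := Sum.inl_injective (hax.trans hx.symm)
    rcases hcb' with h | h | h
    · exact (hC.planar_asymm hpl (hC.planar_of_neg htip' htip h hcb hne.symm)).elim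
    · exact ⟨(hC.levelTree_target_eq_iff hk hax rfl).2 h, h⟩
    · exact (hC.not_loop_of_mem_lam ha h).elim
  rcases t with x | ⟨y, w⟩
  · obtain ⟨h1, h2⟩ := hblack x ht
    rcases t' with x' | ⟨y', w'⟩
    · obtain ⟨h3, h4⟩ := hblack' x' ht'
      refine .node_node _ x x' h1 h3 (Finset.eq_empty_of_forall_notMem fun v hv => ?_)
      obtain ⟨e, v₀, -, h5, h6, h7⟩ := hwhite ⟨v, hv⟩
      have he : C.IsTip e := .inr ⟨v₀, h5, h6⟩
      -- Any whitedot on `c` would give a tip strictly between the one with source `c` and the one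
      -- with target `c`.
      refine hcov e he h7.face ⟨hC.planar_of_neg htip he h2 h7.face ?_,
        hC.planar_of_pos he htip' h7.face h4 ?_⟩
      · rintro rfl
        exact h7.not_neg h2
      · rintro rfl
        exact h7.not_pos h4
    · obtain ⟨rfl, h3, w₀, h4, h5, h6⟩ := hloop _ _ ht' hcb'
      refine .node_white _ x w' h1 fun v hv => ?_
      obtain ⟨e, v₀, h7, h8, h9, h10⟩ := hwhite v
      have he : C.IsTip e := .inr ⟨v₀, h8, h9⟩
      rw [hC.levelSub_lt_iff hk rfl h7 h4, hC.whiteLT_iff h8 h5 h9 h10 h6 h3] at hv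
      refine hcov e he h10.face ⟨hC.planar_of_neg htip he h2 h10.face ?_, hv⟩
      rintro rfl
      exact h10.not_neg h2
  · obtain ⟨rfl, h1, w₀, h2, h2', h3⟩ := hloop _ _ ht hcb
    rcases t' with x' | ⟨y', w'⟩
    · obtain ⟨h4, h5⟩ := hblack' x' ht'
      refine .white_node _ w x' h4 fun v hv => ?_
      obtain ⟨e, v₀, h7, h8, h9, h10⟩ := hwhite v
      have he : C.IsTip e := .inr ⟨v₀, h8, h9⟩
      rw [hC.levelSub_lt_iff hk rfl h2 h7, hC.whiteLT_iff h2' h8 h3 h1 h9 h10] at hv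
      refine hcov e he h10.face ⟨hv, hC.planar_of_pos he htip' h10.face h5 ?_⟩
      rintro rfl
      exact h10.not_pos h5
    · obtain ⟨rfl, h4, w₀', h5, h5', h6⟩ := hloop _ _ ht' hcb'
      refine .white_white _ w w' ?_ ?_
      · rwa [hC.levelSub_lt_iff hk rfl h2 h5, hC.whiteLT_iff h2' h5' h3 h1 h6 h4]
      · rintro v ⟨hv, hv'⟩
        obtain ⟨e, v₀, h7, h8, h9, h10⟩ := hwhite v
        rw [hC.levelSub_lt_iff hk rfl h2 h7, hC.whiteLT_iff h2' h8 h3 h1 h9 h10] at hv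
        rw [hC.levelSub_lt_iff hk rfl h7 h5, hC.whiteLT_iff h8 h5' h9 h10 h6 h4] at hv'
        exact hcov e (.inr ⟨v₀, h8, h9⟩) h10.face ⟨hv, hv'⟩

theorem mem_levelTree_nodes_iff_isLeaf (hC : C.IsDFC) (hk : k + 1 ≤ hC.height)
    (x : C.ZoomName) : x ∈ (hC.levelTree k (Nat.le_of_succ_le hk)).nodes ↔
      ∃ h : x ∈ (hC.levelTree (k + 1) hk).edges, (hC.levelTree (k + 1) hk).IsLeaf ⟨x, h⟩ := by
  rw [hC.mem_levelTree_nodes]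
  constructor
  · rintro ⟨a, ha, hd, rfl⟩
    exact ⟨(hC.mem_levelTree_edges hk).2 ⟨a, by push_cast; exact hd, rfl⟩,
      (hC.levelTree_isLeaf_iff hk rfl).2 ha⟩
  · rintro ⟨h, hl⟩
    obtain ⟨a, hd, rfl⟩ := (hC.mem_levelTree_edges hk).1 h
    exact ⟨a, (hC.levelTree_isLeaf_iff hk rfl).1 hl, by push_cast at hd; exact hd, rfl⟩

theorem exists_mem_levelSub_W_iff (hC : C.IsDFC) (hk : k + 1 ≤ hC.height) (x : C.ZoomName) :
    (∃ y, x ∈ (hC.levelSub k (Nat.le_of_succ_le hk)).W y) ↔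
      ∃ h : x ∈ (hC.levelTree (k + 1) hk).nodes,
        (hC.levelTree (k + 1) hk).IsNulldot ⟨x, h⟩ := by
  constructor
  · rintro ⟨y, hy⟩
    obtain ⟨c, w, b, hd, -, h1, h2, h3, h4⟩ := hC.exists_white ⟨y, x, hy⟩
    exact ⟨(hC.mem_levelTree_nodes hk).2 ⟨w, h2.1,
      by have := h3.dim; have := h4.dim; push_cast; lia, h1⟩,
      (hC.levelTree_isNulldot_iff hk h1).2 h2.2⟩
  · rintro ⟨h, hn⟩
    obtain ⟨w, hw, hd, rfl⟩ := (hC.mem_levelTree_nodes hk).1 h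
    have hn := (hC.levelTree_isNulldot_iff hk rfl).1 hn
    push_cast at hd
    obtain ⟨b, hb⟩ := C.exists_pos_or_loop (x := w) (by lia)
    have hb := hb.resolve_right (hC.not_loop_of_mem_lam hw)
    obtain ⟨c, hc⟩ := C.γ_singleton b (by have := hb.dim; lia)
    have hc : c ∈ C.γ b := by simp [hc]
    have hdc := C.dim_of_mem_γ _ _ hc
    exact ⟨⟨.inl c, (hC.mem_levelTree_edges _).2 ⟨c, by have := hb.dim; lia, rfl⟩⟩,
      (hC.mem_levelSub_W _ rfl).2 ⟨w, ⟨⟨hw, hn⟩, b, hb.1, hc⟩, rfl⟩⟩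

/-- The constellation from the tree with edges `Cₖ` to the tree with edges `Cₖ₊₁`. -/
noncomputable def levelCon (hC : C.IsDFC) (k : ℕ) (hk : k + 1 ≤ hC.height) :
    Constellation (hC.levelTree k (Nat.le_of_succ_le hk)) (hC.levelTree (k + 1) hk) :=
  Constellation.ofExact (hC.levelSub k (Nat.le_of_succ_le hk))
    (hC.mem_levelTree_nodes_iff_isLeaf hk) (hC.exists_mem_levelSub_W_iff hk)
    (hC.levelSub_W_disjoint _) fun x => by
      obtain ⟨a, ha, hd, hx⟩ := (hC.mem_levelTree_nodes hk).1 x.2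
      push_cast at hd
      obtain ⟨g, hg⟩ := C.exists_pos_or_loop (x := a) (by lia)
      have hg := hg.resolve_right (hC.not_loop_of_mem_lam ha)
      have hdg : C.dim g = k + 1 := by have := hg.dim; lia
      have hgx : Sum.inl g = ((hC.levelTree (k + 1) hk).target x).1 := by
        obtain ⟨e, -, he⟩ := (hC.mem_levelTree_edges hk).1 ((hC.levelTree (k + 1) hk).target x).2
        rw [← he, hg.unique ((hC.levelTree_target_eq_iff hk hx he).1 rfl)]
      -- Under the structural maps, the dots over `x` become the tips that descend to the target `g`
      -- of `x`.
      have key : ∀ (t : (hC.levelSub k (Nat.le_of_succ_le hk)).Dot) (b : C.Cell),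
          hC.TipOf t b → ((hC.levelTree (k + 1) hk).Descends
            (Sum.elim (fun a => .inr ⟨a.1, ((hC.mem_levelTree_nodes_iff_isLeaf hk a.1).1 a.2).1⟩)
              (fun w => .inl ⟨w.2.1, ((hC.exists_mem_levelSub_W_iff hk w.2.1).1
                ⟨w.1, w.2.2⟩).1⟩) t) (.inl x) ↔ C.Desc b g) := by
        rintro (t | w) b hb
        · refine (DotTree.leaf_descends_node_iff
            ((hC.mem_levelTree_nodes_iff_isLeaf hk t.1).1 t.2).2).trans ?_
          exact hC.reflTransGen_edgeStep_levelTree_iff hk hb hgx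
        · refine DotTree.node_descends_node_iff.trans ?_
          obtain ⟨w₀, h1, h2⟩ := hb
          refine hC.reflTransGen_edgeStep_levelTree_iff hk ?_ hgx
          obtain ⟨e, -, he⟩ := (hC.mem_levelTree_edges hk).1 ((hC.levelTree (k + 1) hk).target
            ⟨w.2.1, ((hC.exists_mem_levelSub_W_iff hk w.2.1).1 ⟨w.1, w.2.2⟩).1⟩).2
          rw [← he, h2.unique ((hC.levelTree_target_eq_iff hk h1 he).1 rfl)]
      refine (SimpleGraph.connected_iff _).2 ⟨?_, ?_⟩
      · rintro ⟨t, ht⟩ ⟨t', ht'⟩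
        obtain ⟨b, hb⟩ := hC.exists_tipOf t
        obtain ⟨b', hb'⟩ := hC.exists_tipOf t'
        have hpath := hC.tipAdj_connected (by lia) (TipOf.isTip hC hb).1 ((key t b hb).1 ht)
          (TipOf.isTip hC hb').1 ((key t' b' hb').1 ht')
        -- The path of consecutive tips is lifted to dots one step at a time; every intermediate tip
        -- also descends to `g`, so the path stays in the induced subgraph.
        induction hpath generalizing t' with
        | refl =>
          obtain rfl := TipOf.unique hC hb hb'
          exact .refl _
        | tail hpath h ih =>
          rename_i s s'
          obtain ⟨⟨h1, h2⟩, ⟨h3, h4⟩, h5⟩ := h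
          obtain ⟨r, hr⟩ := hC.exists_tipOf_eq (Nat.le_of_succ_le hk) h1
            ((descent_dim h2).trans hdg)
          have hrx := (key r s hr).2 h2
          rcases eq_or_ne r t' with rfl | hne
          · exact ih r hrx hr
          refine (ih r hrx hr).trans (SimpleGraph.Adj.reachable ?_)
          show (hC.levelSub k _).graph.Adj r t'
          rw [DotTree.Subdivision.graph, SimpleGraph.fromRel_adj]
          exact ⟨hne, h5.imp (hC.step_of_nextTip hr hb') (hC.step_of_nextTip hb' hr)⟩
      · obtain ⟨c, hc⟩ := C.exists_pos_or_loop (x := g) (by lia)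
        obtain ⟨b, h1, h2, -⟩ := hC.exists_tip_of_face (c := c) (b := g) (.inr hc)
        obtain ⟨t, ht⟩ := hC.exists_tipOf_eq (Nat.le_of_succ_le hk) h1 ((descent_dim h2).trans hdg)
        exact ⟨⟨t, (key t b ht).2 h2⟩⟩

end MOP.IsDFC

namespace MOP

/-! ### The opetope -/

namespace IsDFC

variable {C : MOP.{u}} {a : C.Cell}

/-- The unique element of `Λ₀`. -/
noncomputable def lamZero (hC : C.IsDFC) : C.Cell := hC.existsUnique_lam_zero.choose

theorem eq_lamZero_iff (hC : C.IsDFC) : a = hC.lamZero ↔ a ∈ C.Lam ∧ C.dim a = 0 := by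
  have h := hC.existsUnique_lam_zero.choose_spec
  exact ⟨fun ha => ha ▸ h.1, h.2 a⟩

/-- The trees of the opetope. -/
noncomputable def zoomTree (hC : C.IsDFC) : ∀ k, k ≤ hC.height → DotTree C.ZoomName
  -- Exactness forces this choice: the node of `T₀` must be the leaf of `T₁`. Likewise the node
  -- `lamZero` of `T₁` is the only leaf of `T₂`.
  | 0, _ => (C.unaryData C.leafName).toDotTree
  | 1, _ => (C.unaryData (.inl hC.lamZero)).toDotTree
  | k + 2, h => hC.levelTree k (by lia)

/-- Nonemptiness in the kernel rule for `T₁ ⟶ T₂`. Every node of `T₂` has a source, so the climb in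
`exists_lam_desc` never stops before a leaf; the property carried along is just dimension 0. -/
theorem exists_leaf_descends (hC : C.IsDFC) (hk : 0 ≤ hC.height) (x : (hC.levelTree 0 hk).nodes) :
    ∃ b, (hC.levelTree 0 hk).IsLeaf b ∧ (hC.levelTree 0 hk).Descends (.inr b) (.inl x) := by
  obtain ⟨a, ha, hd, hx⟩ := (hC.mem_levelTree_nodes hk).1 x.2
  simp only [Nat.cast_zero, zero_add] at hd
  obtain ⟨b, hb, -⟩ := hC.exists_neg_of_dim_one ha hd
  have hb0 : C.dim b = 0 := by have := hb.dim; lia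
  obtain ⟨l, hl, hlb, -⟩ := hC.exists_lam_desc (p := fun b => C.dim b = 0) (d := b)
    (fun b a hb hba => by
      obtain ⟨s, hs, -⟩ := C.existsUnique_bot
      obtain ⟨y, -, hy⟩ := hC.pos_pos (pos_of_dim_zero hb hs) hba
      exact ⟨y, by have := hy.dim; have := hba.dim; lia, hy⟩) hb0
  have hl0 : C.dim l = 0 := by rw [descent_dim hlb, hb0]
  refine ⟨⟨.inl l, (hC.mem_levelTree_edges hk).2 ⟨l, hl0, rfl⟩⟩,
    (hC.levelTree_isLeaf_iff hk rfl).2 hl, ?_⟩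
  have hbe : Sum.inl b ∈ (hC.levelTree 0 hk).edges :=
    (hC.mem_levelTree_edges hk).2 ⟨b, hb0, rfl⟩
  refine Relation.ReflTransGen.tail (DotTree.descends_of_edgeStep
    ((hC.reflTransGen_edgeStep_levelTree_iff hk rfl (y' := ⟨_, hbe⟩) rfl).2 hlb)) ?_
  exact .edge _ _ ((hC.levelTree_targetNode_eq_iff hk hx rfl).2 hb)

/-- The constellations of the opetope. -/
noncomputable def zoomCon (hC : C.IsDFC) : ∀ (k : ℕ) (h : k + 1 ≤ hC.height),
    Constellation (hC.zoomTree k (Nat.le_of_succ_le h)) (hC.zoomTree (k + 1) h)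
  | 0, _ => Constellation.ofUnary (C.unaryData _).toDotTree (C.unaryData _).toDotTree
      (Finset.card_singleton _)
      (fun x => ⟨fun hx => by
          obtain rfl := Finset.mem_singleton.1 hx
          exact ⟨leafName_mem_unaryData, (unaryData_isLeaf_iff _).2 rfl⟩,
        fun ⟨_, h⟩ => Finset.mem_singleton.2 ((unaryData_isLeaf_iff _).1 h)⟩)
      (fun a h => h _ (unaryData_targetNode a))
      (fun x => ⟨_, (unaryData_isLeaf_iff ⟨_, leafName_mem_unaryData⟩).2 rfl,
        .single (.edge _ _ (unaryData_targetNode x))⟩)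
  | 1, _ => Constellation.ofUnary (C.unaryData (.inl hC.lamZero)).toDotTree
      (hC.levelTree 0 (Nat.zero_le _))
      (Finset.card_singleton _)
      (fun x => ⟨fun hx => by
          obtain rfl := Finset.mem_singleton.1 hx
          obtain ⟨h1, h2⟩ := hC.eq_lamZero_iff.1 rfl
          exact ⟨(hC.mem_levelTree_edges _).2 ⟨_, h2, rfl⟩, (hC.levelTree_isLeaf_iff _ rfl).2 h1⟩,
        fun ⟨h, h'⟩ => by
          obtain ⟨c, hc, rfl⟩ := (hC.mem_levelTree_edges _).1 h
          exact Finset.mem_singleton.2 (congrArg _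
            (hC.eq_lamZero_iff.2 ⟨(hC.levelTree_isLeaf_iff _ rfl).1 h', hc⟩))⟩)
      (fun a h => by
        obtain ⟨b, hb, -⟩ := hC.levelTree_zero_isLinear (Nat.zero_le _) a
        exact h b hb)
      (hC.exists_leaf_descends _)
  | k + 2, _ => hC.levelCon k (by lia)

/-- The opetope of a dendritic face complex. -/
noncomputable def zoomObj (hC : C.IsDFC) : KJBM.{u} where
  Name := C.ZoomName
  dim := hC.height
  opetope :=
    { tree := hC.zoomTree
      con := hC.zoomCon
      exact := fun k h => by
        match k, h with
        | 0, _ => exact ⟨fun _ => rfl, fun _ => rfl⟩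
        | 1, _ => exact ⟨fun _ => rfl, fun _ => rfl⟩
        | k + 2, _ => exact ⟨fun _ => rfl, fun _ => rfl⟩
      unary_zero := unaryData_isUnary _
      unary_one := fun _ => unaryData_isUnary _
      linear_two := fun _ => hC.levelTree_zero_isLinear _ }

theorem isZoomOf (hC : C.IsDFC) : IsZoomOf C hC.zoomObj Function.Embedding.inl where
  hasDim := hC.hasDim
  mem_nodes_one h x := by
    refine Finset.mem_singleton.trans ⟨?_, ?_⟩
    · rintro rfl
      obtain ⟨h1, h2⟩ := hC.eq_lamZero_iff.1 rfl
      exact ⟨_, h1, h2, rfl⟩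
    · rintro ⟨a, h1, h2, rfl⟩
      exact congrArg _ (hC.eq_lamZero_iff.2 ⟨h1, h2⟩)
  mem_nodes k h x := hC.mem_levelTree_nodes _
  mem_edges k h x := hC.mem_levelTree_edges _
  target_iff k h a b a₀ c₀ ha hb := hC.levelTree_target_eq_iff _ ha hb
  targetNode_iff k h a b a₀ c₀ ha hb := hC.levelTree_targetNode_eq_iff _ ha hb
  root_eq k h :=
    have hk := hC.exists_isIteratedTarget_dim (k := k) (Nat.le_of_succ_le (Nat.le_of_succ_le h))
    ⟨hk.choose, hk.choose_spec.1, hk.choose_spec.2, rfl⟩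
  mem_white k h b c hc x := hC.mem_levelSub_W (Nat.le_of_succ_le (Nat.le_of_succ_le
    (Nat.le_of_succ_le h))) hc
  white_lt_iff k h b c hc w w' w₀ w₀' hw hw' := hC.levelSub_lt_iff (Nat.le_of_succ_le
    (Nat.le_of_succ_le (Nat.le_of_succ_le h))) hc hw hw'

end IsDFC

/-! ### Isomorphisms -/

section Iso

variable {C D : MOP.{u}}

theorem Hom.map_mem_δ (f : C ⟶ D) {x y : C.Cell} (h : y ∈ C.δ x) :
    f.toFun y ∈ D.δ (f.toFun x) :=
  (f.bijOn_δ x (by have := C.neg_one_le_dim y; have := C.dim_of_mem_δ _ _ h; lia)).mapsTo h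

theorem Hom.map_mem_γ (f : C ⟶ D) {x y : C.Cell} (h : y ∈ C.γ x) :
    f.toFun y ∈ D.γ (f.toFun x) := by
  rw [← f.map_γ x (by have := C.neg_one_le_dim y; have := C.dim_of_mem_γ _ _ h; lia)]
  exact Set.mem_image_of_mem _ h

/-- The bijection between the cells given by an isomorphism. -/
def cellEquiv (i : C ≅ D) : C.Cell ≃ D.Cell where
  toFun := i.hom.toFun
  invFun := i.inv.toFun
  left_inv x := congrFun (congrArg Hom.toFun i.hom_inv_id) x
  right_inv x := congrFun (congrArg Hom.toFun i.inv_hom_id) x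

variable (i : C ≅ D) {c x y z : C.Cell}

theorem cellEquiv_symm : cellEquiv i.symm = (cellEquiv i).symm := rfl

theorem dim_cellEquiv : D.dim (cellEquiv i x) = C.dim x := i.hom.map_dim x

/-- The converse applies the inverse isomorphism. Every notion built from `δ`, `γ`, the dimension
and local orders is then transported by reindexing quantifiers along `cellEquiv`. -/
theorem mem_δ_cellEquiv : cellEquiv i y ∈ D.δ (cellEquiv i x) ↔ y ∈ C.δ x :=
  ⟨fun h => by
    simpa [cellEquiv_symm] using
      (show cellEquiv i.symm (cellEquiv i y) ∈ C.δ (cellEquiv i.symm (cellEquiv i x)) from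
        Hom.map_mem_δ i.inv h), Hom.map_mem_δ i.hom⟩

theorem mem_γ_cellEquiv : cellEquiv i y ∈ D.γ (cellEquiv i x) ↔ y ∈ C.γ x :=
  ⟨fun h => by
    simpa [cellEquiv_symm] using
      (show cellEquiv i.symm (cellEquiv i y) ∈ C.γ (cellEquiv i.symm (cellEquiv i x)) from
        Hom.map_mem_γ i.inv h), Hom.map_mem_γ i.hom⟩

theorem localLT_cellEquiv :
    D.LocalLT (cellEquiv i x) (cellEquiv i y) (cellEquiv i z) ↔ C.LocalLT x y z :=
  ⟨fun h => by
    simpa [cellEquiv_symm] using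
      (show C.LocalLT (cellEquiv i.symm (cellEquiv i x)) (cellEquiv i.symm (cellEquiv i y))
        (cellEquiv i.symm (cellEquiv i z)) from i.inv.map_localLT _ _ _ h),
    i.hom.map_localLT _ _ _⟩

theorem pos_cellEquiv : D.Pos (cellEquiv i y) (cellEquiv i x) ↔ C.Pos y x :=
  and_congr (mem_γ_cellEquiv i) (not_congr (mem_δ_cellEquiv i))

theorem neg_cellEquiv : D.Neg (cellEquiv i y) (cellEquiv i x) ↔ C.Neg y x :=
  and_congr (mem_δ_cellEquiv i) (not_congr (mem_γ_cellEquiv i))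

theorem loop_cellEquiv : D.Loop (cellEquiv i y) (cellEquiv i x) ↔ C.Loop y x :=
  and_congr (mem_δ_cellEquiv i) (mem_γ_cellEquiv i)

theorem lam_cellEquiv : cellEquiv i x ∈ D.Lam ↔ x ∈ C.Lam := by
  simp only [Lam, Set.mem_ofPred_eq, (cellEquiv i).surjective.forall, pos_cellEquiv]

theorem null_cellEquiv : cellEquiv i x ∈ D.Null ↔ x ∈ C.Null := by
  simp only [Null, Set.mem_ofPred_eq, Set.eq_empty_iff_forall_notMem,
    (cellEquiv i).surjective.forall, mem_δ_cellEquiv]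

theorem transGen_equiv_iff {α β : Type*} (e : α ≃ β) {r : α → α → Prop} {s : β → β → Prop}
    (h : ∀ a b, s (e a) (e b) ↔ r a b) {a b : α} :
    Relation.TransGen s (e a) (e b) ↔ Relation.TransGen r a b := by
  constructor
  · intro h'
    simpa [Function.onFun] using h'.lift e.symm (p := r) fun x y hxy => by
      show r _ _
      rw [← h]
      simpa using hxy
  · exact fun h' => h'.lift e fun x y hxy => (h x y).2 hxy

theorem reflTransGen_equiv_iff {α β : Type*} (e : α ≃ β) {r : α → α → Prop} {s : β → β → Prop}
    (h : ∀ a b, s (e a) (e b) ↔ r a b) {a b : α} :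
    Relation.ReflTransGen s (e a) (e b) ↔ Relation.ReflTransGen r a b := by
  simp only [Relation.reflTransGen_iff_eq_or_transGen, transGen_equiv_iff e h,
    EmbeddingLike.apply_eq_iff_eq]

theorem loopInclEq_cellEquiv :
    D.LoopInclEq (cellEquiv i x) (cellEquiv i y) ↔ C.LoopInclEq x y := by
  refine reflTransGen_equiv_iff _ fun x y => ?_
  simp only [LoopIncl, (cellEquiv i).surjective.exists, pos_cellEquiv, neg_cellEquiv,
    loop_cellEquiv, lam_cellEquiv]

theorem transGen_zigStep_cellEquiv :
    Relation.TransGen (D.ZigStep (cellEquiv i c)) (cellEquiv i x) (cellEquiv i y) ↔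
      Relation.TransGen (C.ZigStep c) x y := by
  refine transGen_equiv_iff _ fun x y => ?_
  simp only [ZigStep, (cellEquiv i).surjective.exists, pos_cellEquiv, neg_cellEquiv,
    lam_cellEquiv]

theorem loopLT₁_cellEquiv :
    D.LoopLT₁ (cellEquiv i c) (cellEquiv i x) (cellEquiv i y) ↔ C.LoopLT₁ c x y := by
  simp only [LoopLT₁, (cellEquiv i).surjective.exists, neg_cellEquiv, loop_cellEquiv,
    loopInclEq_cellEquiv, transGen_zigStep_cellEquiv]

theorem minLoops_cellEquiv : cellEquiv i x ∈ D.MinLoops (cellEquiv i c) ↔ x ∈ C.MinLoops c := by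
  simp only [MinLoops, Set.mem_ofPred_eq, Set.mem_inter_iff, (cellEquiv i).surjective.exists,
    pos_cellEquiv, loop_cellEquiv, lam_cellEquiv, null_cellEquiv]

theorem loopLT_cellEquiv :
    D.LoopLT (cellEquiv i c) (cellEquiv i x) (cellEquiv i y) ↔ C.LoopLT c x y := by
  simp only [LoopLT, LoopLT₂, (cellEquiv i).surjective.exists, neg_cellEquiv, loop_cellEquiv,
    loopInclEq_cellEquiv, loopLT₁_cellEquiv, minLoops_cellEquiv, lam_cellEquiv,
    localLT_cellEquiv, ne_eq, EmbeddingLike.apply_eq_iff_eq]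

theorem white_cellEquiv : cellEquiv i x ∈ D.White (cellEquiv i c) ↔ x ∈ C.White c := by
  simp only [White, Set.mem_ofPred_eq, Set.mem_inter_iff, (cellEquiv i).surjective.exists,
    mem_γ_cellEquiv, lam_cellEquiv, null_cellEquiv]

theorem whiteLT_cellEquiv :
    D.WhiteLT (cellEquiv i c) (cellEquiv i x) (cellEquiv i y) ↔ C.WhiteLT c x y := by
  simp only [WhiteLT, (cellEquiv i).surjective.exists, mem_γ_cellEquiv, loopLT_cellEquiv]

theorem isGreatestCell_cellEquiv : D.IsGreatestCell (cellEquiv i x) ↔ C.IsGreatestCell x := by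
  simp only [IsGreatestCell, Le, (cellEquiv i).surjective.forall]
  refine forall_congr' fun y => reflTransGen_equiv_iff _ fun y x => ?_
  simp only [Set.mem_union, mem_γ_cellEquiv, mem_δ_cellEquiv]

theorem isIteratedTarget_cellEquiv :
    D.IsIteratedTarget (cellEquiv i x) ↔ C.IsIteratedTarget x := by
  simp only [IsIteratedTarget, (cellEquiv i).surjective.exists, isGreatestCell_cellEquiv]
  refine exists_congr fun ω => and_congr_right fun _ => reflTransGen_equiv_iff _ fun y x => ?_
  exact mem_γ_cellEquiv i

/-- The bijection between the names given by an isomorphism. -/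
def nameEquiv : C.ZoomName ≃ D.ZoomName := (cellEquiv i).sumCongr (Equiv.refl _)

theorem exists_white_nameEquiv (v : C.ZoomName) : (∃ w ∈ C.White c, .inl w = v) ↔
    ∃ w ∈ D.White (cellEquiv i c), .inl w = nameEquiv i v := by
  rcases v with v | v
  · simp [nameEquiv, white_cellEquiv]
  · simp [nameEquiv]

theorem unaryData_isIsoVia (v : C.ZoomName) {v' : D.ZoomName} (hv : nameEquiv i v = v') :
    DotTree.IsIsoVia (nameEquiv i) (C.unaryData v).toDotTree (D.unaryData v').toDotTree where
  mem_nodes w := by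
    subst hv
    simp [unaryData]
  mem_edges w := by
    simp only [TreeData.mem_toDotTree_edges, unaryData, mem_nameFinset]
    rcases w with w | w <;> simp [nameEquiv]
  target a b h := by
    rw [TreeData.toDotTree_target_eq_iff] at h ⊢
    exact congrArg (nameEquiv i) h
  targetNode b a := by
    rw [TreeData.toDotTree_targetNode_eq_iff, TreeData.toDotTree_targetNode_eq_iff]
    exact (nameEquiv i).apply_eq_iff_eq (y := C.leafName) |>.symm
  root := rfl

namespace IsDFC

theorem height_eq (hC : C.IsDFC) (hD : D.IsDFC) (i : C ≅ D) : hC.height = hD.height := by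
  have h : Set.range D.dim = Set.range C.dim := by
    ext d
    simp only [Set.mem_range, (cellEquiv i).surjective.exists, dim_cellEquiv]
  have h1 := hD.hasDim
  rw [HasDim, h] at h1
  exact_mod_cast hC.hasDim.unique h1

theorem levelTree_isIsoVia (hC : C.IsDFC) (hD : D.IsDFC) {k : ℕ} (hk : k ≤ hC.height)
    (hk' : k ≤ hD.height) :
    DotTree.IsIsoVia (nameEquiv i) (hC.levelTree k hk) (hD.levelTree k hk') where
  mem_nodes v := by
    rw [mem_levelTree_nodes, mem_levelTree_nodes]
    rcases v with v | v
    · simp [nameEquiv, lam_cellEquiv, dim_cellEquiv]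
    · simp [nameEquiv]
  mem_edges v := by
    rw [mem_levelTree_edges, mem_levelTree_edges]
    rcases v with v | v
    · simp [nameEquiv, dim_cellEquiv]
    · simp [nameEquiv]
  target x y h := by
    obtain ⟨a, -, -, ha⟩ := (hC.mem_levelTree_nodes hk).1 x.2
    obtain ⟨c, -, hc⟩ := (hC.mem_levelTree_edges hk).1 y.2
    refine (hD.levelTree_target_eq_iff hk' ?_ ?_).2
      ((pos_cellEquiv i).2 ((hC.levelTree_target_eq_iff hk ha hc).1 h))
    exacts [congrArg (nameEquiv i) ha, congrArg (nameEquiv i) hc]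
  targetNode y x := by
    obtain ⟨a, -, -, ha⟩ := (hC.mem_levelTree_nodes hk).1 x.2
    obtain ⟨c, -, hc⟩ := (hC.mem_levelTree_edges hk).1 y.2
    refine (hC.levelTree_targetNode_eq_iff hk ha hc).trans ((neg_cellEquiv i).symm.trans ?_)
    refine (hD.levelTree_targetNode_eq_iff hk' ?_ ?_).symm
    exacts [congrArg (nameEquiv i) ha, congrArg (nameEquiv i) hc]
  root := by
    -- The roots are picked by choice on both sides; they match because the iterated target of a
    -- given dimension is unique.
    have h := (hC.exists_isIteratedTarget_dim hk).choose_spec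
    have h' := (hD.exists_isIteratedTarget_dim hk').choose_spec
    exact congrArg _ (hD.isIteratedTarget_unique ((isIteratedTarget_cellEquiv i).2 h.1) h'.1
      (by rw [h'.2, dim_cellEquiv, h.2]))

theorem zoomTree_isIsoVia (hC : C.IsDFC) (hD : D.IsDFC) : ∀ (k : ℕ) (hk : k ≤ hC.height)
    (hk' : k ≤ hD.height),
    DotTree.IsIsoVia (nameEquiv i) (hC.zoomTree k hk) (hD.zoomTree k hk')
  | 0, _, _ => unaryData_isIsoVia i _ rfl
  | 1, _, _ => unaryData_isIsoVia i _ (congrArg _ (hD.eq_lamZero_iff.2 (by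
      obtain ⟨h1, h2⟩ := hC.eq_lamZero_iff.1 rfl
      exact ⟨(lam_cellEquiv i).2 h1, (dim_cellEquiv i).trans h2⟩)))
  | _ + 2, _, _ => hC.levelTree_isIsoVia i hD _ _

theorem zoomObj_isIsoVia (hC : C.IsDFC) (hD : D.IsDFC) :
    KJBM.IsIsoVia hC.zoomObj hD.zoomObj (nameEquiv i) where
  dim_eq := hC.height_eq hD i
  tree k hk := hC.zoomTree_isIsoVia i hD k hk _
  mem_W k hk b v := by
    match k, hk, b with
    | 0, _, b => exact ⟨fun h => (Finset.notMem_empty _ h).elim,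
        fun h => (Finset.notMem_empty _ h).elim⟩
    | 1, _, b => exact ⟨fun h => (Finset.notMem_empty _ h).elim,
        fun h => (Finset.notMem_empty _ h).elim⟩
    | k + 2, hk, b =>
      have hk' : k ≤ hC.height := le_trans (Nat.le_add_right k 3) hk
      obtain ⟨c, -, hc⟩ := (hC.mem_levelTree_edges hk').1 b.2
      refine (hC.mem_levelSub_W hk' hc).trans (Iff.trans ?_
        (hD.mem_levelSub_W (c := cellEquiv i c) (hC.height_eq hD i ▸ hk') ?_).symm)
      exacts [exists_white_nameEquiv i v, congrArg (nameEquiv i) hc]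
  lt_iff k hk b w w' := by
    match k, hk, b, w, w' with
    | 0, _, b, w, _ => exact (Finset.notMem_empty _ w.2).elim
    | 1, _, b, w, _ => exact (Finset.notMem_empty _ w.2).elim
    | k + 2, hk, b, w, w' =>
      have hk' : k ≤ hC.height := le_trans (Nat.le_add_right k 3) hk
      obtain ⟨c, -, hc⟩ := (hC.mem_levelTree_edges hk').1 b.2
      obtain ⟨v, -, hv⟩ := (hC.mem_levelSub_W hk' hc).1 w.2
      obtain ⟨v', -, hv'⟩ := (hC.mem_levelSub_W hk' hc).1 w'.2
      refine (hC.levelSub_lt_iff hk' hc hv hv').trans ((whiteLT_cellEquiv i).symm.trans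
        (hD.levelSub_lt_iff (hC.height_eq hD i ▸ hk') ?_ ?_ ?_).symm)
      exacts [congrArg (nameEquiv i) hc, congrArg (nameEquiv i) hv, congrArg (nameEquiv i) hv']

end IsDFC

end Iso

/-- The functor from dendritic face complexes to opetopes. -/
noncomputable def zoomFunctor : Core DFC.{u} ⥤ KJBM.{u} where
  obj C := C.of.property.zoomObj
  map {C D} f := (C.of.property.zoomObj_isIsoVia
    ((ObjectProperty.ι (C := MOP.{u}) MOP.IsDFC).mapIso f.iso) D.of.property).hom
  map_id C := by
    refine KJBM.hom_ext_names (fun k h a => ?_) (fun k h b => ?_) (fun k h w => ?_)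
    · exact congrArg (fun F : C.of.obj.ZoomName → C.of.obj.ZoomName => F a.1) Sum.map_id_id
    · exact congrArg (fun F : C.of.obj.ZoomName → C.of.obj.ZoomName => F b.1) Sum.map_id_id
    · exact congrArg (fun F : C.of.obj.ZoomName → C.of.obj.ZoomName => F w.2.1) Sum.map_id_id
  map_comp {C D E} f g := by
    have key : ∀ v : C.of.obj.ZoomName,
        nameEquiv ((ObjectProperty.ι (C := MOP.{u}) MOP.IsDFC).mapIso (f ≫ g).iso) v =
          nameEquiv ((ObjectProperty.ι (C := MOP.{u}) MOP.IsDFC).mapIso g.iso)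
            (nameEquiv ((ObjectProperty.ι (C := MOP.{u}) MOP.IsDFC).mapIso f.iso) v) := by
      rintro (v | v) <;> rfl
    exact KJBM.hom_ext_names (fun _ _ a => key a.1) (fun _ _ b => key b.1)
      (fun _ _ w => key w.2.1)

end MOP

theorem mainTheorem2 :
    ∃ (Z : Core DFC.{u} ⥤ KJBM.{u})
      (ι : ∀ C : Core DFC.{u}, C.of.obj.Cell ↪ (Z.obj C).Name),
      (∀ C : Core DFC.{u}, IsZoomOf C.of.obj (Z.obj C) (ι C)) ∧
      ∀ (C D : Core DFC.{u}) (f : C ⟶ D),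
        ActsAs (ι C) (ι D) f.iso.hom.hom (Z.map f) :=
  ⟨MOP.zoomFunctor, fun _ => Function.Embedding.inl, fun C => C.of.property.isZoomOf,
    fun C D f =>
      have key : ∀ (v : C.of.obj.ZoomName) (x : C.of.obj.Cell), .inl x = v →
          MOP.nameEquiv ((ObjectProperty.ι (C := MOP.{u}) MOP.IsDFC).mapIso f.iso) v =
            .inl (f.iso.hom.hom.toFun x) := by
        rintro _ x rfl
        rfl
      { node_one := fun _ a x hx => key a.1 x hx
        node := fun _ _ a x hx => key a.1 x hx
        edge := fun _ _ b x hx => key b.1 x hx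
        white := fun _ _ w x hx => key w.2.1 x hx }⟩
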